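/- **Setting.** Let $(\mathcal X,\rho_{\mathcal X})$ and $(\mathcal Y,\rho_{\mathcal Y})$ be separable metric spaces with their Borel $\sigma$-algebras, $\mathcal Y\neq\emptyset$, and let $\ell=\rho_{\mathcal Y}^{\alpha}$ with $\alpha\ge 1$. *Learning rules.* An online learning rule $f_\cdot$ consists of a measurable space $\mathcal R$ of private randomness, probability distributions $R_t$ on $\mathcal R$ and measurable functions $f_t:\mathcal R\times\mathcal X^{t-1}\times\mathcal Y^{t-1}\times\mathcal X\to\mathcal Y$, $t\ge1$. Its prediction at time $t$ is $\hat Y_t=f_t(r_t,(X_u)_{u<t},(Y_u)_{u<t},X_t)$, where the $r_t\sim R_t$ are independent over time. An online learning rule $g_\cdot$ for mean estimation is the same without instances: $g_t:\mathcal R\times\mathcal Y^{t-1}\to\mathcal Y$. *Adversarial responses.* An adversarial response mechanism on a process $\mathbb X=(X_t)_{t\ge1}$ in $\mathcal X$ is a stochastic process $(\tilde X_t,\mathbf Y_t)_{t\ge1}$, independent of the learner's randomness $(r_t)_t$, where $(\tilde X_t)_t$ has the law of $\mathbb X$ and $\mathbf Y_t$ is a (random) Markov kernel from $\mathcal R^{t-1}$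 to $\mathcal Y$. The value at time $t$ is drawn as $Y_t\sim\mathbf Y_t(\cdot\mid r_1,\dots,r_{t-1})$, independently over $t$ given the mechanism and $(r_u)_{u}$. The responses are empirically integrable if there is $y_0\in\mathcal Y$ such that for every $\epsilon>0$, almost surely there is $M\ge0$ with $\limsup_{T}\frac1T\sum_{t=1}^T\ell(y_0,Y_t)\mathbf 1_{\ell(y_0,Y_t)\ge M}\le\epsilon$ (this is automatic when $\ell$ is bounded). *Consistency.* A rule $f_\cdot$ is universally consistent under $\mathbb X$ if for every adversarial response mechanism on $\mathbb X$ with empirically integrable responses and every measurable $f^*:\mathcal X\to\mathcal Y$, $$\limsup_{T\to\infty}\frac1T\sum_{t=1}^T\bigl(\ell(\hat Y_t,Y_t)-\ell(f^*(\tilde X_t),Y_t)\bigr)\le0\quad\text{almost surely.}$$ $\mathrm{SOLAR}$ is the set of processes $\mathbb X$ on $\mathcal X$ (identified with their laws) under which some learning rule, possibly depending on $\mathbb X$, is universally consistent. A rule is optimistically universal if it is universally consistent under every $\mathbb X\in\mathrm{SOLAR}$. *Condition $\mathrm{CS}$.* $\mathbb X\in\mathrm{CS}$ if for every decreasing sequence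 $(A_k)_{k\ge1}$ of measurable subsets of $\mathcal X$ with $\bigcap_kA_k=\emptyset$, $\mathbb E\bigl[\limsup_{T\to\infty}\frac1T\sum_{t=1}^T\mathbf 1_{A_k}(X_t)\bigr]\to0$ as $k\to\infty$. *Property F-TiME.* For every $\eta>0$ there are $T_\eta\ge1$ and an online learning rule $g_\cdot$ for mean estimation such that for all $y_1,\dots,y_{T_\eta}\in\mathcal Y$ and all $y\in\mathcal Y$, $\frac1{T_\eta}\mathbb E\bigl[\sum_{t=1}^{T_\eta}\bigl(\ell(g_t(r_t,(y_u)_{u<t}),y_t)-\ell(y,y_t)\bigr)\bigr]\le\eta$. **Theorem.** Suppose that $\ell$ is bounded and that $(\mathcal Y,\ell)$ does not satisfy F-TiME. Then $\mathrm{SOLAR}=\mathrm{CS}$ (in particular, no learning rule is universally consistent under any $\mathbb X\notin\mathrm{CS}$), and there exists an optimistically universal learning rule, that is, a single rule that is universally consistent under every process $\mathbb X\in\mathrm{CS}$. -/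

import Mathlib

open MeasureTheory ProbabilityTheory Filter Topology

universe u

/-- The loss `ℓ = ρ ^ α`, a power of the metric of the value space. -/
noncomputable def powLoss {𝒴 : Type u} [MetricSpace 𝒴] (α : ℝ) (y y' : 𝒴) : ℝ :=
  dist y y' ^ α

/-- The average of the first `T` terms of a real sequence (time starts at `0`). -/
noncomputable def timeAverage (a : ℕ → ℝ) (T : ℕ) : ℝ :=
  (1 / (T : ℝ)) * ∑ t ∈ Finset.range T, a t

/-- A (randomized) online learning rule on instances `𝒳` and values `𝒴`: a space `R` of private
randomness, the law `ν t` on `R` of the randomness used at time `t`, and the measurable prediction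
function at time `t`, which receives that randomness, the `t` past instances, the `t` past values
and the new instance. -/
structure OnlineLearningRule (𝒳 𝒴 : Type u) [MeasurableSpace 𝒳] [MeasurableSpace 𝒴] where
  R : Type u
  [instR : MeasurableSpace R]
  ν : ℕ → ProbabilityMeasure R
  predict : (t : ℕ) → R × (Fin t → 𝒳) × (Fin t → 𝒴) × 𝒳 → 𝒴
  measurable_predict : ∀ t, Measurable (predict t)

attribute [instance] OnlineLearningRule.instR

/-- A (randomized) online learning rule for mean estimation on `𝒴`: the same without instances. -/
structure MeanEstimationRule (𝒴 : Type u) [MeasurableSpace 𝒴] where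
  R : Type u
  [instR : MeasurableSpace R]
  ν : ℕ → ProbabilityMeasure R
  predict : (t : ℕ) → R × (Fin t → 𝒴) → 𝒴
  measurable_predict : ∀ t, Measurable (predict t)

attribute [instance] MeanEstimationRule.instR

/-- Finite-time mean estimation. Only the first `T` entries of `y` and the first `T` prediction
functions of `g` play a role. -/
def FTiME {𝒴 : Type u} [MeasurableSpace 𝒴] (ℓ : 𝒴 → 𝒴 → ℝ) : Prop :=
  ∀ η : ℝ, 0 < η → ∃ T : ℕ, 1 ≤ T ∧ ∃ g : MeanEstimationRule 𝒴, ∀ (y : ℕ → 𝒴) (y₀ : 𝒴),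
    (1 / (T : ℝ)) * ∫ r, (∑ t ∈ Finset.range T,
        (ℓ (g.predict t (r t, fun s : Fin t => y s)) (y t) - ℓ y₀ (y t)))
      ∂(Measure.infinitePi fun t => (g.ν t : Measure g.R)) ≤ η

/-- The limiting upper frequency of visits of the path `x` to the set `A`. -/
noncomputable def upperFrequency {𝒳 : Type u} (x : ℕ → 𝒳) (A : Set 𝒳) : ℝ :=
  limsup (timeAverage fun t => A.indicator (fun _ => (1 : ℝ)) (x t)) atTop

/-- Condition CS (continuous sub-measure); a process is given by its law on `ℕ → 𝒳`. -/
def CS (𝒳 : Type u) [MeasurableSpace 𝒳] : Set (ProbabilityMeasure (ℕ → 𝒳)) :=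
  {μ | ∀ A : ℕ → Set 𝒳, (∀ k, MeasurableSet (A k)) → Antitone A → ⋂ k, A k = ∅ →
    Tendsto (fun k => ∫ x, upperFrequency x (A k) ∂(μ : Measure (ℕ → 𝒳))) atTop (𝓝 0)}

/-- An adversarial response mechanism on a process of law `μ`, against a learner with private
randomness in `R`: on a probability space `Ω`, an instance process `X` of law `μ` together with a
stochastic process `Y` of Markov kernels, `Y t (ω, ·)` being a kernel from `R ^ t` (the past
private randomness) to `𝒴`. -/
structure AdversarialMechanism (R : Type u) [MeasurableSpace R] {𝒳 : Type u} [MeasurableSpace 𝒳]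
    (μ : ProbabilityMeasure (ℕ → 𝒳)) (𝒴 : Type u) [MeasurableSpace 𝒴] where
  Ω : Type u
  [instΩ : MeasurableSpace Ω]
  P : ProbabilityMeasure Ω
  X : ℕ → Ω → 𝒳
  measurable_X : ∀ t, Measurable (X t)
  law_X : (P : Measure Ω).map (fun ω t => X t ω) = (μ : Measure (ℕ → 𝒳))
  Y : (t : ℕ) → Kernel (Ω × (Fin t → R)) 𝒴
  [markov_Y : ∀ t, IsMarkovKernel (Y t)]

attribute [instance] AdversarialMechanism.instΩ AdversarialMechanism.markov_Y

namespace AdversarialMechanism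

variable {R 𝒳 𝒴 : Type u} [MeasurableSpace R] [MeasurableSpace 𝒳] [MeasurableSpace 𝒴]
  {μ : ProbabilityMeasure (ℕ → 𝒳)}

theorem measurable_infinitePi_Y (M : AdversarialMechanism R μ 𝒴) :
    Measurable fun p : M.Ω × (ℕ → R) =>
      Measure.infinitePi fun t => M.Y t (p.1, fun s : Fin t => p.2 s) := by
  refine Measurable.measure_of_isPiSystem_of_isProbabilityMeasure
    (generateFrom_squareCylinders (α := fun _ : ℕ => 𝒴)).symm
    (isPiSystem_squareCylinders (fun _ => MeasurableSpace.isPiSystem_measurableSet)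
      (fun _ => MeasurableSet.univ)) ?_
  rintro _ ⟨s, S, hS, rfl⟩
  have hS' : ∀ i, MeasurableSet (S i) := fun i => hS i (Set.mem_univ i)
  have h : (fun p : M.Ω × (ℕ → R) =>
      (Measure.infinitePi fun t => M.Y t (p.1, fun s : Fin t => p.2 s)) ((s : Set ℕ).pi S))
      = fun p => ∏ t ∈ s, M.Y t (p.1, fun s : Fin t => p.2 s) (S t) := by
    funext p
    exact Measure.infinitePi_pi _ (fun i _ => hS' i)
  rw [h]
  refine Finset.measurable_prod s fun t _ => ?_
  exact ((M.Y t).measurable_coe (hS' t)).comp (by fun_prop)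

/-- Given the state `ω` and the whole private randomness `r`, the values are drawn independently,
the one at time `t` from `Y t (ω, r 0, …, r (t - 1))`. -/
noncomputable def responseKernel (M : AdversarialMechanism R μ 𝒴) :
    Kernel (M.Ω × (ℕ → R)) (ℕ → 𝒴) where
  toFun p := Measure.infinitePi fun t => M.Y t (p.1, fun s : Fin t => p.2 s)
  measurable' := M.measurable_infinitePi_Y

instance (M : AdversarialMechanism R μ 𝒴) : IsMarkovKernel M.responseKernel :=
  ⟨fun p => inferInstanceAs (IsProbabilityMeasure
    (Measure.infinitePi fun t => M.Y t (p.1, fun s : Fin t => p.2 s)))⟩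

/-- The joint law of the state, of the learner's private randomness (independent of the state and
over time, of law `ν t` at time `t`) and of the realized values. -/
noncomputable def runLaw (M : AdversarialMechanism R μ 𝒴) (ν : ℕ → ProbabilityMeasure R) :
    Measure ((M.Ω × (ℕ → R)) × (ℕ → 𝒴)) :=
  ((M.P : Measure M.Ω).prod (Measure.infinitePi fun t => (ν t : Measure R))) ⊗ₘ M.responseKernel

instance (M : AdversarialMechanism R μ 𝒴) (ν : ℕ → ProbabilityMeasure R) :
    IsProbabilityMeasure (M.runLaw ν) :=
  inferInstanceAs (IsProbabilityMeasure (_ ⊗ₘ M.responseKernel))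

/-- The values realized against private randomness of laws `ν` are empirically integrable. -/
def EmpiricallyIntegrable (M : AdversarialMechanism R μ 𝒴) (ν : ℕ → ProbabilityMeasure R)
    (ℓ : 𝒴 → 𝒴 → ℝ) : Prop :=
  ∃ y₀ : 𝒴, ∀ ε : ℝ, 0 < ε → ∀ᵐ z ∂(M.runLaw ν), ∃ B : ℝ, 0 ≤ B ∧
    limsup (fun T => ((timeAverage (fun t => {y | B ≤ ℓ y₀ y}.indicator (ℓ y₀) (z.2 t)) T : ℝ)
      : EReal)) atTop ≤ (ε : EReal)

end AdversarialMechanism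

namespace OnlineLearningRule

variable {𝒳 𝒴 : Type u} [MeasurableSpace 𝒳] [MeasurableSpace 𝒴]

/-- The prediction at time `t` on the private randomness `r`, instances `x` and values `y`. -/
def prediction (f : OnlineLearningRule 𝒳 𝒴) (r : ℕ → f.R) (x : ℕ → 𝒳) (y : ℕ → 𝒴) (t : ℕ) : 𝒴 :=
  f.predict t (r t, fun s : Fin t => x s, fun s : Fin t => y s, x t)

/-- The long-run average excess loss over the comparator `h`. -/
noncomputable def excessLoss (f : OnlineLearningRule 𝒳 𝒴) (ℓ : 𝒴 → 𝒴 → ℝ) (h : 𝒳 → 𝒴)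
    (r : ℕ → f.R) (x : ℕ → 𝒳) (y : ℕ → 𝒴) : EReal :=
  limsup (fun T => ((timeAverage
    (fun t => ℓ (f.prediction r x y t) (y t) - ℓ (h (x t)) (y t)) T : ℝ) : EReal)) atTop

/-- Consistency under an adversarial process. -/
def Consistent (f : OnlineLearningRule 𝒳 𝒴) (ℓ : 𝒴 → 𝒴 → ℝ) {μ : ProbabilityMeasure (ℕ → 𝒳)}
    (M : AdversarialMechanism f.R μ 𝒴) : Prop :=
  ∀ h : 𝒳 → 𝒴, Measurable h →
    ∀ᵐ z ∂(M.runLaw f.ν), f.excessLoss ℓ h z.1.2 (fun t => M.X t z.1.1) z.2 ≤ 0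

/-- Universal consistency under a process of law `μ`, for empirically integrable adversarial
responses. -/
def UniversallyConsistent (f : OnlineLearningRule 𝒳 𝒴) (ℓ : 𝒴 → 𝒴 → ℝ)
    (μ : ProbabilityMeasure (ℕ → 𝒳)) : Prop :=
  ∀ M : AdversarialMechanism f.R μ 𝒴, M.EmpiricallyIntegrable f.ν ℓ → f.Consistent ℓ M

end OnlineLearningRule

/-- The (laws of) processes under which some learning rule is universally consistent. -/
def SOLAR (𝒳 : Type u) {𝒴 : Type u} [MeasurableSpace 𝒳] [MeasurableSpace 𝒴] (ℓ : 𝒴 → 𝒴 → ℝ) :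
    Set (ProbabilityMeasure (ℕ → 𝒳)) :=
  {μ | ∃ f : OnlineLearningRule 𝒳 𝒴, f.UniversallyConsistent ℓ μ}

/-- A learning rule is optimistically universal if it is universally consistent under every process
in `SOLAR`. -/
def OptimisticallyUniversal {𝒳 𝒴 : Type u} [MeasurableSpace 𝒳] [MeasurableSpace 𝒴]
    (ℓ : 𝒴 → 𝒴 → ℝ) (f : OnlineLearningRule 𝒳 𝒴) : Prop :=
  ∀ μ ∈ SOLAR 𝒳 ℓ, f.UniversallyConsistent ℓ μ

/-! CS is sufficient. For a process in CS, the expected upper frequency `meanFrequency μ` is a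
monotone, subadditive set function which is continuous along measurable sets decreasing to the empty
set. As for a finite measure, this suffices to approximate every measurable set by a member of a
countable generating algebra, and every measurable function by a countable family of simple
functions. That family does not depend on the process (`exists_dense_class`), so one rule can serve
all of CS. The rule runs multiplicative weights over pairs (function, learning rate). Against each
pair its average regret is asymptotically at most a multiple of the rate (`sum_prodLoss_sub_le`),
and every function occurs with arbitrarily small rates. The randomness used at time `t` is
independent of the past and of the response at time `t` (`AdversarialMechanism.runLaw_map_past`), so
realized losses deviate from the forecaster's losses by bounded orthogonal variables, whose averages
vanish almost surely. Uniform continuity of the bounded loss then passes from the dense family to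
any measurable comparator.

CS is necessary. If CS fails, `𝒳` splits into levels and time into fast-growing blocks such that,
with probability bounded below in each block `i`, the path visits level `i` during a positive
fraction of the times up to some horizon in the block and visits no higher level before the block
ends (`exists_blocks_of_notMem_CS`). The adversary sees the whole path, hence the horizon. On the
first visits to level `i` it plays values that are hard for mean estimation; at the other visits to
levels at most `i` it plays the value of the comparator, where the comparator loses nothing.
Conditionally on the horizon, the learner facing the hard values is itself a mean estimation rule
(`simulationRule`), and the failure of F-TiME makes it lose.

The difficulty is that the comparator must take one value on each level, whereas each possible
horizon produces a different rule to defeat with a different number of plays.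
`exists_common_comparator` resolves this without a minimax theorem. The same forecaster combines
finitely many rules, each restarted periodically at its own horizon, into a single rule. A sequence
and a comparator value that defeat the combination must defeat every component on one of its
restarts, with that same comparator value. The hard values are thus fixed in advance, level by level
(`recSeq`), and the adversary is a deterministic function of the path. The expected average regret
at the horizon of block `i` stays above a positive constant up to a vanishing error, while
consistency and bounded convergence force its positive part to zero. -/

/-! ### The forecaster: multiplicative weights over a growing list of experts -/

/-- The first `n` weights `κ j * w j`, normalized. -/
noncomputable def normalizedWeight (κ w : ℕ → ℝ) (n j : ℕ) : ℝ :=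
  κ j * w j / ∑ i ∈ Finset.range n, κ i * w i

/-- The average of the losses `a` of the first `n` experts, under the normalized weights. -/
noncomputable def mixLoss (κ w : ℕ → ℝ) (n : ℕ) (a : ℕ → ℝ) : ℝ :=
  ∑ j ∈ Finset.range n, normalizedWeight κ w n j * a j

/-- The weights of the experts of losses `a t j` and learning rates `κ j` at time `t`. Expert `j`
is inactive before time `j`. -/
noncomputable def prodWeight (κ : ℕ → ℝ) (a : ℕ → ℕ → ℝ) : ℕ → ℕ → ℝ
  | 0 => fun j => (1 / 2) ^ (j + 1)
  | t + 1 => fun j => prodWeight κ a t j *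
      (1 + if j ≤ t then κ j * (mixLoss κ (prodWeight κ a t) (t + 1) (a t) - a t j) else 0)

/-- The probability given at time `t` to expert `j`. -/
noncomputable def prodProb (κ : ℕ → ℝ) (a : ℕ → ℕ → ℝ) (t j : ℕ) : ℝ :=
  normalizedWeight κ (prodWeight κ a t) (t + 1) j

/-- The expected loss of the forecaster at time `t`. -/
noncomputable def prodLoss (κ : ℕ → ℝ) (a : ℕ → ℕ → ℝ) (t : ℕ) : ℝ :=
  ∑ j ∈ Finset.range (t + 1), prodProb κ a t j * a t j

theorem prodWeight_succ (κ : ℕ → ℝ) (a : ℕ → ℕ → ℝ) (t j : ℕ) :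
    prodWeight κ a (t + 1) j = prodWeight κ a t j *
      (1 + if j ≤ t then κ j * (prodLoss κ a t - a t j) else 0) := rfl

/-- This causality lets the rules below compute their probabilities from past losses alone, padding
the future arbitrarily. -/
theorem prodWeight_congr {κ : ℕ → ℝ} {a b : ℕ → ℕ → ℝ} {t : ℕ} (h : ∀ s < t, a s = b s) :
    prodWeight κ a t = prodWeight κ b t := by
  induction t with
  | zero => rfl
  | succ t ih =>
    have h1 := ih fun s hs => h s (by omega)
    funext j
    simp only [prodWeight, h1, h t (by omega)]

theorem prodProb_congr {κ : ℕ → ℝ} {a b : ℕ → ℕ → ℝ} {t : ℕ} (h : ∀ s < t, a s = b s) :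
    prodProb κ a t = prodProb κ b t := by
  funext j
  simp only [prodProb, prodWeight_congr h]

section Bounds

variable {κ : ℕ → ℝ} {a : ℕ → ℕ → ℝ} {C : ℝ}

theorem normalizedWeight_nonneg {w : ℕ → ℝ} (hκ : ∀ j, 0 < κ j) (hw : ∀ j, 0 < w j) (n j : ℕ) :
    0 ≤ normalizedWeight κ w n j :=
  div_nonneg (mul_nonneg (hκ j).le (hw j).le)
    (Finset.sum_nonneg fun i _ => mul_nonneg (hκ i).le (hw i).le)

theorem sum_range_mul_pos {w : ℕ → ℝ} (hκ : ∀ j, 0 < κ j) (hw : ∀ j, 0 < w j) (n : ℕ) :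
    0 < ∑ i ∈ Finset.range (n + 1), κ i * w i :=
  Finset.sum_pos (fun i _ => mul_pos (hκ i) (hw i)) ⟨0, by simp⟩

theorem sum_normalizedWeight {w : ℕ → ℝ} (hκ : ∀ j, 0 < κ j) (hw : ∀ j, 0 < w j) (n : ℕ) :
    ∑ j ∈ Finset.range (n + 1), normalizedWeight κ w (n + 1) j = 1 := by
  simp only [normalizedWeight, ← Finset.sum_div]
  exact div_self (sum_range_mul_pos hκ hw n).ne'

theorem mixLoss_mem {w : ℕ → ℝ} (hκ : ∀ j, 0 < κ j) (hw : ∀ j, 0 < w j) (n : ℕ) {b : ℕ → ℝ}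
    (hb : ∀ j, b j ∈ Set.Icc 0 C) : mixLoss κ w (n + 1) b ∈ Set.Icc 0 C := by
  refine ⟨Finset.sum_nonneg fun j _ =>
    mul_nonneg (normalizedWeight_nonneg hκ hw _ _) (hb j).1, ?_⟩
  calc mixLoss κ w (n + 1) b
      ≤ ∑ j ∈ Finset.range (n + 1), normalizedWeight κ w (n + 1) j * C :=
        Finset.sum_le_sum fun j _ =>
          mul_le_mul_of_nonneg_left (hb j).2 (normalizedWeight_nonneg hκ hw _ _)
    _ = C := by rw [← Finset.sum_mul, sum_normalizedWeight hκ hw, one_mul]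

theorem abs_rate_mul_le (hκ : ∀ j, 0 < κ j) (hC : ∀ j, κ j * C ≤ 1 / 2) {x y : ℝ}
    (hx : x ∈ Set.Icc 0 C) (hy : y ∈ Set.Icc 0 C) (j : ℕ) : |κ j * (x - y)| ≤ 1 / 2 := by
  rw [abs_mul, abs_of_pos (hκ j)]
  refine le_trans (mul_le_mul_of_nonneg_left ?_ (hκ j).le) (hC j)
  rw [abs_le]
  constructor <;> linarith [hx.1, hx.2, hy.1, hy.2]

theorem prodWeight_pos (hκ : ∀ j, 0 < κ j) (hC : ∀ j, κ j * C ≤ 1 / 2)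
    (ha : ∀ t j, a t j ∈ Set.Icc 0 C) (t : ℕ) : ∀ j, 0 < prodWeight κ a t j := by
  induction t with
  | zero => intro j; simp only [prodWeight]; positivity
  | succ t ih =>
    intro j
    rw [prodWeight_succ]
    refine mul_pos (ih j) ?_
    split_ifs
    · have := abs_rate_mul_le hκ hC (mixLoss_mem hκ ih t (ha t)) (ha t j) j
      have h2 := (abs_le.1 this).1
      change 0 < 1 + κ j * (mixLoss κ (prodWeight κ a t) (t + 1) (a t) - a t j)
      linarith
    · norm_num

theorem prodProb_nonneg (hκ : ∀ j, 0 < κ j) (hC : ∀ j, κ j * C ≤ 1 / 2)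
    (ha : ∀ t j, a t j ∈ Set.Icc 0 C) (t j : ℕ) : 0 ≤ prodProb κ a t j :=
  normalizedWeight_nonneg hκ (prodWeight_pos hκ hC ha t) _ _

theorem sum_prodProb (hκ : ∀ j, 0 < κ j) (hC : ∀ j, κ j * C ≤ 1 / 2)
    (ha : ∀ t j, a t j ∈ Set.Icc 0 C) (t : ℕ) :
    ∑ j ∈ Finset.range (t + 1), prodProb κ a t j = 1 :=
  sum_normalizedWeight hκ (prodWeight_pos hκ hC ha t) _

theorem prodLoss_mem (hκ : ∀ j, 0 < κ j) (hC : ∀ j, κ j * C ≤ 1 / 2)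
    (ha : ∀ t j, a t j ∈ Set.Icc 0 C) (t : ℕ) : prodLoss κ a t ∈ Set.Icc 0 C :=
  mixLoss_mem hκ (prodWeight_pos hκ hC ha t) t (ha t)

theorem prodWeight_of_le {t j : ℕ} (h : t ≤ j) : prodWeight κ a t j = (1 / 2) ^ (j + 1) := by
  induction t with
  | zero => rfl
  | succ t ih => rw [prodWeight_succ, ih (by omega), if_neg (by omega)]; ring

/-- The probabilities are proportional to `κ j * w j` rather than to `w j`, which makes the
first-order changes of the weights cancel although the rates differ. The mass of the active experts
therefore grows only through the entering expert, of weight `(1 / 2) ^ (t + 1)`. -/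
theorem sum_prodWeight (hκ : ∀ j, 0 < κ j) (hC : ∀ j, κ j * C ≤ 1 / 2)
    (ha : ∀ t j, a t j ∈ Set.Icc 0 C) (t : ℕ) :
    ∑ j ∈ Finset.range t, prodWeight κ a t j = 1 - (1 / 2) ^ t := by
  induction t with
  | zero => simp
  | succ t ih =>
    have h0 := sum_range_mul_pos hκ (prodWeight_pos hκ hC ha t) t
    have h1 : ∑ j ∈ Finset.range (t + 1),
        κ j * prodWeight κ a t j * (prodLoss κ a t - a t j) = 0 := by
      simp only [mul_sub, Finset.sum_sub_distrib, ← Finset.sum_mul]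
      rw [sub_eq_zero]
      simp only [prodLoss, prodProb, normalizedWeight]
      rw [Finset.mul_sum]
      refine Finset.sum_congr rfl fun j _ => ?_
      field_simp
    calc ∑ j ∈ Finset.range (t + 1), prodWeight κ a (t + 1) j
        = ∑ j ∈ Finset.range (t + 1), (prodWeight κ a t j
            + κ j * prodWeight κ a t j * (prodLoss κ a t - a t j)) := by
          refine Finset.sum_congr rfl fun j hj => ?_
          rw [prodWeight_succ, if_pos (by have := Finset.mem_range.1 hj; omega)]
          ring
      _ = 1 - (1 / 2) ^ (t + 1) := by
          rw [Finset.sum_add_distrib, h1, Finset.sum_range_succ, ih, prodWeight_of_le le_rfl]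
          ring

theorem prodWeight_le_one (hκ : ∀ j, 0 < κ j) (hC : ∀ j, κ j * C ≤ 1 / 2)
    (ha : ∀ t j, a t j ∈ Set.Icc 0 C) (t j : ℕ) : prodWeight κ a t j ≤ 1 := by
  rcases lt_or_ge j t with h | h
  · calc prodWeight κ a t j ≤ ∑ j ∈ Finset.range t, prodWeight κ a t j :=
          Finset.single_le_sum (f := fun j => prodWeight κ a t j)
            (fun i _ => (prodWeight_pos hκ hC ha t i).le) (Finset.mem_range.2 h)
      _ = 1 - (1 / 2) ^ t := sum_prodWeight hκ hC ha t
      _ ≤ 1 := by simp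
  · rw [prodWeight_of_le h]
    exact pow_le_one₀ (by norm_num) (by norm_num)

/-- Since `log (1 + x) ≥ x / (1 + x)`, it remains to note that `x / (1 + x) - (x - 2 * x ^ 2)`
equals `x ^ 2 * (1 + 2 * x) / (1 + x)`. -/
theorem sub_two_mul_sq_le_log {x : ℝ} (hx : |x| ≤ 1 / 2) : x - 2 * x ^ 2 ≤ Real.log (1 + x) := by
  have h := abs_le.1 hx
  have h1 : 0 < 1 + x := by linarith
  refine le_trans ?_ (Real.one_sub_inv_le_log_of_pos h1)
  rw [← sub_nonneg]
  have : 1 - (1 + x)⁻¹ - (x - 2 * x ^ 2) = x ^ 2 * (1 + 2 * x) / (1 + x) := by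
    field_simp; ring
  rw [this]
  exact div_nonneg (mul_nonneg (sq_nonneg x) (by linarith)) h1.le

/-- Each active round adds at least `κ j` times the regret, minus a quadratic error, to the
logarithm of the weight. The term `j + 1` pays for the initial weight and `κ j * (C * j)` for the
`j` rounds before expert `j` enters. -/
theorem sum_le_log_prodWeight (hκ : ∀ j, 0 < κ j) (hC : ∀ j, κ j * C ≤ 1 / 2)
    (ha : ∀ t j, a t j ∈ Set.Icc 0 C) (j T : ℕ) :
    κ j * ∑ t ∈ Finset.range T, (prodLoss κ a t - a t j)
      ≤ Real.log (prodWeight κ a T j) + (j + 1) + κ j * (C * j) + 2 * (κ j * C) ^ 2 * T := by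
  have hC0 : 0 ≤ C := (ha 0 0).1.trans (ha 0 0).2
  induction T with
  | zero =>
    have : Real.log ((1 / 2 : ℝ) ^ (j + 1)) = -((j + 1) * Real.log 2) := by
      rw [Real.log_pow, one_div, Real.log_inv]; push_cast; ring
    have h2 : Real.log 2 ≤ 1 := by linarith [Real.log_two_lt_d9]
    simp only [Finset.range_zero, Finset.sum_empty, mul_zero, prodWeight, this]
    have h3 : 0 ≤ κ j * (C * j) := by have := (hκ j).le; positivity
    have h4 : ((j : ℝ) + 1) * Real.log 2 ≤ (j + 1) * 1 :=
      mul_le_mul_of_nonneg_left h2 (by positivity)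
    simp only [CharP.cast_eq_zero, mul_zero]
    linarith
  | succ T ih =>
    have hl := prodLoss_mem hκ hC ha T
    rcases le_or_gt j T with h | h
    · have hx := abs_rate_mul_le hκ hC hl (ha T j) j
      have h1 := sub_two_mul_sq_le_log hx
      have h2 : (κ j * (prodLoss κ a T - a T j)) ^ 2 ≤ (κ j * C) ^ 2 := by
        rw [mul_pow, mul_pow]
        refine mul_le_mul_of_nonneg_left ?_ (sq_nonneg _)
        rw [sq_le_sq, abs_of_nonneg hC0, abs_le]
        constructor <;> linarith [hl.1, hl.2, (ha T j).1, (ha T j).2]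
      have hpos : 0 < 1 + κ j * (prodLoss κ a T - a T j) := by
        have := (abs_le.1 hx).1; linarith
      rw [prodWeight_succ, if_pos h,
        Real.log_mul (prodWeight_pos hκ hC ha T j).ne' hpos.ne', Finset.sum_range_succ, mul_add]
      push_cast
      linarith
    · rw [prodWeight_of_le (by omega : T + 1 ≤ j)]
      have h5 : Real.log ((1 / 2 : ℝ) ^ (j + 1)) = -((j + 1) * Real.log 2) := by
        rw [Real.log_pow, one_div, Real.log_inv]; push_cast; ring
      have h2 : Real.log 2 ≤ 1 := by linarith [Real.log_two_lt_d9]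
      have h4 : ((j : ℝ) + 1) * Real.log 2 ≤ (j + 1) * 1 :=
        mul_le_mul_of_nonneg_left h2 (by positivity)
      have h6 : ∑ t ∈ Finset.range (T + 1), (prodLoss κ a t - a t j) ≤ C * j := by
        calc ∑ t ∈ Finset.range (T + 1), (prodLoss κ a t - a t j)
            ≤ ∑ t ∈ Finset.range (T + 1), C := Finset.sum_le_sum fun t _ => by
              linarith [(prodLoss_mem hκ hC ha t).2, (ha t j).1]
          _ = (T + 1 : ℕ) * C := by simp
          _ ≤ j * C := mul_le_mul_of_nonneg_right (by exact_mod_cast h) hC0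
          _ = C * j := mul_comm _ _
      have h7 := mul_le_mul_of_nonneg_left h6 (hκ j).le
      have h8 : 0 ≤ 2 * (κ j * C) ^ 2 * ((T + 1 : ℕ) : ℝ) := by positivity
      linarith

/-- The regret bound of the forecaster. -/
theorem sum_prodLoss_sub_le (hκ : ∀ j, 0 < κ j) (hC : ∀ j, κ j * C ≤ 1 / 2)
    (ha : ∀ t j, a t j ∈ Set.Icc 0 C) (j T : ℕ) :
    ∑ t ∈ Finset.range T, (prodLoss κ a t - a t j)
      ≤ (j + 1) / κ j + C * j + 2 * κ j * C ^ 2 * T := by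
  have h1 := sum_le_log_prodWeight hκ hC ha j T
  have h2 : Real.log (prodWeight κ a T j) ≤ 0 :=
    Real.log_nonpos (prodWeight_pos hκ hC ha T j).le (prodWeight_le_one hκ hC ha T j)
  have h3 : κ j * ∑ t ∈ Finset.range T, (prodLoss κ a t - a t j)
      ≤ κ j * ((j + 1) / κ j + C * j + 2 * κ j * C ^ 2 * T) := by
    have : κ j * ((j + 1) / κ j + C * j + 2 * κ j * C ^ 2 * T)
        = (j + 1) + κ j * (C * j) + 2 * (κ j * C) ^ 2 * T := by
      have := (hκ j).ne'
      field_simp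
    rw [this]
    linarith
  exact le_of_mul_le_mul_left h3 (hκ j)

end Bounds

theorem measurable_prodWeight {Ω : Type*} [MeasurableSpace Ω] {κ : ℕ → ℝ}
    {a : Ω → ℕ → ℕ → ℝ} (ha : ∀ t j, Measurable fun ω => a ω t j) (t : ℕ) :
    ∀ j, Measurable fun ω => prodWeight κ (a ω) t j := by
  induction t with
  | zero => intro j; exact measurable_const
  | succ t ih =>
    intro j
    simp only [prodWeight, mixLoss, normalizedWeight]
    refine (ih j).mul (measurable_const.add ?_)
    split_ifs
    · refine measurable_const.mul (Measurable.sub ?_ (ha t j))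
      exact Finset.measurable_sum _ fun i _ => (((ih i).const_mul _).div
        (Finset.measurable_sum _ fun i _ => (ih i).const_mul _)).mul (ha t i)
    · exact measurable_const

theorem measurable_prodProb {Ω : Type*} [MeasurableSpace Ω] {κ : ℕ → ℝ}
    {a : Ω → ℕ → ℕ → ℝ} (ha : ∀ t j, Measurable fun ω => a ω t j) (t j : ℕ) :
    Measurable fun ω => prodProb κ (a ω) t j :=
  ((measurable_prodWeight ha t j).const_mul _).div
    (Finset.measurable_sum _ fun i _ => (measurable_prodWeight ha t i).const_mul _)

theorem measurable_prodLoss {Ω : Type*} [MeasurableSpace Ω] {κ : ℕ → ℝ}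
    {a : Ω → ℕ → ℕ → ℝ} (ha : ∀ t j, Measurable fun ω => a ω t j) (t : ℕ) :
    Measurable fun ω => prodLoss κ (a ω) t :=
  Finset.measurable_sum _ fun i _ => (measurable_prodProb ha t i).mul (ha t i)

/-! ### Sampling from a finite distribution with a uniform variable -/

/-- The index drawn from the distribution `p` on `{0, …, n - 1}` with the uniform variable `v`. -/
noncomputable def drawIndex (n : ℕ) (p : ℕ → ℝ) (v : ℝ) : ℕ :=
  ∑ b ∈ Finset.range n, if ∑ i ∈ Finset.range (b + 1), p i ≤ v then 1 else 0

theorem measurable_drawIndex {Ω : Type*} [MeasurableSpace Ω] (n : ℕ) {p : Ω → ℕ → ℝ} {v : Ω → ℝ}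
    (hp : ∀ j, Measurable fun ω => p ω j) (hv : Measurable v) :
    Measurable fun ω => drawIndex n (p ω) (v ω) :=
  Finset.measurable_sum _ fun _ _ => Measurable.ite
    (measurableSet_le (Finset.measurable_sum _ fun i _ => hp i) hv)
    measurable_const measurable_const

theorem drawIndex_eq {n b : ℕ} {p : ℕ → ℝ} {v : ℝ} (hp : ∀ j, 0 ≤ p j) (hb : b < n)
    (h1 : ∑ i ∈ Finset.range b, p i ≤ v) (h2 : v < ∑ i ∈ Finset.range (b + 1), p i) :
    drawIndex n p v = b := by
  have hmono : Monotone fun k => ∑ i ∈ Finset.range k, p i :=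
    monotone_nat_of_le_succ fun k => by
      rw [Finset.sum_range_succ]; linarith [hp k]
  have : ∀ k, (∑ i ∈ Finset.range (k + 1), p i ≤ v) ↔ k < b := by
    intro k
    constructor
    · intro h
      by_contra hk
      have := hmono (by omega : b + 1 ≤ k + 1)
      simp only at this
      linarith
    · intro h
      exact (hmono (by omega : k + 1 ≤ b)).trans h1
  simp only [drawIndex, this, Finset.sum_boole]
  have h3 : (Finset.range n).filter (fun k => k < b) = Finset.range b := by
    ext k; simp; omega
  rw [h3]; simp

/-- This is inversion of the distribution function: the partial sums of `p` cut the unit interval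
into pieces of lengths `p b`, and the drawn index is `b` on the piece number `b`. -/
theorem integral_drawIndex {n : ℕ} {p : ℕ → ℝ} (hp : ∀ j, 0 ≤ p j)
    (h1 : ∑ i ∈ Finset.range n, p i = 1) (F : ℕ → ℝ) :
    ∫ v in (0 : ℝ)..1, F (drawIndex n p v) = ∑ j ∈ Finset.range n, p j * F j := by
  have key : ∀ b < n, Set.EqOn (fun v => F (drawIndex n p v)) (fun _ => F b)
      (Set.Ico (∑ i ∈ Finset.range b, p i) (∑ i ∈ Finset.range (b + 1), p i)) :=
    fun b hb v hv => by simp only [drawIndex_eq hp hb hv.1 hv.2]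
  have hle : ∀ b, ∑ i ∈ Finset.range b, p i ≤ ∑ i ∈ Finset.range (b + 1), p i := fun b => by
    rw [Finset.sum_range_succ]; linarith [hp b]
  have hae : ∀ b < n, ∀ᵐ v ∂(volume : Measure ℝ),
      v ∈ Set.uIoc (∑ i ∈ Finset.range b, p i) (∑ i ∈ Finset.range (b + 1), p i) →
        F (drawIndex n p v) = F b := by
    intro b hb
    have : ∀ᵐ v ∂(volume : Measure ℝ), v ≠ ∑ i ∈ Finset.range (b + 1), p i := by
      simp [ae_iff]
    filter_upwards [this] with v hv hv2
    rw [Set.uIoc_of_le (hle b)] at hv2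
    exact key b hb ⟨hv2.1.le, lt_of_le_of_ne hv2.2 hv⟩
  have h := intervalIntegral.sum_integral_adjacent_intervals
    (μ := volume) (f := fun v => F (drawIndex n p v)) (a := fun b => ∑ i ∈ Finset.range b, p i)
    (n := n) (fun b hb => by
      refine (intervalIntegrable_const (c := F b)).congr_ae ?_
      refine (ae_restrict_iff' measurableSet_uIoc).2 ?_
      filter_upwards [hae b hb] with v hv hv2 using (hv hv2).symm)
  simp only [Finset.range_zero, Finset.sum_empty, h1] at h
  rw [← h]
  refine Finset.sum_congr rfl fun b hb => ?_
  rw [intervalIntegral.integral_congr_ae (hae b (Finset.mem_range.1 hb)),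
    intervalIntegral.integral_const, Finset.sum_range_succ]
  simp

/-- The uniform law on `[0, 1]`, in an arbitrary universe. -/
noncomputable def uniformLaw : ProbabilityMeasure (ULift.{u} ℝ) :=
  ⟨(volume.restrict (Set.Ioc (0 : ℝ) 1)).map ULift.up, by
    have : IsProbabilityMeasure (volume.restrict (Set.Ioc (0 : ℝ) 1)) := ⟨by simp⟩
    exact Measure.isProbabilityMeasure_map measurable_up.aemeasurable⟩

theorem integral_uniformLaw_drawIndex {n : ℕ} {p : ℕ → ℝ} (hp : ∀ j, 0 ≤ p j)
    (h1 : ∑ i ∈ Finset.range n, p i = 1) (F : ℕ → ℝ) :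
    ∫ v, F (drawIndex n p v.down) ∂(uniformLaw.{u} : Measure (ULift.{u} ℝ))
      = ∑ j ∈ Finset.range n, p j * F j := by
  rw [← integral_drawIndex hp h1 F, intervalIntegral.integral_of_le zero_le_one]
  change ∫ v, _ ∂(Measure.map ULift.up _) = _
  rw [integral_map measurable_up.aemeasurable]
  refine Measurable.aestronglyMeasurable ?_
  exact (measurable_from_top (f := F)).comp
    (measurable_drawIndex n (fun j => measurable_const) measurable_down)

/-! ### Upper frequencies -/

theorem timeAverage_mono {a b : ℕ → ℝ} (h : ∀ t, a t ≤ b t) (T : ℕ) :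
    timeAverage a T ≤ timeAverage b T :=
  mul_le_mul_of_nonneg_left (Finset.sum_le_sum fun t _ => h t) (by positivity)

theorem timeAverage_add (a b : ℕ → ℝ) (T : ℕ) :
    timeAverage (fun t => a t + b t) T = timeAverage a T + timeAverage b T := by
  simp only [timeAverage, Finset.sum_add_distrib, mul_add]

theorem timeAverage_const_mul (c : ℝ) (a : ℕ → ℝ) (T : ℕ) :
    timeAverage (fun t => c * a t) T = c * timeAverage a T := by
  simp only [timeAverage, ← Finset.mul_sum]; ring

theorem timeAverage_le {a : ℕ → ℝ} {C : ℝ} (hC : 0 ≤ C) (h : ∀ t, a t ≤ C) (T : ℕ) :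
    timeAverage a T ≤ C := by
  rcases Nat.eq_zero_or_pos T with rfl | hT
  · simpa [timeAverage] using hC
  · have : (0 : ℝ) < T := by exact_mod_cast hT
    calc timeAverage a T ≤ timeAverage (fun _ => C) T := timeAverage_mono h T
      _ = C := by simp [timeAverage]; field_simp

theorem timeAverage_nonneg {a : ℕ → ℝ} (h : ∀ t, 0 ≤ a t) (T : ℕ) : 0 ≤ timeAverage a T :=
  mul_nonneg (by positivity) (Finset.sum_nonneg fun t _ => h t)

theorem measurable_timeAverage {Ω : Type*} [MeasurableSpace Ω] {a : Ω → ℕ → ℝ}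
    (h : ∀ t, Measurable fun ω => a ω t) (T : ℕ) : Measurable fun ω => timeAverage (a ω) T :=
  (Finset.measurable_sum _ fun t _ => h t).const_mul _

section UpperFrequency

variable {𝒳 : Type u} {x : ℕ → 𝒳} {A B : Set 𝒳}

/-- The frequency of visits of the path `x` to `A` before time `T`. -/
noncomputable def visitFrequency (x : ℕ → 𝒳) (A : Set 𝒳) (T : ℕ) : ℝ :=
  timeAverage (fun t => A.indicator (fun _ => (1 : ℝ)) (x t)) T

theorem visitFrequency_nonneg (x : ℕ → 𝒳) (A : Set 𝒳) (T : ℕ) : 0 ≤ visitFrequency x A T :=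
  timeAverage_nonneg (fun _ => Set.indicator_nonneg (fun _ _ => zero_le_one) _) T

theorem visitFrequency_le_one (x : ℕ → 𝒳) (A : Set 𝒳) (T : ℕ) : visitFrequency x A T ≤ 1 :=
  timeAverage_le zero_le_one
    (fun t => Set.indicator_apply_le' (a := x t) (fun _ => le_rfl) fun _ => zero_le_one) T

theorem isBoundedUnder_visitFrequency (x : ℕ → 𝒳) (A : Set 𝒳) :
    IsBoundedUnder (· ≤ ·) atTop (visitFrequency x A) :=
  isBoundedUnder_of ⟨1, visitFrequency_le_one x A⟩

theorem isBoundedUnder_ge_visitFrequency (x : ℕ → 𝒳) (A : Set 𝒳) :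
    IsBoundedUnder (· ≥ ·) atTop (visitFrequency x A) :=
  isBoundedUnder_of ⟨0, visitFrequency_nonneg x A⟩

theorem upperFrequency_nonneg (x : ℕ → 𝒳) (A : Set 𝒳) : 0 ≤ upperFrequency x A :=
  le_limsup_of_frequently_le (Eventually.frequently (Eventually.of_forall
    (visitFrequency_nonneg x A))) (isBoundedUnder_visitFrequency x A)

theorem upperFrequency_le_one (x : ℕ → 𝒳) (A : Set 𝒳) : upperFrequency x A ≤ 1 :=
  limsup_le_of_le (isBoundedUnder_ge_visitFrequency x A).isCoboundedUnder_le
    (Eventually.of_forall (visitFrequency_le_one x A))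

theorem upperFrequency_mono (x : ℕ → 𝒳) (h : A ⊆ B) : upperFrequency x A ≤ upperFrequency x B :=
  limsup_le_limsup (Eventually.of_forall fun T => timeAverage_mono
      (fun _ => Set.indicator_le_indicator_of_subset h (fun _ => zero_le_one) _) T)
    (isBoundedUnder_ge_visitFrequency x A).isCoboundedUnder_le (isBoundedUnder_visitFrequency x B)

theorem upperFrequency_union_le (x : ℕ → 𝒳) (A B : Set 𝒳) :
    upperFrequency x (A ∪ B) ≤ upperFrequency x A + upperFrequency x B := by
  refine le_trans ?_ (limsup_add_le (isBoundedUnder_ge_visitFrequency x A)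
    (isBoundedUnder_visitFrequency x A) (isBoundedUnder_ge_visitFrequency x B).isCoboundedUnder_le
    (isBoundedUnder_visitFrequency x B))
  refine limsup_le_limsup (Eventually.of_forall fun T => ?_)
    (isBoundedUnder_ge_visitFrequency x _).isCoboundedUnder_le ?_
  · change _ ≤ timeAverage _ T + timeAverage _ T
    rw [← timeAverage_add]
    refine timeAverage_mono (fun t => ?_) T
    by_cases hA : x t ∈ A <;> by_cases hB : x t ∈ B <;> simp [hA, hB]
  · refine isBoundedUnder_of ⟨2, fun T => ?_⟩
    have h1 := visitFrequency_le_one x A T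
    have h2 := visitFrequency_le_one x B T
    change visitFrequency x A T + visitFrequency x B T ≤ 2
    linarith

theorem upperFrequency_empty (x : ℕ → 𝒳) : upperFrequency x ∅ = 0 := by
  have : (timeAverage fun _ => (0 : ℝ)) = fun _ => 0 := by
    funext T; simp [timeAverage]
  simp [upperFrequency, this]

variable [MeasurableSpace 𝒳]

theorem measurable_visitFrequency (hA : MeasurableSet A) (T : ℕ) :
    Measurable fun x : ℕ → 𝒳 => visitFrequency x A T :=
  measurable_timeAverage
    (fun t => (measurable_const.indicator hA).comp (measurable_pi_apply t)) T

theorem measurable_upperFrequency (hA : MeasurableSet A) :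
    Measurable fun x : ℕ → 𝒳 => upperFrequency x A :=
  Measurable.limsup fun T => measurable_visitFrequency hA T

theorem integrable_upperFrequency (μ : ProbabilityMeasure (ℕ → 𝒳)) (hA : MeasurableSet A) :
    Integrable (fun x : ℕ → 𝒳 => upperFrequency x A) (μ : Measure (ℕ → 𝒳)) :=
  Integrable.of_bound (measurable_upperFrequency hA).aestronglyMeasurable 1
    (Eventually.of_forall fun x => by
      rw [Real.norm_of_nonneg (upperFrequency_nonneg x A)]; exact upperFrequency_le_one x A)

/-- The expected upper frequency of visits to `A` under `μ`. -/
noncomputable def meanFrequency (μ : ProbabilityMeasure (ℕ → 𝒳)) (A : Set 𝒳) : ℝ :=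
  ∫ x, upperFrequency x A ∂(μ : Measure (ℕ → 𝒳))

variable {μ : ProbabilityMeasure (ℕ → 𝒳)}

theorem meanFrequency_nonneg (μ : ProbabilityMeasure (ℕ → 𝒳)) (A : Set 𝒳) :
    0 ≤ meanFrequency μ A :=
  integral_nonneg fun x => upperFrequency_nonneg x A

theorem meanFrequency_mono (hA : MeasurableSet A) (hB : MeasurableSet B) (h : A ⊆ B) :
    meanFrequency μ A ≤ meanFrequency μ B :=
  integral_mono (integrable_upperFrequency μ hA) (integrable_upperFrequency μ hB)
    fun x => upperFrequency_mono x h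

theorem meanFrequency_union_le (hA : MeasurableSet A) (hB : MeasurableSet B) :
    meanFrequency μ (A ∪ B) ≤ meanFrequency μ A + meanFrequency μ B := by
  simp only [meanFrequency]
  rw [← integral_add (integrable_upperFrequency μ hA) (integrable_upperFrequency μ hB)]
  exact integral_mono (integrable_upperFrequency μ (hA.union hB))
    ((integrable_upperFrequency μ hA).add (integrable_upperFrequency μ hB))
    fun x => upperFrequency_union_le x A B

theorem meanFrequency_le_add {D : Set 𝒳} (hA : MeasurableSet A) (hB : MeasurableSet B)
    (hD : MeasurableSet D) (h : D ⊆ A ∪ B) :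
    meanFrequency μ D ≤ meanFrequency μ A + meanFrequency μ B :=
  (meanFrequency_mono hD (hA.union hB) h).trans (meanFrequency_union_le hA hB)

theorem meanFrequency_empty (μ : ProbabilityMeasure (ℕ → 𝒳)) : meanFrequency μ ∅ = 0 := by
  simp [meanFrequency, upperFrequency_empty]

theorem meanFrequency_biUnion_lt {n : ℕ} {S : ℕ → Set 𝒳} {ε : ℕ → ℝ}
    (hS : ∀ i, MeasurableSet (S i)) (h : ∀ i, meanFrequency μ (S i) ≤ ε i) :
    meanFrequency μ (⋃ i ∈ Finset.range n, S i) ≤ ∑ i ∈ Finset.range n, ε i := by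
  induction n with
  | zero => simp [meanFrequency_empty]
  | succ n ih =>
    rw [Finset.sum_range_succ, Finset.range_add_one, Finset.set_biUnion_insert, Set.union_comm]
    exact (meanFrequency_union_le (Finset.measurableSet_biUnion _ fun i _ => hS i) (hS n)).trans
      (add_le_add ih (h n))

/-- Under CS, every measurable set is close to an element of any generating algebra. -/
theorem exists_meanFrequency_symmDiff_lt (hμ : μ ∈ CS 𝒳) {𝒜 : Set (Set 𝒳)}
    (h𝒜 : IsSetAlgebra 𝒜) (hm : ∀ A ∈ 𝒜, MeasurableSet A) {A : Set 𝒳}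
    (hA : MeasurableSet[MeasurableSpace.generateFrom 𝒜] A) :
    MeasurableSet A ∧ ∀ ε : ℝ, 0 < ε → ∃ B ∈ 𝒜, meanFrequency μ (symmDiff A B) < ε := by
  induction A, hA using MeasurableSpace.generateFrom_induction with
  | hC t ht _ =>
    exact ⟨hm t ht, fun ε hε => ⟨t, ht, by
      simpa [symmDiff_self, meanFrequency_empty] using hε⟩⟩
  | empty => exact ⟨.empty, fun ε hε => ⟨∅, h𝒜.empty_mem, by
      simpa [symmDiff_self, meanFrequency_empty] using hε⟩⟩
  | compl t _ ih =>
    refine ⟨ih.1.compl, fun ε hε => ?_⟩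
    obtain ⟨B, hB, h⟩ := ih.2 ε hε
    refine ⟨Bᶜ, h𝒜.compl_mem hB, ?_⟩
    have h2 : symmDiff tᶜ Bᶜ = symmDiff t B := by
      ext x; simp only [Set.mem_symmDiff, Set.mem_compl_iff]; tauto
    rwa [h2]
  | iUnion s _ ih =>
    have hs : ∀ n, MeasurableSet (s n) := fun n => (ih n).1
    have hU : MeasurableSet (⋃ i, s i) := MeasurableSet.iUnion hs
    refine ⟨hU, fun ε hε => ?_⟩
    have hfin : ∀ n, MeasurableSet (⋃ i ∈ Finset.range n, s i) := fun n =>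
      Finset.measurableSet_biUnion _ fun i _ => hs i
    -- CS applied to what the first `n` sets miss of the union; this is the only place where
    -- continuity is needed.
    have h1 := hμ (fun n => (⋃ i, s i) \ ⋃ i ∈ Finset.range n, s i) (fun n => hU.diff (hfin n))
      (fun m n hmn => Set.sdiff_subset_sdiff_right
        (Set.biUnion_subset_biUnion_left (by simpa using hmn)))
      (by
        ext x
        simp only [Set.mem_iInter, Set.mem_sdiff, Set.mem_iUnion, Finset.mem_range, not_exists,
          Set.mem_empty_iff_false, iff_false, not_forall]
        by_contra! hx
        obtain ⟨i, hi⟩ := (hx 0).1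
        exact (hx (i + 1)).2 i (by omega) hi)
    obtain ⟨n, hn⟩ := (h1.eventually (gt_mem_nhds (half_pos hε))).exists
    -- With `n` fixed, the `n` approximation errors must add up to less than `ε / 2`.
    have hε' : ∀ i : ℕ, 0 < ε / 2 / (n + 1) := fun _ => by positivity
    choose B hB hBlt using fun i => (ih i).2 _ (hε' i)
    have hBm : ∀ i, MeasurableSet (B i) := fun i => hm _ (hB i)
    refine ⟨⋃ i ∈ Finset.range n, B i, h𝒜.biUnion_mem _ fun i _ => hB i, ?_⟩
    have hBU : MeasurableSet (⋃ i ∈ Finset.range n, B i) :=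
      Finset.measurableSet_biUnion _ fun i _ => hBm i
    have h2 := meanFrequency_biUnion_lt (μ := μ) (n := n)
      (fun i => (hs i).symmDiff (hBm i)) (fun i => (hBlt i).le)
    have h3 : meanFrequency μ (symmDiff (⋃ i, s i) (⋃ i ∈ Finset.range n, B i)) ≤ _ :=
      meanFrequency_le_add (hU.diff (hfin n))
        (Finset.measurableSet_biUnion (Finset.range n) fun i _ => (hs i).symmDiff (hBm i))
        (hU.symmDiff hBU) (by
          intro x
          simp only [Set.mem_symmDiff, Set.mem_iUnion, Set.mem_union, Set.mem_sdiff,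
            Finset.mem_range]
          rintro (⟨⟨i, hi⟩, h⟩ | ⟨⟨i, hin, hi⟩, h⟩)
          · by_cases hx : ∃ i, ∃ (_ : i < n), x ∈ s i
            · obtain ⟨j, hj, hx⟩ := hx
              exact Or.inr ⟨j, hj, Or.inl ⟨hx, fun hb => h ⟨j, hj, hb⟩⟩⟩
            · exact Or.inl ⟨⟨i, hi⟩, hx⟩
          · exact Or.inr ⟨i, hin, Or.inr ⟨hi, fun hs => h ⟨i, hs⟩⟩⟩)
    have h4 : ∑ i ∈ Finset.range n, ε / 2 / ((n : ℝ) + 1) < ε / 2 := by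
      rw [Finset.sum_const, Finset.card_range, nsmul_eq_mul]
      have : (0 : ℝ) < n + 1 := by positivity
      rw [mul_div_assoc', div_lt_iff₀ this]
      nlinarith
    change meanFrequency μ _ < ε / 2 at hn
    linarith

end UpperFrequency

/-! ### A countable class of functions which is dense under every process in CS -/

section DenseClass

variable {𝒳 𝒴 : Type u}

/-- The function which takes the value `d k` on `S b` for the first pair `(b, k)` of the list such
that `S b` contains the point, and `d 0` if there is none. -/
noncomputable def listFun (S : ℕ → Set 𝒳) (d : ℕ → 𝒴) : List (ℕ × ℕ) → 𝒳 → 𝒴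
  | [] => fun _ => d 0
  | p :: l => by classical exact (S p.1).piecewise (fun _ => d p.2) (listFun S d l)

variable [MeasurableSpace 𝒳]

theorem measurable_listFun [MeasurableSpace 𝒴] {S : ℕ → Set 𝒳} (hS : ∀ n, MeasurableSet (S n))
    (d : ℕ → 𝒴) (l : List (ℕ × ℕ)) : Measurable (listFun S d l) := by
  classical
  induction l with
  | nil => exact measurable_const
  | cons p l ih => exact Measurable.piecewise (hS p.1) measurable_const ih

variable [MetricSpace 𝒴] [MeasurableSpace 𝒴] [BorelSpace 𝒴]
  [TopologicalSpace.SeparableSpace 𝒴]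

theorem measurableSet_exists_dist_le (d : ℕ → 𝒴) {h : 𝒳 → 𝒴} (hh : Measurable h) (δ : ℝ) (K : ℕ) :
    MeasurableSet {x | ∃ k < K, dist (d k) (h x) ≤ δ} := by
  have : SecondCountableTopology 𝒴 := UniformSpace.secondCountable_of_separable 𝒴
  have : {x | ∃ k < K, dist (d k) (h x) ≤ δ}
      = ⋃ k ∈ Finset.range K, {x | dist (d k) (h x) ≤ δ} := by ext; simp
  rw [this]
  exact Finset.measurableSet_biUnion _ fun k _ =>
    measurableSet_le (measurable_const.dist hh) measurable_const

/-- Induction on the number of candidate values: prepend the value `d K` on a set `S b` close to the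
set where `d K` is good for `h`. Where the two sets agree, either `d K` is used and is good, or the
previous list takes over. -/
theorem exists_listFun_finite {μ : ProbabilityMeasure (ℕ → 𝒳)} {S : ℕ → Set 𝒳}
    (hS : ∀ n, MeasurableSet (S n))
    (hdense : ∀ A, MeasurableSet A → ∀ ε : ℝ, 0 < ε → ∃ b, meanFrequency μ (symmDiff A (S b)) < ε)
    (d : ℕ → 𝒴) {h : 𝒳 → 𝒴} (hh : Measurable h) (δ : ℝ) (K : ℕ) :
    ∀ ε : ℝ, 0 < ε → ∃ l, meanFrequency μ {x | (∃ k < K, dist (d k) (h x) ≤ δ) ∧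
      δ < dist (listFun S d l x) (h x)} < ε := by
  have : SecondCountableTopology 𝒴 := UniformSpace.secondCountable_of_separable 𝒴
  have hk : ∀ k, MeasurableSet {x | dist (d k) (h x) ≤ δ} := fun k =>
    measurableSet_le (measurable_const.dist hh) measurable_const
  have hm : ∀ K l, MeasurableSet {x | (∃ k < K, dist (d k) (h x) ≤ δ) ∧
      δ < dist (listFun S d l x) (h x)} := by
    intro K l
    exact (measurableSet_exists_dist_le d hh δ K).inter
      (measurableSet_lt measurable_const ((measurable_listFun hS d l).dist hh))
  induction K with
  | zero => intro ε hε; exact ⟨[], by simpa [meanFrequency_empty] using hε⟩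
  | succ K ih =>
    intro ε hε
    obtain ⟨l, hl⟩ := ih (ε / 2) (half_pos hε)
    obtain ⟨b, hb⟩ := hdense _ (hk K) (ε / 2) (half_pos hε)
    refine ⟨(b, K) :: l, ?_⟩
    have := meanFrequency_le_add (μ := μ) (hm K l) ((hk K).symmDiff (hS b))
      (hm (K + 1) ((b, K) :: l)) (by
        classical
        rintro x ⟨⟨k, hkK, hx⟩, hx2⟩
        simp only [listFun, Set.piecewise] at hx2
        split_ifs at hx2 with hxb
        · exact Or.inr (Or.inr ⟨hxb, fun h => absurd hx2 (not_lt.2 h)⟩)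
        · rcases (by omega : k < K ∨ k = K) with h | rfl
          · exact Or.inl ⟨⟨k, h, hx⟩, hx2⟩
          · exact Or.inr (Or.inl ⟨hx, hxb⟩))
    linarith

/-- The class consists of functions with finitely many values in a dense sequence, built on sets of
a countable generating algebra. Quantifying over `μ` after the class is what later gives an
optimistically universal rule. -/
theorem exists_dense_class [MetricSpace 𝒳] [TopologicalSpace.SeparableSpace 𝒳]
    [BorelSpace 𝒳] [Nonempty 𝒴] :
    ∃ F : ℕ → 𝒳 → 𝒴, (∀ n, Measurable (F n)) ∧ ∀ μ ∈ CS 𝒳, ∀ h : 𝒳 → 𝒴, Measurable h →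
      ∀ δ : ℝ, 0 < δ → ∀ ε : ℝ, 0 < ε →
        ∃ n, meanFrequency μ {x | δ < dist (F n x) (h x)} < ε := by
  have : SecondCountableTopology 𝒳 := UniformSpace.secondCountable_of_separable 𝒳
  have : SecondCountableTopology 𝒴 := UniformSpace.secondCountable_of_separable 𝒴
  let 𝒜 : Set (Set 𝒳) := generateSetAlgebra (MeasurableSpace.countableGeneratingSet 𝒳)
  have h𝒜 : IsSetAlgebra 𝒜 := isSetAlgebra_generateSetAlgebra
  have hgen : MeasurableSpace.generateFrom 𝒜 = ‹MeasurableSpace 𝒳› := by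
    rw [generateFrom_generateSetAlgebra_eq, MeasurableSpace.generateFrom_countableGeneratingSet]
  have hm : ∀ A ∈ 𝒜, MeasurableSet A := fun A hA => by
    rw [← hgen]; exact MeasurableSpace.measurableSet_generateFrom hA
  have hc : 𝒜.Countable :=
    countable_generateSetAlgebra MeasurableSpace.countable_countableGeneratingSet
  obtain ⟨S, hS⟩ := hc.exists_eq_range ⟨∅, h𝒜.empty_mem⟩
  have hSm : ∀ n, MeasurableSet (S n) := fun n => hm _ (hS ▸ ⟨n, rfl⟩)
  let d : ℕ → 𝒴 := TopologicalSpace.denseSeq 𝒴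
  obtain ⟨e, he⟩ := exists_surjective_nat (List (ℕ × ℕ))
  refine ⟨fun n => listFun S d (e n), fun n => measurable_listFun hSm d _, ?_⟩
  intro μ hμ h hh δ hδ ε hε
  have hdense : ∀ A, MeasurableSet A → ∀ ε : ℝ, 0 < ε →
      ∃ b, meanFrequency μ (symmDiff A (S b)) < ε := by
    intro A hA ε hε
    obtain ⟨B, hB, h⟩ := (exists_meanFrequency_symmDiff_lt hμ h𝒜 hm (A := A)
      (by rw [hgen]; exact hA)).2 ε hε
    rw [hS] at hB
    obtain ⟨b, rfl⟩ := hB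
    exact ⟨b, h⟩
  have hKm := measurableSet_exists_dist_le d hh δ
  -- The points whose image under `h` is far from the first `K` terms of the dense sequence decrease
  -- to the empty set, so CS makes them negligible.
  have h1 := hμ (fun K => {x | ∃ k < K, dist (d k) (h x) ≤ δ}ᶜ) (fun K => (hKm K).compl)
    (fun K K' hK => Set.compl_subset_compl.2 fun x ⟨k, hk, hx⟩ => ⟨k, hk.trans_le hK, hx⟩)
    (by
      ext x
      simp only [Set.mem_iInter, Set.mem_compl_iff, Set.mem_empty_iff_false, iff_false,
        not_forall, not_not]
      obtain ⟨k, hk⟩ := (TopologicalSpace.denseRange_denseSeq 𝒴).exists_dist_lt (h x) hδ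
      exact ⟨k + 1, k, by omega, by rw [dist_comm]; exact hk.le⟩)
  obtain ⟨K, hK⟩ := (h1.eventually (gt_mem_nhds (half_pos hε))).exists
  obtain ⟨l, hl⟩ := exists_listFun_finite hSm hdense d hh δ K (ε / 2) (half_pos hε)
  obtain ⟨n, rfl⟩ := he l
  refine ⟨n, ?_⟩
  have hdm : MeasurableSet {x | δ < dist (listFun S d (e n) x) (h x)} :=
    measurableSet_lt measurable_const ((measurable_listFun hSm d _).dist hh)
  have h2 := meanFrequency_le_add (μ := μ) (hKm K).compl ((hKm K).inter hdm) hdm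
    (fun x hx => by
      by_cases h : ∃ k < K, dist (d k) (h x) ≤ δ
      · exact Or.inr ⟨h, hx⟩
      · exact Or.inl h)
  change meanFrequency μ _ < ε / 2 at hK
  have h3 : {x | ∃ k < K, dist (d k) (h x) ≤ δ} ∩ {x | δ < dist (listFun S d (e n) x) (h x)}
    = {x | (∃ k < K, dist (d k) (h x) ≤ δ) ∧ δ < dist (listFun S d (e n) x) (h x)} := rfl
  rw [h3] at h2
  linarith

end DenseClass

/-! ### Averages of bounded orthogonal variables -/

section Orthogonal

theorem abs_sum_range_le {Ω : Type*} {D : ℕ → Ω → ℝ} {C : ℝ} (hC : ∀ t ω, |D t ω| ≤ C) (n : ℕ) (ω : Ω) :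
    |∑ t ∈ Finset.range n, D t ω| ≤ n * C :=
  (Finset.abs_sum_le_sum_abs _ _).trans
    ((Finset.sum_le_sum fun t _ => hC t ω).trans (by simp))

variable {Ω : Type*} [MeasurableSpace Ω] {P : Measure Ω} [IsProbabilityMeasure P] {D : ℕ → Ω → ℝ}
  {C : ℝ}

theorem integrable_of_abs_le {f : Ω → ℝ} (hf : Measurable f) (h : ∀ ω, |f ω| ≤ C) :
    Integrable f P :=
  Integrable.of_bound hf.aestronglyMeasurable C (Eventually.of_forall h)

theorem integral_sq_sum_le (hm : ∀ t, Measurable (D t)) (hC : ∀ t ω, |D t ω| ≤ C)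
    (horth : ∀ s t, s < t → ∫ ω, D s ω * D t ω ∂P = 0) (n : ℕ) :
    ∫ ω, (∑ t ∈ Finset.range n, D t ω) ^ 2 ∂P ≤ C ^ 2 * n := by
  induction n with
  | zero => simp
  | succ n ih =>
    have hSm : Measurable fun ω => ∑ t ∈ Finset.range n, D t ω :=
      Finset.measurable_sum _ fun t _ => hm t
    have hprod : ∀ s, Integrable (fun ω => D s ω * D n ω) P := fun s =>
      integrable_of_abs_le (C := C * C) ((hm s).mul (hm n)) fun ω => by
        rw [abs_mul]
        exact mul_le_mul (hC s ω) (hC n ω) (abs_nonneg _) ((abs_nonneg _).trans (hC s ω))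
    have h1 : Integrable (fun ω => (∑ t ∈ Finset.range n, D t ω) ^ 2) P :=
      integrable_of_abs_le (C := (n * C) ^ 2) (hSm.pow_const 2) fun ω => by
        rw [abs_pow]
        exact pow_le_pow_left₀ (abs_nonneg _) (abs_sum_range_le hC n ω) 2
    have h2 : Integrable (fun ω => ∑ t ∈ Finset.range n, D t ω * D n ω) P :=
      integrable_finsetSum _ fun s _ => hprod s
    have h3 : Integrable (fun ω => D n ω ^ 2) P := by
      simpa only [pow_two] using hprod n
    have h4 : ∫ ω, ∑ t ∈ Finset.range n, D t ω * D n ω ∂P = 0 := by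
      rw [integral_finsetSum _ fun s _ => hprod s]
      exact Finset.sum_eq_zero fun s hs => horth s n (Finset.mem_range.1 hs)
    have h5 : ∫ ω, D n ω ^ 2 ∂P ≤ C ^ 2 := by
      calc ∫ ω, D n ω ^ 2 ∂P ≤ ∫ _, C ^ 2 ∂P := integral_mono h3 (integrable_const _) fun ω => by
            rw [← sq_abs]; exact pow_le_pow_left₀ (abs_nonneg _) (hC n ω) 2
        _ = C ^ 2 := by simp
    have h6 : ∀ ω, (∑ t ∈ Finset.range (n + 1), D t ω) ^ 2
        = (∑ t ∈ Finset.range n, D t ω) ^ 2 + 2 * ∑ t ∈ Finset.range n, D t ω * D n ω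
          + D n ω ^ 2 := fun ω => by
      rw [Finset.sum_range_succ, ← Finset.sum_mul]; ring
    simp only [h6]
    have h7 : ∫ ω, ((∑ t ∈ Finset.range n, D t ω) ^ 2 + 2 * ∑ t ∈ Finset.range n, D t ω * D n ω
        + D n ω ^ 2) ∂P = ∫ ω, ((∑ t ∈ Finset.range n, D t ω) ^ 2
          + 2 * ∑ t ∈ Finset.range n, D t ω * D n ω) ∂P + ∫ ω, D n ω ^ 2 ∂P :=
      integral_add (h1.add (h2.const_mul 2)) h3
    rw [h7, integral_add h1 (h2.const_mul 2), integral_const_mul, h4]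
    push_cast
    linarith

/-- Orthogonality bounds the second moment of the average at time `n ^ 2` by `C ^ 2 / n ^ 2`, which
is summable. -/
theorem ae_tendsto_sq_sum_div (hm : ∀ t, Measurable (D t)) (hC : ∀ t ω, |D t ω| ≤ C)
    (horth : ∀ s t, s < t → ∫ ω, D s ω * D t ω ∂P = 0) :
    ∀ᵐ ω ∂P, Tendsto (fun n : ℕ => (∑ t ∈ Finset.range (n ^ 2), D t ω) / ((n ^ 2 : ℕ) : ℝ))
      atTop (𝓝 0) := by
  set f : ℕ → Ω → ℝ := fun n ω => ((∑ t ∈ Finset.range (n ^ 2), D t ω) / ((n ^ 2 : ℕ) : ℝ)) ^ 2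
    with hf
  have hfm : ∀ n, Measurable (f n) := fun n =>
    ((Finset.measurable_sum _ fun t _ => hm t).div_const _).pow_const 2
  have hle : ∀ n, ∫⁻ ω, ENNReal.ofReal (f n ω) ∂P ≤ ENNReal.ofReal (C ^ 2 * (1 / (n : ℝ) ^ 2)) := by
    intro n
    have hint : Integrable (f n) P := integrable_of_abs_le (C := C ^ 2) (hfm n) fun ω => by
      rw [abs_pow]
      refine pow_le_pow_left₀ (abs_nonneg _) ?_ 2
      have h := abs_sum_range_le hC (n ^ 2) ω
      have hC0 : 0 ≤ C := (abs_nonneg _).trans (hC 0 ω)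
      rw [abs_div, abs_of_nonneg (by positivity : (0 : ℝ) ≤ ((n ^ 2 : ℕ) : ℝ))]
      exact div_le_of_le_mul₀ (by positivity) hC0 (by linarith)
    rw [← ofReal_integral_eq_lintegral_ofReal hint (Eventually.of_forall fun ω => sq_nonneg _)]
    refine ENNReal.ofReal_le_ofReal ?_
    simp only [hf, div_pow]
    rw [integral_div]
    have h := integral_sq_sum_le hm hC horth (n ^ 2)
    rcases Nat.eq_zero_or_pos n with rfl | hn
    · simp
    · have hn' : (0 : ℝ) < n := by exact_mod_cast hn
      refine (div_le_div_of_nonneg_right h (by positivity)).trans (le_of_eq ?_)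
      push_cast
      field_simp
  have hsum : ∑' n, ∫⁻ ω, ENNReal.ofReal (f n ω) ∂P ≠ ⊤ := by
    refine ne_top_of_le_ne_top ?_ (ENNReal.tsum_le_tsum hle)
    have hs : Summable fun n : ℕ => C ^ 2 * (1 / (n : ℝ) ^ 2) :=
      (Real.summable_one_div_nat_pow.2 (by norm_num)).mul_left _
    rw [← ENNReal.ofReal_tsum_of_nonneg (fun n => by positivity) hs]
    exact ENNReal.ofReal_ne_top
  rw [← lintegral_tsum fun n => (hfm n).ennreal_ofReal.aemeasurable] at hsum
  filter_upwards [ae_lt_top (Measurable.tsum fun n => (hfm n).ennreal_ofReal) hsum] with ω hω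
  have h1 := ENNReal.tendsto_atTop_zero_of_tsum_ne_top hω.ne
  have h2 : Tendsto (fun n => f n ω) atTop (𝓝 0) := by
    have h3 : Tendsto (fun n => (ENNReal.ofReal (f n ω)).toReal) atTop (𝓝 0) := by
      simpa [Function.comp_def] using (ENNReal.tendsto_toReal ENNReal.zero_ne_top).comp h1
    refine h3.congr fun n => ENNReal.toReal_ofReal (sq_nonneg _)
  have h4 := h2.sqrt
  simp only [hf, Real.sqrt_sq_eq_abs, Real.sqrt_zero] at h4
  exact (tendsto_zero_iff_abs_tendsto_zero _).2 h4

/-- The averages of bounded, pairwise orthogonal variables tend to zero almost surely. -/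
theorem ae_tendsto_timeAverage (hm : ∀ t, Measurable (D t)) (hC : ∀ t ω, |D t ω| ≤ C)
    (horth : ∀ s t, s < t → ∫ ω, D s ω * D t ω ∂P = 0) :
    ∀ᵐ ω ∂P, Tendsto (timeAverage fun t => D t ω) atTop (𝓝 0) := by
  filter_upwards [ae_tendsto_sq_sum_div hm hC horth] with ω hω
  -- Adding `C` to each term makes the partial sums nondecreasing. Convergence along the squares,
  -- whose consecutive ratios tend to one, then gives convergence along all times.
  have hmono : Monotone fun n : ℕ => (∑ t ∈ Finset.range n, D t ω) + n * C := by
    refine monotone_nat_of_le_succ fun n => ?_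
    rw [Finset.sum_range_succ]
    push_cast
    linarith [(abs_le.1 (hC n ω)).1]
  have h := tendsto_div_of_monotone_of_exists_subseq_tendsto_div _ C hmono (fun a ha => by
    refine ⟨fun n => n ^ 2, ?_, tendsto_pow_atTop (by norm_num), ?_⟩
    · have h1 : Tendsto (fun n : ℕ => ((n : ℝ) + 1) / n) atTop (𝓝 1) := by
        have h0 : Tendsto (fun n : ℕ => 1 + 1 / (n : ℝ)) atTop (𝓝 (1 + 0)) :=
          tendsto_const_nhds.add tendsto_one_div_atTop_nhds_zero_nat
        rw [add_zero] at h0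
        refine h0.congr' ?_
        filter_upwards [eventually_gt_atTop 0] with n hn
        have : (n : ℝ) ≠ 0 := by positivity
        field_simp
      have h2 : Tendsto (fun n : ℕ => (((n : ℝ) + 1) / n) ^ 2) atTop (𝓝 1) := by
        simpa using h1.pow 2
      filter_upwards [h2.eventually (gt_mem_nhds ha), eventually_gt_atTop 0] with n hn hn0
      have hn' : (0 : ℝ) < n := by exact_mod_cast hn0
      rw [div_pow, div_lt_iff₀ (by positivity)] at hn
      push_cast
      exact hn.le
    · have : Tendsto (fun n : ℕ =>
          (∑ t ∈ Finset.range (n ^ 2), D t ω) / ((n ^ 2 : ℕ) : ℝ) + C) atTop (𝓝 (0 + C)) :=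
        hω.add tendsto_const_nhds
      rw [zero_add] at this
      refine this.congr' ?_
      filter_upwards [eventually_gt_atTop 0] with n hn
      have : ((n ^ 2 : ℕ) : ℝ) ≠ 0 := by positivity
      field_simp)
  have h2 := h.sub_const C
  rw [sub_self] at h2
  refine h2.congr' ?_
  filter_upwards [eventually_gt_atTop 0] with n hn
  have : (n : ℝ) ≠ 0 := by positivity
  simp only [timeAverage]
  field_simp
  ring

end Orthogonal

/-! ### The private randomness is independent of the past -/

/-- Resampling one coordinate leaves the product law unchanged. In this form, independence of one
coordinate from the others can be used under an integral. -/
theorem infinitePi_map_update {R : Type*} [MeasurableSpace R] (ν : ℕ → Measure R)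
    [∀ t, IsProbabilityMeasure (ν t)] (t : ℕ) :
    ((Measure.infinitePi ν).prod (ν t)).map (fun p => Function.update p.1 t p.2)
      = Measure.infinitePi ν := by
  classical
  have hmeas : Measurable fun p : (ℕ → R) × R => Function.update p.1 t p.2 := measurable_update'
  refine Measure.eq_infinitePi _ fun s S hS => ?_
  rw [Measure.map_apply hmeas (MeasurableSet.pi s.countable_toSet fun i _ => hS i)]
  by_cases hts : t ∈ s
  · have : (fun p : (ℕ → R) × R => Function.update p.1 t p.2) ⁻¹' ((s : Set ℕ).pi S)
        = (((s.erase t : Finset ℕ) : Set ℕ).pi S) ×ˢ S t := by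
      ext p
      simp only [Set.mem_preimage, Set.mem_pi, Finset.mem_coe, Set.mem_prod, Finset.mem_erase]
      constructor
      · intro h
        exact ⟨fun i hi => by simpa [Function.update_of_ne hi.1] using h i hi.2,
          by simpa using h t hts⟩
      · rintro ⟨h1, h2⟩ i hi
        by_cases hit : i = t
        · subst hit; simpa using h2
        · simpa [Function.update_of_ne hit] using h1 i ⟨hit, hi⟩
    rw [this, Measure.prod_prod, Measure.infinitePi_pi _ fun i _ => hS i,
      Finset.prod_erase_mul _ _ hts]
  · have : (fun p : (ℕ → R) × R => Function.update p.1 t p.2) ⁻¹' ((s : Set ℕ).pi S)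
        = ((s : Set ℕ).pi S) ×ˢ Set.univ := by
      ext p
      simp only [Set.mem_preimage, Set.mem_pi, Finset.mem_coe, Set.mem_prod, Set.mem_univ,
        and_true]
      refine forall₂_congr fun i hi => ?_
      rw [Function.update_of_ne (by rintro rfl; exact hts hi)]
    rw [this, Measure.prod_prod, Measure.infinitePi_pi _ fun i _ => hS i, measure_univ, mul_one]

namespace AdversarialMechanism

variable {R 𝒳 𝒴 : Type u} [MeasurableSpace R] [MeasurableSpace 𝒳] [MeasurableSpace 𝒴]
  {μ : ProbabilityMeasure (ℕ → 𝒳)}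

/-- The sequence `y` up to time `t`, continued by `y₀`. -/
def truncate (y₀ : 𝒴) (t : ℕ) (y : ℕ → 𝒴) : ℕ → 𝒴 := fun u => if u ≤ t then y u else y₀

theorem measurable_truncate (y₀ : 𝒴) (t : ℕ) : Measurable (truncate y₀ t) := by
  refine measurable_pi_iff.2 fun u => ?_
  by_cases h : u ≤ t
  · simpa [truncate, h] using measurable_pi_apply u
  · simp [truncate, h]

/-- What the response at time `t` may depend on, together with the values up to time `t`. -/
def past (M : AdversarialMechanism R μ 𝒴) (y₀ : 𝒴) (t : ℕ) (z : (M.Ω × (ℕ → R)) × (ℕ → 𝒴)) :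
    M.Ω × (Fin t → R) × (ℕ → 𝒴) :=
  (z.1.1, fun s => z.1.2 s, truncate y₀ t z.2)

theorem measurable_past (M : AdversarialMechanism R μ 𝒴) (y₀ : 𝒴) (t : ℕ) :
    Measurable (M.past y₀ t) := by
  unfold past
  have := (measurable_truncate y₀ t).comp
    (measurable_snd : Measurable (Prod.snd : (M.Ω × (ℕ → R)) × (ℕ → 𝒴) → _))
  exact Measurable.prodMk (by fun_prop) (Measurable.prodMk (by fun_prop) this)

/-- The response at time `u ≤ t` reads the randomness only at times before `u`, so the responses up
to and including `t` cannot see that of time `t`. -/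
theorem responseKernel_map_truncate (M : AdversarialMechanism R μ 𝒴) (y₀ : 𝒴) (t : ℕ) (ω : M.Ω)
    {r r' : ℕ → R} (h : ∀ s < t, r s = r' s) :
    (M.responseKernel (ω, r)).map (truncate y₀ t)
      = (M.responseKernel (ω, r')).map (truncate y₀ t) := by
  have hf : ∀ u, Measurable fun y : 𝒴 => if u ≤ t then y else y₀ := fun u => by
    split_ifs <;> fun_prop
  change (Measure.infinitePi _).map (fun y u => if u ≤ t then y u else y₀)
    = (Measure.infinitePi _).map (fun y u => if u ≤ t then y u else y₀)
  rw [Measure.infinitePi_map_pi _ hf, Measure.infinitePi_map_pi _ hf]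
  congr 1
  funext u
  by_cases hu : u ≤ t
  · have : (fun s : Fin u => r s) = fun s : Fin u => r' s :=
      funext fun s => h s (lt_of_lt_of_le s.2 hu)
    simp only [this]
  · simp [hu]

/-- Resample the randomness at time `t`: neither the earlier randomness nor the law of the truncated
responses changes, so it is independent of a past which includes the response at time `t`. -/
theorem runLaw_map_past (M : AdversarialMechanism R μ 𝒴) (ν : ℕ → ProbabilityMeasure R)
    (y₀ : 𝒴) (t : ℕ) :
    (M.runLaw ν).map (fun z => (z.1.2 t, M.past y₀ t z))
      = (ν t : Measure R).prod ((M.runLaw ν).map (M.past y₀ t)) := by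
  have hpast := M.measurable_past y₀ t
  have hr : Measurable fun z : (M.Ω × (ℕ → R)) × (ℕ → 𝒴) => z.1.2 t := by fun_prop
  have hpair := hr.prodMk hpast
  refine Measure.ext fun S hS => ?_
  rw [← lintegral_indicator_one hS, ← lintegral_indicator_one hS]
  set H : R × M.Ω × (Fin t → R) × (ℕ → 𝒴) → ENNReal := S.indicator 1 with hH
  have hHm : Measurable H := measurable_one.indicator hS
  rw [lintegral_map hHm hpair, lintegral_prod_symm _ hHm.aemeasurable,
    lintegral_map hHm.lintegral_prod_left' hpast]
  rw [runLaw, Measure.lintegral_compProd (f := fun z => H (z.1.2 t, M.past y₀ t z))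
      (hHm.comp hpair),
    Measure.lintegral_compProd (f := fun z => ∫⁻ x, H (x, M.past y₀ t z) ∂(ν t : Measure R))
      (hHm.lintegral_prod_left'.comp hpast)]
  have hJm : Measurable fun p : M.Ω × (ℕ → R) =>
      ∫⁻ y, H (p.2 t, M.past y₀ t (p, y)) ∂M.responseKernel p :=
    (hHm.comp hpair).lintegral_kernel_prod_right'
  rw [lintegral_prod _ hJm.aemeasurable, lintegral_prod]
  swap
  · exact ((hHm.lintegral_prod_left'.comp hpast).lintegral_kernel_prod_right').aemeasurable
  refine lintegral_congr fun ω => ?_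
  have hJω : Measurable fun r : ℕ → R =>
      ∫⁻ y, H (r t, M.past y₀ t ((ω, r), y)) ∂M.responseKernel (ω, r) :=
    hJm.comp (measurable_prodMk_left (x := ω))
  have hup : Measurable fun p : (ℕ → R) × R => Function.update p.1 t p.2 := measurable_update'
  conv_lhs => rw [← infinitePi_map_update (fun t => (ν t : Measure R)) t]
  refine (lintegral_map hJω hup).trans ?_
  refine (lintegral_prod _ (hJω.comp hup).aemeasurable).trans (lintegral_congr fun r => ?_)
  have hkey : ∀ ρ, ∫⁻ y, H (Function.update r t ρ t, M.past y₀ t ((ω, Function.update r t ρ), y))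
      ∂M.responseKernel (ω, Function.update r t ρ)
      = ∫⁻ y, H (ρ, M.past y₀ t ((ω, r), y)) ∂M.responseKernel (ω, r) := by
    intro ρ
    have hg : Measurable fun v : ℕ → 𝒴 => H (ρ, ω, (fun s : Fin t => r s), v) :=
      hHm.comp (by fun_prop)
    have e1 : ∀ y, H (Function.update r t ρ t, M.past y₀ t ((ω, Function.update r t ρ), y))
        = H (ρ, ω, (fun s : Fin t => r s), truncate y₀ t y) := by
      intro y
      have : (fun s : Fin t => Function.update r t ρ s) = fun s : Fin t => r s :=
        funext fun s => Function.update_of_ne (by have := s.2; omega) _ _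
      simp only [past, this, Function.update_self]
    simp only [e1]
    simp only [past]
    rw [← lintegral_map hg (measurable_truncate y₀ t), ← lintegral_map hg (measurable_truncate y₀ t),
      M.responseKernel_map_truncate y₀ t ω (r := Function.update r t ρ) (r' := r)
        fun s hs => Function.update_of_ne hs.ne _ _]
  refine (lintegral_congr hkey).trans ?_
  rw [lintegral_lintegral_swap]
  exact (hHm.comp (measurable_fst.prodMk (hpast.comp
    (measurable_const.prodMk measurable_snd)))).aemeasurable

/-- A function of the randomness at time `t` and of the past, centered given the past, is
orthogonal to the past. -/
theorem integral_mul_past_eq_zero (M : AdversarialMechanism R μ 𝒴) (ν : ℕ → ProbabilityMeasure R)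
    (y₀ : 𝒴) (t : ℕ) {φ : R × M.Ω × (Fin t → R) × (ℕ → 𝒴) → ℝ}
    {ψ : M.Ω × (Fin t → R) × (ℕ → 𝒴) → ℝ} (hφ : Measurable φ) (hψ : Measurable ψ) {C : ℝ}
    (hφC : ∀ p, |φ p| ≤ C) (hψC : ∀ p, |ψ p| ≤ C)
    (h0 : ∀ g, ∫ ρ, φ (ρ, g) ∂(ν t : Measure R) = 0) :
    ∫ z, ψ (M.past y₀ t z) * φ (z.1.2 t, M.past y₀ t z) ∂(M.runLaw ν) = 0 := by
  have hpast := M.measurable_past y₀ t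
  have hr : Measurable fun z : (M.Ω × (ℕ → R)) × (ℕ → 𝒴) => z.1.2 t := by fun_prop
  have hpair := hr.prodMk hpast
  have hf : Measurable fun q : R × M.Ω × (Fin t → R) × (ℕ → 𝒴) => ψ q.2 * φ q :=
    (hψ.comp measurable_snd).mul hφ
  have hprob : IsProbabilityMeasure ((M.runLaw ν).map (M.past y₀ t)) :=
    Measure.isProbabilityMeasure_map hpast.aemeasurable
  have e := integral_map (μ := M.runLaw ν) hpair.aemeasurable
    (f := fun q : R × M.Ω × (Fin t → R) × (ℕ → 𝒴) => ψ q.2 * φ q) hf.aestronglyMeasurable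
  rw [M.runLaw_map_past] at e
  rw [← e, integral_prod_symm _ (integrable_of_abs_le (C := C * C) hf fun q => by
    rw [abs_mul]
    exact mul_le_mul (hψC _) (hφC _) (abs_nonneg _) ((abs_nonneg _).trans (hψC q.2)))]
  simp only [integral_const_mul, h0, mul_zero, integral_zero]

theorem ae_runLaw_of_ae (M : AdversarialMechanism R μ 𝒴) (ν : ℕ → ProbabilityMeasure R)
    {p : (ℕ → 𝒳) → Prop} (h : ∀ᵐ x ∂(μ : Measure (ℕ → 𝒳)), p x) :
    ∀ᵐ z ∂(M.runLaw ν), p fun t => M.X t z.1.1 := by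
  rw [← M.law_X] at h
  have h1 := ae_of_ae_map (measurable_pi_iff.2 M.measurable_X).aemeasurable h
  have h2 : (M.runLaw ν).map (fun z => z.1.1) = M.P := by
    have : (fun z : (M.Ω × (ℕ → R)) × (ℕ → 𝒴) => z.1.1) = Prod.fst ∘ Prod.fst := rfl
    rw [this, ← Measure.map_map measurable_fst measurable_fst]
    change ((M.runLaw ν).fst).fst = _
    rw [runLaw, Measure.fst_compProd, Measure.fst_prod]
  rw [← h2] at h1
  exact ae_of_ae_map (f := fun z : (M.Ω × (ℕ → R)) × (ℕ → 𝒴) => z.1.1) (by fun_prop) h1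

end AdversarialMechanism

/-! ### The learning rule -/

section Rule

variable {𝒳 𝒴 : Type u}

/-- The losses of the experts `F j` on the instances `x` and the values `y`. -/
def expertLoss (ℓ : 𝒴 → 𝒴 → ℝ) (F : ℕ → 𝒳 → 𝒴) (x : ℕ → 𝒳) (y : ℕ → 𝒴) : ℕ → ℕ → ℝ :=
  fun s j => ℓ (F j (x s)) (y s)

/-- The losses of the experts `F j` before time `t`, and `0` afterwards. -/
noncomputable def pastExpertLoss (ℓ : 𝒴 → 𝒴 → ℝ) (F : ℕ → 𝒳 → 𝒴) (t : ℕ) (x : Fin t → 𝒳)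
    (y : Fin t → 𝒴) : ℕ → ℕ → ℝ :=
  fun s j => if h : s < t then ℓ (F j (x ⟨s, h⟩)) (y ⟨s, h⟩) else 0

variable {κ : ℕ → ℝ} {ℓ : 𝒴 → 𝒴 → ℝ} {F : ℕ → 𝒳 → 𝒴} {C : ℝ}

/-- The loss at time `t` when the expert is drawn with `v`, minus its conditional expectation. -/
noncomputable def drawnLossDev (κ : ℕ → ℝ) (ℓ : 𝒴 → 𝒴 → ℝ) (F : ℕ → 𝒳 → 𝒴) (t : ℕ)
    (v : ULift.{u} ℝ) (x : ℕ → 𝒳) (y : ℕ → 𝒴) : ℝ :=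
  ℓ (F (drawIndex (t + 1) (prodProb κ (expertLoss ℓ F x y) t) v.down) (x t)) (y t)
    - prodLoss κ (expertLoss ℓ F x y) t

theorem drawnLossDev_truncate (y₀ : 𝒴) {s t : ℕ} (hst : s ≤ t) (v : ULift.{u} ℝ) (x : ℕ → 𝒳)
    (y : ℕ → 𝒴) :
    drawnLossDev κ ℓ F s v x (AdversarialMechanism.truncate y₀ t y)
      = drawnLossDev κ ℓ F s v x y := by
  have h : ∀ u ≤ s, expertLoss ℓ F x (AdversarialMechanism.truncate y₀ t y) u
      = expertLoss ℓ F x y u := fun u hu => by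
    funext j
    simp [expertLoss, AdversarialMechanism.truncate, hu.trans hst]
  have h1 : prodProb κ (expertLoss ℓ F x (AdversarialMechanism.truncate y₀ t y)) s
      = prodProb κ (expertLoss ℓ F x y) s := prodProb_congr fun u hu => h u hu.le
  simp only [drawnLossDev, prodLoss, h1, h s le_rfl]
  simp [AdversarialMechanism.truncate, hst]

theorem abs_drawnLossDev_le (hκ : ∀ j, 0 < κ j) (hκC : ∀ j, κ j * C ≤ 1 / 2)
    (hC : ∀ y y', ℓ y y' ∈ Set.Icc 0 C) (t : ℕ) (v : ULift.{u} ℝ) (x : ℕ → 𝒳) (y : ℕ → 𝒴) :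
    |drawnLossDev κ ℓ F t v x y| ≤ C := by
  have h1 := prodLoss_mem hκ hκC (a := expertLoss ℓ F x y) (fun s j => hC _ _) t
  have h2 := hC (F (drawIndex (t + 1) (prodProb κ (expertLoss ℓ F x y) t) v.down) (x t)) (y t)
  rw [drawnLossDev, abs_le]
  constructor <;> linarith [h1.1, h1.2, h2.1, h2.2]

theorem integral_drawnLossDev (hκ : ∀ j, 0 < κ j) (hκC : ∀ j, κ j * C ≤ 1 / 2)
    (hC : ∀ y y', ℓ y y' ∈ Set.Icc 0 C) (t : ℕ) (x : ℕ → 𝒳) (y : ℕ → 𝒴) :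
    ∫ v, drawnLossDev κ ℓ F t v x y ∂(uniformLaw.{u} : Measure (ULift.{u} ℝ)) = 0 := by
  have ha : ∀ s j, expertLoss ℓ F x y s j ∈ Set.Icc 0 C := fun s j => hC _ _
  have h := integral_uniformLaw_drawIndex (prodProb_nonneg hκ hκC ha t) (sum_prodProb hκ hκC ha t)
    (expertLoss ℓ F x y t)
  have hi : Integrable (fun v => expertLoss ℓ F x y t
      (drawIndex (t + 1) (prodProb κ (expertLoss ℓ F x y) t) (ULift.down v)))
      (uniformLaw.{u} : Measure (ULift.{u} ℝ)) := by
    refine integrable_of_abs_le (C := C) ?_ fun v => ?_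
    · exact (measurable_from_top (f := expertLoss ℓ F x y t)).comp
        (measurable_drawIndex _ (fun j => measurable_const) measurable_down)
    · rw [abs_of_nonneg (ha _ _).1]; exact (ha _ _).2
  change ∫ v, (expertLoss ℓ F x y t
      (drawIndex (t + 1) (prodProb κ (expertLoss ℓ F x y) t) (ULift.down v))
    - prodLoss κ (expertLoss ℓ F x y) t) ∂_ = 0
  rw [integral_sub hi (integrable_const _), h]
  simp [prodLoss]

variable [MeasurableSpace 𝒳] [MeasurableSpace 𝒴]

theorem measurable_expertLoss {Ω : Type*} [MeasurableSpace Ω] {ℓ : 𝒴 → 𝒴 → ℝ}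
    (hℓ : Measurable fun p : 𝒴 × 𝒴 => ℓ p.1 p.2) {F : ℕ → 𝒳 → 𝒴} (hF : ∀ j, Measurable (F j))
    {x : Ω → ℕ → 𝒳} {y : Ω → ℕ → 𝒴} (hx : ∀ t, Measurable fun ω => x ω t)
    (hy : ∀ t, Measurable fun ω => y ω t) (t j : ℕ) :
    Measurable fun ω => expertLoss ℓ F (x ω) (y ω) t j :=
  hℓ.comp (((hF j).comp (hx t)).prodMk (hy t))

theorem measurable_pastExpertLoss {Ω : Type*} [MeasurableSpace Ω] {ℓ : 𝒴 → 𝒴 → ℝ}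
    (hℓ : Measurable fun p : 𝒴 × 𝒴 => ℓ p.1 p.2) {F : ℕ → 𝒳 → 𝒴} (hF : ∀ j, Measurable (F j))
    {t : ℕ} {x : Ω → Fin t → 𝒳} {y : Ω → Fin t → 𝒴} (hx : Measurable x) (hy : Measurable y)
    (s j : ℕ) : Measurable fun ω => pastExpertLoss ℓ F t (x ω) (y ω) s j := by
  unfold pastExpertLoss
  split_ifs with h
  · exact hℓ.comp (((hF j).comp ((measurable_pi_apply _).comp hx)).prodMk
      ((measurable_pi_apply _).comp hy))
  · exact measurable_const

theorem measurable_apply_index {Ω β γ : Type*} [MeasurableSpace Ω] [MeasurableSpace β]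
    [MeasurableSpace γ] {F : ℕ → β → γ} (hF : ∀ j, Measurable (F j)) {n : Ω → ℕ} {x : Ω → β}
    (hn : Measurable n) (hx : Measurable x) : Measurable fun ω => F (n ω) (x ω) :=
  (measurable_from_prod_countable_right (f := fun q : ℕ × β => F q.1 q.2) hF).comp (hn.prodMk hx)

/-- The rule which predicts with an expert drawn at random from the forecaster's weights. -/
noncomputable def weightedExpertsRule (κ : ℕ → ℝ) (ℓ : 𝒴 → 𝒴 → ℝ)
    (hℓ : Measurable fun p : 𝒴 × 𝒴 => ℓ p.1 p.2) (F : ℕ → 𝒳 → 𝒴) (hF : ∀ j, Measurable (F j)) :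
    OnlineLearningRule 𝒳 𝒴 where
  R := ULift.{u} ℝ
  ν := fun _ => uniformLaw
  predict t p :=
    F (drawIndex (t + 1) (prodProb κ (pastExpertLoss ℓ F t p.2.1 p.2.2.1) t) p.1.down) p.2.2.2
  measurable_predict t := by
    refine measurable_apply_index hF (measurable_drawIndex _ (fun j => ?_)
      (measurable_down.comp measurable_fst)) (by fun_prop)
    exact measurable_prodProb (fun s j => measurable_pastExpertLoss hℓ hF (by fun_prop)
      (by fun_prop) s j) t j

/-- The zero losses that pad the future in the rule are invisible, because the probabilities at time
`t` use only earlier losses. -/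
theorem weightedExpertsRule_prediction {hℓ : Measurable fun p : 𝒴 × 𝒴 => ℓ p.1 p.2}
    {hF : ∀ j, Measurable (F j)} (r : ℕ → ULift.{u} ℝ) (x : ℕ → 𝒳) (y : ℕ → 𝒴) (t : ℕ) :
    (weightedExpertsRule κ ℓ hℓ F hF).prediction r x y t
      = F (drawIndex (t + 1) (prodProb κ (expertLoss ℓ F x y) t) (r t).down) (x t) := by
  simp only [OnlineLearningRule.prediction, weightedExpertsRule]
  rw [prodProb_congr (b := expertLoss ℓ F x y)]
  intro s hs
  funext j
  simp [pastExpertLoss, expertLoss, hs]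

theorem measurable_drawnLossDev (hℓ : Measurable fun p : 𝒴 × 𝒴 => ℓ p.1 p.2)
    (hF : ∀ j, Measurable (F j)) {Ω : Type*} [MeasurableSpace Ω] {v : Ω → ULift.{u} ℝ}
    {x : Ω → ℕ → 𝒳} {y : Ω → ℕ → 𝒴} (hv : Measurable v) (hx : ∀ t, Measurable fun ω => x ω t)
    (hy : ∀ t, Measurable fun ω => y ω t) (t : ℕ) :
    Measurable fun ω => drawnLossDev κ ℓ F t (v ω) (x ω) (y ω) := by
  have ha := measurable_expertLoss hℓ hF hx hy
  refine Measurable.sub (hℓ.comp (Measurable.prodMk ?_ (hy t))) (measurable_prodLoss ha t)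
  exact measurable_apply_index hF (measurable_drawIndex _ (fun j => measurable_prodProb ha t j)
      (measurable_down.comp hv)) (hx t)

theorem ae_tendsto_drawnLossDev {μ : ProbabilityMeasure (ℕ → 𝒳)} (hκ : ∀ j, 0 < κ j)
    (hκC : ∀ j, κ j * C ≤ 1 / 2) (hC : ∀ y y', ℓ y y' ∈ Set.Icc 0 C)
    (hℓ : Measurable fun p : 𝒴 × 𝒴 => ℓ p.1 p.2) (hF : ∀ j, Measurable (F j))
    (M : AdversarialMechanism (ULift.{u} ℝ) μ 𝒴) (y₀ : 𝒴) :
    ∀ᵐ z ∂(M.runLaw fun _ => uniformLaw), Tendsto (timeAverage fun t =>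
      drawnLossDev κ ℓ F t (z.1.2 t) (fun t => M.X t z.1.1) z.2) atTop (𝓝 0) := by
  let D : ℕ → (M.Ω × (ℕ → ULift.{u} ℝ)) × (ℕ → 𝒴) → ℝ := fun t z =>
    drawnLossDev κ ℓ F t (z.1.2 t) (fun t => M.X t z.1.1) z.2
  have hD : ∀ t, Measurable (D t) := fun t =>
    measurable_drawnLossDev hℓ hF (v := fun z : (M.Ω × (ℕ → ULift.{u} ℝ)) × (ℕ → 𝒴) => z.1.2 t)
      (x := fun z t => M.X t z.1.1) (y := fun z => z.2) (by fun_prop)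
      (fun t => (M.measurable_X t).comp (by fun_prop)) (fun t => by fun_prop) t
  have hDC : ∀ t z, |D t z| ≤ C := fun t z => abs_drawnLossDev_le hκ hκC hC t _ _ _
  refine ae_tendsto_timeAverage (D := D) hD hDC fun s t hst => ?_
  let φ : ULift.{u} ℝ × M.Ω × (Fin t → ULift.{u} ℝ) × (ℕ → 𝒴) → ℝ :=
    fun p => drawnLossDev κ ℓ F t p.1 (fun t => M.X t p.2.1) p.2.2.2
  let ψ : M.Ω × (Fin t → ULift.{u} ℝ) × (ℕ → 𝒴) → ℝ :=
    fun p => drawnLossDev κ ℓ F s (p.2.1 ⟨s, hst⟩) (fun t => M.X t p.1) p.2.2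
  have hφ : Measurable φ := measurable_drawnLossDev hℓ hF
    (v := fun p : ULift.{u} ℝ × M.Ω × (Fin t → ULift.{u} ℝ) × (ℕ → 𝒴) => p.1)
    (x := fun p t => M.X t p.2.1) (y := fun p => p.2.2.2) (by fun_prop)
    (fun t => (M.measurable_X t).comp (by fun_prop)) (fun t => by fun_prop) t
  have hψ : Measurable ψ := measurable_drawnLossDev hℓ hF
    (v := fun p : M.Ω × (Fin t → ULift.{u} ℝ) × (ℕ → 𝒴) => p.2.1 ⟨s, hst⟩)
    (x := fun p t => M.X t p.1) (y := fun p => p.2.2) (by fun_prop)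
    (fun t => (M.measurable_X t).comp (by fun_prop)) (fun t => by fun_prop) s
  have hφC : ∀ p, |φ p| ≤ C := fun p => abs_drawnLossDev_le hκ hκC hC _ _ _ _
  have hψC : ∀ p, |ψ p| ≤ C := fun p => abs_drawnLossDev_le hκ hκC hC _ _ _ _
  have h0 : ∀ g, ∫ ρ, φ (ρ, g) ∂(uniformLaw.{u} : Measure (ULift.{u} ℝ)) = 0 := fun g =>
    integral_drawnLossDev hκ hκC hC t (fun t => M.X t g.1) g.2.2
  have h := M.integral_mul_past_eq_zero (fun _ => uniformLaw) y₀ t hφ hψ hφC hψC h0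
  refine (integral_congr_ae (Eventually.of_forall fun z => ?_)).trans h
  exact congrArg₂ (· * ·) (drawnLossDev_truncate y₀ hst.le _ _ _).symm
    (drawnLossDev_truncate y₀ le_rfl _ _ _).symm

/-- The realized regret is the deviation of the draw plus the forecaster's regret. After division by
`T`, only the term linear in `T` of the regret bound survives. -/
theorem weightedExpertsRule_le (hκ : ∀ j, 0 < κ j)
    (hκC : ∀ j, κ j * C ≤ 1 / 2) (hC : ∀ y y', ℓ y y' ∈ Set.Icc 0 C)
    (hℓ : Measurable fun p : 𝒴 × 𝒴 => ℓ p.1 p.2) (hF : ∀ j, Measurable (F j))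
    {r : ℕ → ULift.{u} ℝ} {x : ℕ → 𝒳} {y : ℕ → 𝒴}
    (hz : Tendsto (timeAverage fun t => drawnLossDev κ ℓ F t (r t) x y) atTop (𝓝 0)) (j : ℕ)
    {ε : ℝ} (hε : 0 < ε) : ∀ᶠ T in atTop, timeAverage (fun t =>
      ℓ ((weightedExpertsRule κ ℓ hℓ F hF).prediction r x y t) (y t) - ℓ (F j (x t)) (y t)) T
        ≤ 2 * κ j * C ^ 2 + ε := by
  set a := expertLoss ℓ F x y with ha
  have hlim : Tendsto (fun T : ℕ => ((j + 1) / κ j + C * j) / (T : ℝ)) atTop (𝓝 0) :=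
    tendsto_const_div_atTop_nhds_zero_nat _
  filter_upwards [hz.eventually (gt_mem_nhds (half_pos hε)),
    hlim.eventually (gt_mem_nhds (half_pos hε)), eventually_gt_atTop 0] with T h1 h2 hT
  have hT' : (0 : ℝ) < T := by exact_mod_cast hT
  have h3 := sum_prodLoss_sub_le hκ hκC (a := a) (fun s j => hC _ _) j T
  have h4 : timeAverage (fun t => prodLoss κ a t - a t j) T
      ≤ ((j + 1) / κ j + C * j) / (T : ℝ) + 2 * κ j * C ^ 2 := by
    rw [timeAverage]
    calc 1 / (T : ℝ) * ∑ t ∈ Finset.range T, (prodLoss κ a t - a t j)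
        ≤ 1 / (T : ℝ) * ((j + 1) / κ j + C * j + 2 * κ j * C ^ 2 * T) :=
          mul_le_mul_of_nonneg_left h3 (by positivity)
      _ = ((j + 1) / κ j + C * j) / (T : ℝ) + 2 * κ j * C ^ 2 := by field_simp
  have h5 : ∀ t, ℓ ((weightedExpertsRule κ ℓ hℓ F hF).prediction r x y t) (y t)
      - ℓ (F j (x t)) (y t) = drawnLossDev κ ℓ F t (r t) x y + (prodLoss κ a t - a t j) := by
    intro t
    rw [weightedExpertsRule_prediction]
    simp only [drawnLossDev, ha, expertLoss]
    ring
  simp only [h5]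
  rw [timeAverage_add]
  linarith

/-- If the upper frequencies of some sets have mean arbitrarily close to zero, then almost surely
some of them are small. -/
theorem ae_exists_upperFrequency_lt {μ : ProbabilityMeasure (ℕ → 𝒳)} {S : ℕ → Set 𝒳}
    (hS : ∀ n, MeasurableSet (S n)) (h : ∀ ε : ℝ, 0 < ε → ∃ n, meanFrequency μ (S n) < ε)
    {η : ℝ} (hη : 0 < η) :
    ∀ᵐ x ∂(μ : Measure (ℕ → 𝒳)), ∃ n, upperFrequency x (S n) < η := by
  have hle : ∀ ε : ℝ, 0 < ε →
      (μ : Measure (ℕ → 𝒳)).real {x | ∀ n, η ≤ upperFrequency x (S n)} ≤ ε := by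
    intro ε hε
    obtain ⟨n, hn⟩ := h (η * ε) (mul_pos hη hε)
    -- Markov's inequality for a set whose mean frequency is below `η * ε`.
    have h1 := mul_meas_ge_le_integral_of_nonneg
      (Eventually.of_forall fun x => upperFrequency_nonneg x (S n))
      (integrable_upperFrequency μ (hS n)) η
    have h2 : (μ : Measure (ℕ → 𝒳)).real {x | ∀ n, η ≤ upperFrequency x (S n)}
        ≤ (μ : Measure (ℕ → 𝒳)).real {x | η ≤ upperFrequency x (S n)} :=
      measureReal_mono fun x hx => hx n
    have h3 : η * (μ : Measure (ℕ → 𝒳)).real {x | η ≤ upperFrequency x (S n)} ≤ η * ε :=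
      h1.trans hn.le
    exact h2.trans (le_of_mul_le_mul_left h3 hη)
  have h0 : (μ : Measure (ℕ → 𝒳)).real {x | ∀ n, η ≤ upperFrequency x (S n)} = 0 :=
    le_antisymm (le_of_forall_pos_le_add fun ε hε => by simpa using hle ε hε) measureReal_nonneg
  rw [measureReal_eq_zero_iff] at h0
  rw [ae_iff]
  simpa only [not_exists, not_lt] using h0

end Rule

/-! ### Power losses and comparison with arbitrary measurable functions -/

section PowLoss

variable {𝒴 : Type u} [MetricSpace 𝒴] {α : ℝ}

theorem powLoss_nonneg (α : ℝ) (y y' : 𝒴) : 0 ≤ powLoss α y y' := Real.rpow_nonneg dist_nonneg _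

theorem powLoss_self (hα : α ≠ 0) (y : 𝒴) : powLoss α y y = 0 := by
  simp [powLoss, Real.zero_rpow hα]

theorem measurable_powLoss [TopologicalSpace.SeparableSpace 𝒴] [MeasurableSpace 𝒴] [BorelSpace 𝒴]
    (α : ℝ) : Measurable fun p : 𝒴 × 𝒴 => powLoss α p.1 p.2 := by
  have : SecondCountableTopology 𝒴 := UniformSpace.secondCountable_of_separable 𝒴
  exact (measurable_fst.dist measurable_snd).pow_const α

/-- A bounded power loss is uniformly continuous in its first argument. -/
theorem exists_powLoss_le_add (hα : 0 < α) {C : ℝ} (hC : ∀ y y' : 𝒴, powLoss α y y' ≤ C) {ε : ℝ}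
    (hε : 0 < ε) : ∃ δ > 0, ∀ y₁ y₂ y : 𝒴, dist y₁ y₂ ≤ δ →
      powLoss α y₁ y ≤ powLoss α y₂ y + ε := by
  -- Boundedness of the loss confines all distances to a compact interval, on which the power is
  -- uniformly continuous.
  have hd : ∀ y y' : 𝒴, dist y y' ∈ Set.Icc 0 (C ^ α⁻¹) := fun y y' => by
    refine ⟨dist_nonneg, ?_⟩
    have h := Real.rpow_le_rpow (powLoss_nonneg α y y') (hC y y') (inv_nonneg.2 hα.le)
    rwa [powLoss, Real.rpow_rpow_inv dist_nonneg hα.ne'] at h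
  have huc : UniformContinuousOn (fun a : ℝ => a ^ α) (Set.Icc 0 (C ^ α⁻¹)) :=
    isCompact_Icc.uniformContinuousOn_of_continuous
      (Real.continuous_rpow_const hα.le).continuousOn
  rw [Metric.uniformContinuousOn_iff] at huc
  obtain ⟨δ, hδ, h⟩ := huc ε hε
  refine ⟨δ / 2, half_pos hδ, fun y₁ y₂ y hy => ?_⟩
  have h1 := h _ (hd y₁ y) _ (hd y₂ y) (by
    rw [Real.dist_eq]
    exact (abs_dist_sub_le y₁ y₂ y).trans_lt (by linarith))
  rw [Real.dist_eq] at h1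
  have := (abs_lt.1 h1).2
  simp only [powLoss]
  linarith

end PowLoss

/-- Pass through an expert `F n`: its excess over `h` is small where the two are close, and at most
`C` on a set visited rarely. The argument is pathwise, so `n` may depend on the path. -/
theorem excessLoss_nonpos {𝒳 𝒴 : Type u} [MeasurableSpace 𝒳] [MetricSpace 𝒴] [MeasurableSpace 𝒴]
    {α C : ℝ} (hα : 0 < α) (hCpos : 0 < C) (hCle : ∀ y y' : 𝒴, powLoss α y y' ≤ C)
    {f : OnlineLearningRule 𝒳 𝒴} {F : ℕ → 𝒳 → 𝒴} {h : 𝒳 → 𝒴} {r : ℕ → f.R} {x : ℕ → 𝒳} {y : ℕ → 𝒴}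
    (h1 : ∀ n, ∀ ε : ℝ, 0 < ε → ∀ᶠ T in atTop, timeAverage (fun t =>
      powLoss α (f.prediction r x y t) (y t) - powLoss α (F n (x t)) (y t)) T ≤ ε)
    (h2 : ∀ m m' : ℕ, ∃ n,
      upperFrequency x {x | 1 / ((m : ℝ) + 1) < dist (F n x) (h x)} < 1 / ((m' : ℝ) + 1)) :
    f.excessLoss (powLoss α) h r x y ≤ 0 := by
  have key : ∀ ε : ℝ, 0 < ε → ∀ᶠ T in atTop, timeAverage (fun t =>
      powLoss α (f.prediction r x y t) (y t) - powLoss α (h (x t)) (y t)) T ≤ ε := by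
    intro ε hε
    obtain ⟨δ, hδ, hδε⟩ := exists_powLoss_le_add hα hCle (ε := ε / 4) (by positivity)
    obtain ⟨m, hm⟩ := exists_nat_one_div_lt hδ
    obtain ⟨m', hm'⟩ := exists_nat_one_div_lt (show 0 < ε / (4 * C) by positivity)
    obtain ⟨n, hn⟩ := h2 m m'
    have h3 := eventually_lt_of_limsup_lt (hn.trans hm') (isBoundedUnder_visitFrequency x _)
    filter_upwards [h1 n (ε / 4) (by positivity), h3] with T h4 h5
    have h7 : ∀ t, powLoss α (F n (x t)) (y t) - powLoss α (h (x t)) (y t)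
        ≤ ε / 4 + C * {x | 1 / ((m : ℝ) + 1) < dist (F n x) (h x)}.indicator
          (fun _ => (1 : ℝ)) (x t) := by
      intro t
      by_cases ht : 1 / ((m : ℝ) + 1) < dist (F n (x t)) (h (x t))
      · rw [Set.indicator_of_mem (by exact ht)]
        linarith [hCle (F n (x t)) (y t), powLoss_nonneg α (h (x t)) (y t)]
      · rw [Set.indicator_of_notMem (by exact ht)]
        linarith [hδε (F n (x t)) (h (x t)) (y t) ((not_lt.1 ht).trans hm.le)]
    have h8 : timeAverage (fun t => powLoss α (F n (x t)) (y t)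
        - powLoss α (h (x t)) (y t)) T ≤ ε / 4 + C * (ε / (4 * C)) := by
      refine (timeAverage_mono h7 T).trans ?_
      rw [timeAverage_add, timeAverage_const_mul]
      exact add_le_add (timeAverage_le (by positivity) (fun _ => le_rfl) T)
        (mul_le_mul_of_nonneg_left h5.le hCpos.le)
    have h9 : C * (ε / (4 * C)) = ε / 4 := by field_simp
    have h10 : timeAverage (fun t => powLoss α (f.prediction r x y t) (y t)
        - powLoss α (h (x t)) (y t)) T
        = timeAverage (fun t => powLoss α (f.prediction r x y t) (y t)
          - powLoss α (F n (x t)) (y t)) T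
        + timeAverage (fun t => powLoss α (F n (x t)) (y t)
          - powLoss α (h (x t)) (y t)) T := by
      rw [← timeAverage_add]; congr 1; funext t; ring
    rw [h10]
    linarith
  refine le_of_forall_gt fun c hc => ?_
  obtain ⟨ε, hε, hεc⟩ := EReal.exists_between_coe_real hc
  refine lt_of_le_of_lt (limsup_le_of_le (by isBoundedDefault) ?_) hεc
  filter_upwards [key ε (by exact_mod_cast hε)] with T hT
  exact_mod_cast hT

/-- A bounded power loss admits a rule which is universally consistent under all processes
in CS. -/
theorem exists_universallyConsistent_of_CS {𝒳 𝒴 : Type u}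
    [MetricSpace 𝒳] [TopologicalSpace.SeparableSpace 𝒳] [MeasurableSpace 𝒳] [BorelSpace 𝒳]
    [MetricSpace 𝒴] [TopologicalSpace.SeparableSpace 𝒴] [MeasurableSpace 𝒴] [BorelSpace 𝒴]
    [Nonempty 𝒴] {α : ℝ} (hα : 0 < α) (hbdd : ∃ C : ℝ, ∀ y y' : 𝒴, powLoss α y y' ≤ C) :
    ∃ f : OnlineLearningRule 𝒳 𝒴, ∀ μ ∈ CS 𝒳,
      f.UniversallyConsistent (powLoss α : 𝒴 → 𝒴 → ℝ) μ := by
  have : SecondCountableTopology 𝒴 := UniformSpace.secondCountable_of_separable 𝒴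
  obtain ⟨C₀, hC₀⟩ := hbdd
  set C : ℝ := max C₀ 1 with hCdef
  have hCpos : 0 < C := lt_of_lt_of_le one_pos (le_max_right _ _)
  have hCle : ∀ y y' : 𝒴, powLoss α y y' ≤ C := fun y y' => (hC₀ y y').trans (le_max_left _ _)
  have hC : ∀ y y' : 𝒴, powLoss α y y' ∈ Set.Icc 0 C := fun y y' =>
    ⟨powLoss_nonneg α y y', hCle y y'⟩
  obtain ⟨F, hF, hdense⟩ := exists_dense_class (𝒳 := 𝒳) (𝒴 := 𝒴)
  -- Expert `Nat.pair n k` plays `F n` at rate `1 / (2 * C * (k + 1))`: each function occurs with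
  -- rates tending to zero, and the factor `2 * C` ensures `κ j * C ≤ 1 / 2`.
  let κ : ℕ → ℝ := fun j => 1 / (2 * C * ((Nat.unpair j).2 + 1))
  have hκ : ∀ j, 0 < κ j := fun j => by positivity
  have hκC : ∀ j, κ j * C ≤ 1 / 2 := fun j => by
    have h : κ j * C = 1 / 2 * (1 / ((Nat.unpair j).2 + 1)) := by
      simp only [κ]; field_simp
    rw [h]
    have h2 : 1 / (((Nat.unpair j).2 : ℝ) + 1) ≤ 1 := by
      rw [div_le_one (by positivity)]; linarith [(Nat.unpair j).2.cast_nonneg (α := ℝ)]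
    linarith
  refine ⟨weightedExpertsRule κ (powLoss α) (measurable_powLoss α)
    (fun j => F (Nat.unpair j).1) (fun j => hF _), fun μ hμ M _ h hh => ?_⟩
  have hS : ∀ (δ : ℝ) n, MeasurableSet {x | δ < dist (F n x) (h x)} := fun δ n =>
    measurableSet_lt measurable_const ((hF n).dist hh)
  have hae : ∀ᵐ x ∂(μ : Measure (ℕ → 𝒳)), ∀ m m' : ℕ, ∃ n,
      upperFrequency x {x | 1 / ((m : ℝ) + 1) < dist (F n x) (h x)} < 1 / ((m' : ℝ) + 1) := by
    refine ae_all_iff.2 fun m => ae_all_iff.2 fun m' => ?_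
    exact ae_exists_upperFrequency_lt (fun n => hS _ n)
      (fun ε hε => hdense μ hμ h hh _ Nat.one_div_pos_of_nat ε hε) Nat.one_div_pos_of_nat
  have hdev : ∀ᵐ z ∂(M.runLaw fun _ => uniformLaw), Tendsto (timeAverage fun t =>
      drawnLossDev κ (powLoss α) (fun j => F (Nat.unpair j).1) t (z.1.2 t)
        (fun t => M.X t z.1.1) z.2) atTop (𝓝 0) :=
    ae_tendsto_drawnLossDev hκ hκC hC (measurable_powLoss α) (fun j => hF (Nat.unpair j).1) M
      (Classical.arbitrary 𝒴)
  filter_upwards [hdev, M.ae_runLaw_of_ae _ hae] with z h0 h2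
  have h1 := fun j (ε : ℝ) (hε : 0 < ε) => weightedExpertsRule_le hκ hκC hC (measurable_powLoss α)
    (fun j => hF (Nat.unpair j).1) h0 j hε
  refine excessLoss_nonpos hα hCpos hCle (fun n ε hε => ?_) h2
  obtain ⟨k, hk⟩ := exists_nat_one_div_lt (show 0 < ε / (2 * C) by positivity)
  filter_upwards [h1 (Nat.pair n k) (ε / 2) (by positivity)] with T h4
  simp only [Nat.unpair_pair, κ] at h4
  have h6 : 2 * (1 / (2 * C * ((k : ℝ) + 1))) * C ^ 2 ≤ ε / 2 := by
    calc 2 * (1 / (2 * C * ((k : ℝ) + 1))) * C ^ 2 = C * (1 / ((k : ℝ) + 1)) := by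
          field_simp
      _ ≤ C * (ε / (2 * C)) := mul_le_mul_of_nonneg_left hk.le hCpos.le
      _ = ε / 2 := by field_simp
  linarith

/-! ### Mean estimation against several rules at once -/

section MeanEstimation

/-- The sequence `y`, continued by `y₀`. -/
def extendSeq {𝒴 : Type u} (y₀ : 𝒴) {t : ℕ}
    (y : Fin t → 𝒴) : ℕ → 𝒴 := fun s => if h : s < t then y ⟨s, h⟩ else y₀

theorem extendSeq_of_lt {𝒴 : Type u} (y₀ : 𝒴) (y : ℕ → 𝒴) {s t : ℕ} (h : s < t) :
    extendSeq y₀ (fun s : Fin t => y s) s = y s := by simp [extendSeq, h]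

variable {𝒴 : Type u} [MeasurableSpace 𝒴]

namespace MeanEstimationRule

/-- The expected loss at time `t` of a mean estimation rule on the values `y`. -/
noncomputable def expectedLoss (g : MeanEstimationRule 𝒴) (ℓ : 𝒴 → 𝒴 → ℝ) (t : ℕ) (y : ℕ → 𝒴) :
    ℝ :=
  ∫ r, ℓ (g.predict t (r, fun s : Fin t => y s)) (y t) ∂(g.ν t : Measure g.R)

variable {ℓ : 𝒴 → 𝒴 → ℝ} {C : ℝ}

theorem measurable_loss_predict (g : MeanEstimationRule 𝒴)
    (hℓ : Measurable fun p : 𝒴 × 𝒴 => ℓ p.1 p.2) (t : ℕ) :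
    Measurable fun p : (ℕ → 𝒴) × g.R => ℓ (g.predict t (p.2, fun s : Fin t => p.1 s)) (p.1 t) :=
  hℓ.comp (((g.measurable_predict t).comp (by fun_prop)).prodMk (by fun_prop))

theorem measurable_expectedLoss (g : MeanEstimationRule 𝒴)
    (hℓ : Measurable fun p : 𝒴 × 𝒴 => ℓ p.1 p.2) (t : ℕ) : Measurable (g.expectedLoss ℓ t) :=
  (StronglyMeasurable.integral_prod_right' (ν := (g.ν t : Measure g.R))
    (g.measurable_loss_predict hℓ t).stronglyMeasurable).measurable

theorem integrable_loss_predict (g : MeanEstimationRule 𝒴)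
    (hℓ : Measurable fun p : 𝒴 × 𝒴 => ℓ p.1 p.2) (hC : ∀ y y', ℓ y y' ∈ Set.Icc 0 C) (t : ℕ)
    (y : ℕ → 𝒴) : Integrable (fun r => ℓ (g.predict t (r, fun s : Fin t => y s)) (y t))
      (g.ν t : Measure g.R) :=
  integrable_of_abs_le (C := C) ((g.measurable_loss_predict hℓ t).comp measurable_prodMk_left)
    fun r => by rw [abs_of_nonneg (hC _ _).1]; exact (hC _ _).2

theorem expectedLoss_mem (g : MeanEstimationRule 𝒴) (hℓ : Measurable fun p : 𝒴 × 𝒴 => ℓ p.1 p.2)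
    (hC : ∀ y y', ℓ y y' ∈ Set.Icc 0 C) (t : ℕ) (y : ℕ → 𝒴) :
    g.expectedLoss ℓ t y ∈ Set.Icc 0 C := by
  refine ⟨integral_nonneg fun r => (hC _ _).1, ?_⟩
  calc g.expectedLoss ℓ t y ≤ ∫ _, C ∂(g.ν t : Measure g.R) :=
        integral_mono (g.integrable_loss_predict hℓ hC t y) (integrable_const _) fun r => (hC _ _).2
    _ = C := by simp

theorem integral_sum_regret (g : MeanEstimationRule 𝒴)
    (hℓ : Measurable fun p : 𝒴 × 𝒴 => ℓ p.1 p.2) (hC : ∀ y y', ℓ y y' ∈ Set.Icc 0 C) (T : ℕ)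
    (y : ℕ → 𝒴) (y₀ : 𝒴) :
    ∫ r, (∑ t ∈ Finset.range T,
        (ℓ (g.predict t (r t, fun s : Fin t => y s)) (y t) - ℓ y₀ (y t)))
      ∂(Measure.infinitePi fun t => (g.ν t : Measure g.R))
      = ∑ t ∈ Finset.range T, (g.expectedLoss ℓ t y - ℓ y₀ (y t)) := by
  have hi : ∀ t, Integrable (fun r : ℕ → g.R => ℓ (g.predict t (r t, fun s : Fin t => y s)) (y t))
      (Measure.infinitePi fun t => (g.ν t : Measure g.R)) := fun t =>
    (measurePreserving_eval_infinitePi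
      (fun t => (g.ν t : Measure g.R)) t).integrable_comp_of_integrable (g.integrable_loss_predict hℓ hC t y)
  have hi' : ∀ t ∈ Finset.range T, Integrable (fun r : ℕ → g.R =>
      ℓ (g.predict t (r t, fun s : Fin t => y s)) (y t) - ℓ y₀ (y t))
      (Measure.infinitePi fun t => (g.ν t : Measure g.R)) := fun t _ =>
    (hi t).sub (integrable_const _)
  rw [integral_finsetSum _ hi']
  refine Finset.sum_congr rfl fun t _ => ?_
  rw [integral_sub (hi t) (integrable_const _)]
  simp only [integral_const, probReal_univ, one_smul]
  congr 1
  have h := Measure.infinitePi_map_eval (fun t => (g.ν t : Measure g.R)) t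
  rw [expectedLoss, ← h, integral_map (measurable_pi_apply t).aemeasurable]
  exact ((g.measurable_loss_predict hℓ t).comp measurable_prodMk_left).aestronglyMeasurable

end MeanEstimationRule

theorem measurable_extendSeq (y₀ : 𝒴) (t : ℕ) :
    Measurable (extendSeq y₀ : (Fin t → 𝒴) → ℕ → 𝒴) := by
  refine measurable_pi_iff.2 fun s => ?_
  unfold extendSeq
  split_ifs <;> fun_prop

/-- The expected losses of the rules `g j`, restarted every `n j` steps. -/
noncomputable def restartLoss (ℓ : 𝒴 → 𝒴 → ℝ) (g : ℕ → MeanEstimationRule 𝒴) (n : ℕ → ℕ)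
    (y : ℕ → 𝒴) (t j : ℕ) : ℝ :=
  (g j).expectedLoss ℓ (t % n j) fun s => y (t / n j * n j + s)

variable {ℓ : 𝒴 → 𝒴 → ℝ} {C : ℝ} {g : ℕ → MeanEstimationRule 𝒴} {n : ℕ → ℕ}

theorem restartLoss_congr {y y' : ℕ → 𝒴} {t : ℕ} (h : ∀ s ≤ t, y s = y' s) :
    restartLoss ℓ g n y t = restartLoss ℓ g n y' t := by
  funext j
  have h2 := Nat.div_add_mod' t (n j)
  have h1 : (fun s : Fin (t % n j) => y (t / n j * n j + s))
      = fun s : Fin (t % n j) => y' (t / n j * n j + s) :=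
    funext fun s => h _ (by have := s.2; omega)
  simp only [restartLoss, MeanEstimationRule.expectedLoss, h1, h _ h2.le]

theorem measurable_restartLoss {Ω : Type*} [MeasurableSpace Ω]
    (hℓ : Measurable fun p : 𝒴 × 𝒴 => ℓ p.1 p.2) {y : Ω → ℕ → 𝒴} (hy : Measurable y) (t j : ℕ) :
    Measurable fun ω => restartLoss ℓ g n (y ω) t j :=
  ((g j).measurable_expectedLoss hℓ _).comp
    (measurable_pi_iff.2 fun _ => (measurable_pi_apply _).comp hy)

/-- The rule which follows at each time one of the rules `g j`, restarted every `n j` steps, drawn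
from the forecaster's weights. -/
noncomputable def mixedRestartRule (κ : ℕ → ℝ) (ℓ : 𝒴 → 𝒴 → ℝ)
    (hℓ : Measurable fun p : 𝒴 × 𝒴 => ℓ p.1 p.2) (g : ℕ → MeanEstimationRule 𝒴) (n : ℕ → ℕ)
    (y₀ : 𝒴) : MeanEstimationRule 𝒴 where
  R := ULift.{u} ℝ × (∀ j, (g j).R)
  ν t := ⟨(uniformLaw.{u} : Measure (ULift.{u} ℝ)).prod
    (Measure.infinitePi fun j => ((g j).ν (t % n j) : Measure (g j).R)), inferInstance⟩
  predict t p :=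
    (fun (j : ℕ) (q : (ULift.{u} ℝ × (∀ j, (g j).R)) × (Fin t → 𝒴)) => (g j).predict (t % n j)
      (q.1.2 j, fun s : Fin (t % n j) => extendSeq y₀ q.2 (t / n j * n j + s)))
      (drawIndex (t + 1) (prodProb κ (restartLoss ℓ g n (extendSeq y₀ p.2)) t) p.1.1.down) p
  measurable_predict t := by
    have he : Measurable fun q : (ULift.{u} ℝ × (∀ j, (g j).R)) × (Fin t → 𝒴) =>
        extendSeq y₀ q.2 := (measurable_extendSeq y₀ t).comp measurable_snd
    have hj : ∀ j, Measurable fun q : (ULift.{u} ℝ × (∀ j, (g j).R)) × (Fin t → 𝒴) =>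
        (g j).predict (t % n j)
          (q.1.2 j, fun s : Fin (t % n j) => extendSeq y₀ q.2 (t / n j * n j + s)) := fun j =>
      ((g j).measurable_predict _).comp (Measurable.prodMk
        ((measurable_pi_apply j).comp (measurable_snd.comp measurable_fst))
        (measurable_pi_iff.2 fun s => (measurable_pi_apply (t / n j * n j + (s : ℕ))).comp he))
    refine measurable_apply_index hj ?_ measurable_id
    exact measurable_drawIndex _ (fun j => measurable_prodProb
      (fun s j => measurable_restartLoss hℓ he s j) t j)
      (measurable_down.comp (measurable_fst.comp measurable_fst))

/-- The uniform variable that selects a rule is independent of the randomness of the rules. The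
expected loss is thus the mixture of their expected losses, which are exactly the losses fed to the
forecaster. -/
theorem expectedLoss_mixedRestartRule {κ : ℕ → ℝ} (hκ : ∀ j, 0 < κ j)
    (hκC : ∀ j, κ j * C ≤ 1 / 2) (hC : ∀ y y', ℓ y y' ∈ Set.Icc 0 C)
    (hℓ : Measurable fun p : 𝒴 × 𝒴 => ℓ p.1 p.2) (y₀ : 𝒴) (t : ℕ) (y : ℕ → 𝒴) :
    (mixedRestartRule κ ℓ hℓ g n y₀).expectedLoss ℓ t y = prodLoss κ (restartLoss ℓ g n y) t := by
  have ha : ∀ s j, restartLoss ℓ g n y s j ∈ Set.Icc 0 C := fun s j =>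
    (g j).expectedLoss_mem hℓ hC _ _
  rw [prodLoss, ← integral_uniformLaw_drawIndex (prodProb_nonneg hκ hκC ha t)
    (sum_prodProb hκ hκC ha t)]
  have hpr : prodProb κ (restartLoss ℓ g n (extendSeq y₀ fun s : Fin t => y s)) t
      = prodProb κ (restartLoss ℓ g n y) t :=
    prodProb_congr fun s hs => restartLoss_congr fun s' hs' =>
      extendSeq_of_lt y₀ y (lt_of_le_of_lt hs' hs)
  have hint := (mixedRestartRule κ ℓ hℓ g n y₀).integrable_loss_predict hℓ hC t y
  have h := integral_prod _ hint
  refine h.trans (integral_congr_ae (Eventually.of_forall fun v => ?_))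
  simp only [mixedRestartRule]
  rw [hpr]
  generalize drawIndex (t + 1) (prodProb κ (restartLoss ℓ g n y) t) v.down = j
  have hdm := Nat.div_add_mod' t (n j)
  have he : (fun s : Fin (t % n j) => extendSeq y₀ (fun s : Fin t => y s) (t / n j * n j + s))
      = fun s : Fin (t % n j) => y (t / n j * n j + s) :=
    funext fun s => extendSeq_of_lt y₀ y (by have := s.2; omega)
  have hev := Measure.infinitePi_map_eval (fun j => ((g j).ν (t % n j) : Measure (g j).R)) j
  rw [he, restartLoss, MeanEstimationRule.expectedLoss, ← hev,
    integral_map (measurable_pi_apply j).aemeasurable]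
  · simp only [hdm]
  · exact (((g j).measurable_loss_predict hℓ _).comp
      (measurable_prodMk_left (x := fun s => y (t / n j * n j + s)))).aestronglyMeasurable

theorem sum_range_mul_le {f : ℕ → ℝ} {n : ℕ} {c : ℝ} (N : ℕ)
    (h : ∀ b, ∑ s ∈ Finset.range n, f (b * n + s) ≤ c) :
    ∑ t ∈ Finset.range (N * n), f t ≤ N * c := by
  induction N with
  | zero => simp
  | succ N ih =>
    rw [Nat.succ_mul, Finset.sum_range_add]
    push_cast
    linarith [h N]

/-- If finite-time mean estimation is not possible, then finitely many rules, each with its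
horizon, can be made to fail simultaneously, with the same comparator. -/
theorem exists_common_comparator (hC : ∀ y y', ℓ y y' ∈ Set.Icc 0 C)
    (hℓ : Measurable fun p : 𝒴 × 𝒴 => ℓ p.1 p.2) (hF : ¬ FTiME ℓ) :
    ∃ η : ℝ, 0 < η ∧ ∀ (g : ℕ → MeanEstimationRule 𝒴) (n : ℕ → ℕ), (∀ j, 0 < n j) → ∀ m : ℕ,
      ∃ y₀ : 𝒴, ∀ j < m, ∃ y : ℕ → 𝒴,
        η * n j ≤ ∑ s ∈ Finset.range (n j), ((g j).expectedLoss ℓ s y - ℓ y₀ (y s)) := by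
  unfold FTiME at hF
  push Not at hF
  obtain ⟨η, hη, hF⟩ := hF
  refine ⟨η / 2, half_pos hη, fun g n hn m => ?_⟩
  have hne : Nonempty 𝒴 := by
    obtain ⟨y, -, -⟩ := hF 1 le_rfl (g 0)
    exact ⟨y 0⟩
  obtain ⟨y₁⟩ := hne
  have hC0 : 0 ≤ C := (hC y₁ y₁).1.trans (hC y₁ y₁).2
  -- The first bound is the admissibility of the rate, the second makes the linear part of the
  -- regret at most `η / 4` per round.
  set k : ℝ := min (1 / (2 * (C + 1))) (η / (8 * (C + 1) ^ 2)) with hk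
  have hkpos : 0 < k := lt_min (by positivity) (by positivity)
  have hk1 : k * C ≤ 1 / 2 := by
    have : k * (C + 1) ≤ 1 / 2 := by
      calc k * (C + 1) ≤ 1 / (2 * (C + 1)) * (C + 1) :=
            mul_le_mul_of_nonneg_right (min_le_left _ _) (by positivity)
        _ = 1 / 2 := by field_simp
    nlinarith
  have hk2 : 2 * k * C ^ 2 ≤ η / 4 := by
    have h1 : 2 * k * (C + 1) ^ 2 ≤ η / 4 := by
      calc 2 * k * (C + 1) ^ 2 ≤ 2 * (η / (8 * (C + 1) ^ 2)) * (C + 1) ^ 2 := by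
            gcongr; exact min_le_right _ _
        _ = η / 4 := by field_simp; norm_num
    have h2 : C ^ 2 ≤ (C + 1) ^ 2 := by nlinarith
    nlinarith
  -- The total time is a common multiple of all horizons `n j`, so it splits into complete restarts
  -- of every rule, and it is long enough for the constant part of the regret to be at most `η / 4`
  -- per round.
  obtain ⟨K, hK⟩ := exists_nat_gt (((m + 1) / k + C * m) / (η / 4))
  set N : ℕ := ∏ j ∈ Finset.range m, n j with hN
  have hNpos : 0 < N := Finset.prod_pos fun j _ => hn j
  set T : ℕ := (K + 1) * N with hT
  have hTpos : 0 < T := by positivity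
  have hTK : ((m + 1) / k + C * m) ≤ η / 4 * T := by
    rw [div_lt_iff₀ (by positivity)] at hK
    have : (K : ℝ) ≤ T := by
      have : K ≤ T := by rw [hT]; nlinarith
      exact_mod_cast this
    nlinarith
  obtain ⟨y, y₀, hy⟩ := hF T hTpos (mixedRestartRule (fun _ => k) ℓ hℓ g n y₁)
  rw [MeanEstimationRule.integral_sum_regret _ hℓ hC] at hy
  simp only [expectedLoss_mixedRestartRule (g := g) (n := n) (fun _ => hkpos) (fun _ => hk1) hC hℓ
    y₁] at hy
  have hT' : (0 : ℝ) < T := by exact_mod_cast hTpos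
  rw [one_div, inv_mul_eq_div, lt_div_iff₀ hT'] at hy
  refine ⟨y₀, fun j hj => ?_⟩
  -- Otherwise rule `j` has regret below `η / 2` per round on every restart. The combination loses
  -- at most another `η / 2` per round to rule `j`, so its average regret is at most `η`, contrary
  -- to the choice of `y` and `y₀`.
  by_contra! hcon
  have hreg := sum_prodLoss_sub_le (κ := fun _ => k) (a := restartLoss ℓ g n y) (fun _ => hkpos)
    (fun _ => hk1) (fun s j => (g j).expectedLoss_mem hℓ hC _ _) j T
  have hjm : ((j : ℝ) + 1) / k + C * j ≤ (m + 1) / k + C * m := by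
    have : (j : ℝ) ≤ m := by exact_mod_cast hj.le
    gcongr
  obtain ⟨N', hN'⟩ : n j ∣ N := Finset.dvd_prod_of_mem _ (Finset.mem_range.2 hj)
  have hT2 : T = ((K + 1) * N') * n j := by rw [hT, hN']; ring
  have hup : ∑ t ∈ Finset.range T, (restartLoss ℓ g n y t j - ℓ y₀ (y t))
      ≤ ((K + 1) * N' : ℕ) * (η / 2 * n j) := by
    rw [hT2]
    refine sum_range_mul_le _ fun b => ?_
    refine le_trans (le_of_eq (Finset.sum_congr rfl fun s hs => ?_))
      (hcon fun s => y (b * n j + s)).le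
    have hs' := Finset.mem_range.1 hs
    have h1 : (b * n j + s) % n j = s := by
      rw [Nat.mul_comm, Nat.mul_add_mod, Nat.mod_eq_of_lt hs']
    have h2 : (b * n j + s) / n j = b := by
      rw [Nat.add_div_of_dvd_right (Dvd.intro_left b rfl), Nat.div_eq_of_lt hs',
        Nat.mul_div_cancel _ (hn j), add_zero]
    simp only [restartLoss, h1, h2]
  have hsum : ∑ t ∈ Finset.range T, (prodLoss (fun _ => k) (restartLoss ℓ g n y) t - ℓ y₀ (y t))
      = ∑ t ∈ Finset.range T,
          (prodLoss (fun _ => k) (restartLoss ℓ g n y) t - restartLoss ℓ g n y t j)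
        + ∑ t ∈ Finset.range T, (restartLoss ℓ g n y t j - ℓ y₀ (y t)) := by
    rw [← Finset.sum_add_distrib]
    exact Finset.sum_congr rfl fun t _ => by ring
  rw [hsum] at hy
  have hTc : (T : ℝ) = ((K + 1) * N' : ℕ) * n j := by rw [hT2]; push_cast; ring
  have h3 : ((K + 1) * N' : ℕ) * (η / 2 * n j) = η / 2 * T := by rw [hTc]; ring
  rw [h3] at hup
  nlinarith

end MeanEstimation

/-! ### The block structure of processes outside CS -/

section Blocks

variable {𝒳 : Type u}

/-- The number of times in `[s, t)` at which the path `x` is in `A`. -/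
noncomputable def visitCount (x : ℕ → 𝒳) (A : Set 𝒳) (s t : ℕ) : ℕ := by
  classical exact ((Finset.Ico s t).filter fun u => x u ∈ A).card

theorem visitFrequency_eq (x : ℕ → 𝒳) (A : Set 𝒳) (t : ℕ) :
    visitFrequency x A t = 1 / (t : ℝ) * visitCount x A 0 t := by
  classical
  simp only [visitFrequency, timeAverage, visitCount, Set.indicator_apply, Finset.sum_boole,
    Finset.range_eq_Ico]

theorem visitCount_le_add (x : ℕ → 𝒳) (A : Set 𝒳) (s t : ℕ) :
    visitCount x A 0 t ≤ s + visitCount x A s t := by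
  classical
  unfold visitCount
  calc _ ≤ (Finset.range s ∪ (Finset.Ico s t).filter fun u => x u ∈ A).card := by
        refine Finset.card_le_card fun u hu => ?_
        simp only [Finset.mem_filter, Finset.mem_Ico, Finset.mem_union, Finset.mem_range] at hu ⊢
        by_cases h : u < s
        · exact Or.inl h
        · exact Or.inr ⟨⟨not_lt.1 h, hu.1.2⟩, hu.2⟩
    _ ≤ _ := (Finset.card_union_le _ _).trans (by simp)

variable [MeasurableSpace 𝒳] {μ : ProbabilityMeasure (ℕ → 𝒳)}

theorem measurable_visitCount {A : Set 𝒳} (hA : MeasurableSet A) (s t : ℕ) :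
    Measurable fun x : ℕ → 𝒳 => visitCount x A s t := by
  classical
  simp only [visitCount, Finset.card_filter]
  exact Finset.measurable_sum _ fun u _ => Measurable.ite (measurable_pi_apply u hA)
    measurable_const measurable_const

/-- Take sets `A k` that witness the failure of CS, and let the level of a point be the first `k`
with the point outside `A k`; it exists because the intersection is empty. -/
theorem exists_level_of_notMem_CS (h : μ ∉ CS 𝒳) :
    ∃ ε : ℝ, 0 < ε ∧ ∃ L : 𝒳 → ℕ, Measurable L ∧ ∀ k, ε ≤ meanFrequency μ {x | k ≤ L x} := by
  classical
  simp only [CS, Set.mem_ofPred_eq, not_forall] at h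
  obtain ⟨A, hA, hanti, hempty, hlim⟩ := h
  obtain ⟨ε, hε, hle⟩ : ∃ ε : ℝ, 0 < ε ∧ ∀ k, ε ≤ meanFrequency μ (A k) := by
    by_contra! hcon
    refine hlim (Metric.tendsto_atTop.2 fun ε hε => ?_)
    obtain ⟨k, hk⟩ := hcon ε hε
    refine ⟨k, fun n hn => ?_⟩
    rw [Real.dist_0_eq_abs]
    change |meanFrequency μ (A n)| < ε
    rw [abs_of_nonneg (meanFrequency_nonneg μ _)]
    exact (meanFrequency_mono (hA n) (hA k) (hanti hn)).trans_lt hk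
  have hex : ∀ x, ∃ k, x ∉ A k := fun x => by
    by_contra! hx
    have : x ∈ ⋂ k, A k := Set.mem_iInter.2 hx
    rw [hempty] at this
    exact this
  have hLm : Measurable fun x => Nat.find (hex x) :=
    measurable_find hex fun k => (hA k).compl
  refine ⟨ε, hε, fun x => Nat.find (hex x), hLm, fun k => ?_⟩
  refine (hle k).trans (meanFrequency_mono (hA k) (hLm (measurableSet_Ici (a := k)))
    fun x hx => ?_)
  exact (Nat.le_find_iff _ _).2 fun m hm => not_not.2 (hanti hm.le hx)

/-- An upper frequency bounded by one with mean at least `ε` is at least `ε / 2` with probability at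
least `ε / 2`. On that event high frequencies recur at arbitrarily late times, so the visits before
`T` are negligible. Continuity of the measure then provides a deterministic time bound `T'` and a
level bound `k'`, at a small cost in probability. -/
theorem exists_block_step {ε : ℝ} (hε : 0 < ε) {L : 𝒳 → ℕ} (hL : Measurable L)
    (hLε : ∀ k, ε ≤ meanFrequency μ {x | k ≤ L x}) (k T S : ℕ) :
    ∃ T' k', k < k' ∧ ε / 4 ≤ (μ : Measure (ℕ → 𝒳)).real {x | (∃ t, S ≤ t ∧ t < T' ∧
      ε / 8 * t ≤ visitCount x {x | k ≤ L x} T t) ∧ ∀ u < T', L (x u) < k'} := by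
  have hA : MeasurableSet {x | k ≤ L x} := hL (measurableSet_Ici (a := k))
  let G : ℕ → Set (ℕ → 𝒳) := fun T' => {x | ∃ t, S ≤ t ∧ t < T' ∧
    ε / 8 * t ≤ visitCount x {x | k ≤ L x} T t}
  have hGm : ∀ T', MeasurableSet (G T') := fun T' => by
    have : G T' = ⋃ t ∈ Finset.Ico S T', {x | ε / 8 * t ≤ visitCount x {x | k ≤ L x} T t} := by
      ext x; simp only [G, Set.mem_ofPred_eq, Set.mem_iUnion, Finset.mem_Ico]
      constructor
      · rintro ⟨t, h1, h2, h3⟩; exact ⟨t, ⟨h1, h2⟩, h3⟩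
      · rintro ⟨t, ⟨h1, h2⟩, h3⟩; exact ⟨t, h1, h2, h3⟩
    rw [this]
    exact Finset.measurableSet_biUnion _ fun t _ => measurableSet_le measurable_const
      (measurable_from_top.comp (measurable_visitCount hA T t))
  have hGmono : Monotone G := fun a b hab x ⟨t, h1, h2, h3⟩ => ⟨t, h1, h2.trans_le hab, h3⟩
  have hfreq : {x | ε / 2 ≤ upperFrequency x {x | k ≤ L x}} ⊆ ⋃ T', G T' := by
    intro x hx
    have hx' : ε / 4 < limsup (visitFrequency x {x | k ≤ L x}) atTop :=
      lt_of_lt_of_le (by linarith) (show ε / 2 ≤ _ from hx)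
    have hfr := frequently_lt_of_lt_limsup
      (isBoundedUnder_ge_visitFrequency x {x | k ≤ L x}).isCoboundedUnder_le hx'
    -- For `t ≥ K`, the at most `T` visits before time `T` number at most `ε / 8 * t`, so half of
    -- the frequency `ε / 4` remains.
    obtain ⟨K, hK⟩ := exists_nat_gt (T / (ε / 8))
    obtain ⟨t, ht, hlt⟩ := frequently_atTop.1 hfr (S + K + 1)
    refine Set.mem_iUnion.2 ⟨t + 1, t, by omega, by omega, ?_⟩
    have htpos : (0 : ℝ) < t := by exact_mod_cast (by omega : 0 < t)
    rw [visitFrequency_eq, one_div, inv_mul_eq_div, lt_div_iff₀ htpos] at hlt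
    have h1 : (visitCount x {x | k ≤ L x} 0 t : ℝ) ≤ T + visitCount x {x | k ≤ L x} T t := by
      exact_mod_cast visitCount_le_add x _ T t
    rw [div_lt_iff₀ (by positivity)] at hK
    have h2 : (K : ℝ) ≤ t := by exact_mod_cast (by omega : K ≤ t)
    nlinarith
  have hmass : ε / 2 ≤
      (μ : Measure (ℕ → 𝒳)).real {x | ε / 2 ≤ upperFrequency x {x | k ≤ L x}} := by
    have hm : MeasurableSet {x : ℕ → 𝒳 | ε / 2 ≤ upperFrequency x {x | k ≤ L x}} :=
      measurableSet_le measurable_const (measurable_upperFrequency hA)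
    have h1 : meanFrequency μ {x | k ≤ L x} ≤ ∫ x, (ε / 2 +
        {x | ε / 2 ≤ upperFrequency x {x | k ≤ L x}}.indicator (fun _ => (1 : ℝ)) x)
          ∂(μ : Measure (ℕ → 𝒳)) := by
      refine integral_mono (integrable_upperFrequency μ hA)
        ((integrable_const _).add ((integrable_const _).indicator hm)) fun x => ?_
      by_cases hx : ε / 2 ≤ upperFrequency x {x | k ≤ L x}
      · simp only [Set.indicator_of_mem (show x ∈ {x | ε / 2 ≤ upperFrequency x {x | k ≤ L x}}
          from hx)]
        linarith [upperFrequency_le_one x {x | k ≤ L x}]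
      · simp only [Set.indicator_of_notMem (show x ∉ {x | ε / 2 ≤ upperFrequency x {x | k ≤ L x}}
          from hx)]
        linarith
    rw [integral_add (integrable_const _) ((integrable_const _).indicator hm),
      integral_indicator_const _ hm] at h1
    simp only [integral_const, probReal_univ, smul_eq_mul, mul_one] at h1
    linarith [hLε k]
  have hT' : ∃ T', ε / 3 < (μ : Measure (ℕ → 𝒳)).real (G T') := by
    have h1 := (ENNReal.tendsto_toReal (measure_ne_top _ _)).comp
      (tendsto_measure_iUnion_atTop (μ := (μ : Measure (ℕ → 𝒳))) hGmono)
    have h2 : ε / 3 < ((μ : Measure (ℕ → 𝒳)) (⋃ T', G T')).toReal :=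
      lt_of_lt_of_le (by linarith) (hmass.trans (measureReal_mono hfreq))
    exact (h1.eventually (lt_mem_nhds h2)).exists
  obtain ⟨T', hT'⟩ := hT'
  let H : ℕ → Set (ℕ → 𝒳) := fun k' => {x | ∀ u < T', L (x u) < k'}
  have hHmono : Monotone fun k' => G T' ∩ H k' :=
    fun a b hab x ⟨h1, h2⟩ => ⟨h1, fun u hu => (h2 u hu).trans_le hab⟩
  have hHU : ⋃ k', G T' ∩ H k' = G T' := by
    refine subset_antisymm (Set.iUnion_subset fun _ => Set.inter_subset_left) fun x hx => ?_
    refine Set.mem_iUnion.2 ⟨∑ u ∈ Finset.range T', L (x u) + 1, hx, fun u hu => ?_⟩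
    exact Nat.lt_succ_of_le (Finset.single_le_sum (f := fun u => L (x u)) (fun _ _ => Nat.zero_le _)
      (Finset.mem_range.2 hu))
  have h1 := (ENNReal.tendsto_toReal (measure_ne_top _ _)).comp
    (tendsto_measure_iUnion_atTop (μ := (μ : Measure (ℕ → 𝒳))) hHmono)
  rw [hHU] at h1
  obtain ⟨k', hk', hkk⟩ := ((h1.eventually (lt_mem_nhds (show ε / 4 < _ from
    lt_trans (by linarith) hT'))).and (eventually_gt_atTop k)).exists
  exact ⟨T', k', hkk, hk'.le⟩

/-- A process outside CS visits, with probability bounded below in every block of times, the points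
of a new level a positive fraction of the time, and no points of higher levels. -/
theorem exists_blocks_of_notMem_CS (h : μ ∉ CS 𝒳) :
    ∃ c δ : ℝ, 0 < c ∧ 0 < δ ∧ ∃ L : 𝒳 → ℕ, Measurable L ∧ ∃ T : ℕ → ℕ, T 0 = 0 ∧
      ∀ i, δ ≤ (μ : Measure (ℕ → 𝒳)).real {x | ∃ t, (i + 1) * (T i + 1) ≤ t ∧ t < T (i + 1) ∧
        c * t ≤ visitCount x {x | L x = i} (T i) t ∧ ∀ u < T (i + 1), L (x u) ≤ i} := by
  classical
  obtain ⟨ε, hε, L, hL, hLε⟩ := exists_level_of_notMem_CS h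
  choose T' k' hkk hmass using exists_block_step hε hL hLε
  -- The pair holds the start of block `i` and the level threshold that no visited point reached in
  -- the previous block on its good event. Demanding a horizon beyond `(i + 1) * (T i + 1)` makes
  -- the past of the block negligible.
  let s : ℕ → ℕ × ℕ := fun i => Nat.rec (0, 0) (fun i p =>
    (T' p.2 p.1 ((i + 1) * (p.1 + 1)), k' p.2 p.1 ((i + 1) * (p.1 + 1)))) i
  have hs : ∀ i, s (i + 1) = (T' (s i).2 (s i).1 ((i + 1) * ((s i).1 + 1)),
    k' (s i).2 (s i).1 ((i + 1) * ((s i).1 + 1))) := fun i => rfl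
  have hmono : StrictMono fun i => (s i).2 := strictMono_nat_of_lt_succ fun i => by
    rw [hs]; exact hkk _ _ _
  have hex : ∀ l : ℕ, ∃ i, l < (s (i + 1)).2 := fun l =>
    ⟨l, lt_of_lt_of_le (Nat.lt_succ_self l) (hmono.id_le (l + 1))⟩
  -- The old levels are regrouped: the new level of a point is the index of the interval between
  -- consecutive thresholds that contains its old level.
  refine ⟨ε / 8, ε / 4, by positivity, by positivity, fun x => Nat.find (hex (L x)),
    (measurable_from_top (f := fun l => Nat.find (hex l))).comp hL, fun i => (s i).1, rfl,
    fun i => ?_⟩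
  have hfind : ∀ l j, Nat.find (hex l) ≤ j ↔ l < (s (j + 1)).2 := fun l j => by
    rw [Nat.find_le_iff]
    exact ⟨fun ⟨m, hm, hl⟩ => hl.trans_le (hmono.monotone (Nat.succ_le_succ hm)),
      fun hl => ⟨j, le_rfl, hl⟩⟩
  refine (hmass (s i).2 (s i).1 ((i + 1) * ((s i).1 + 1))).trans (measureReal_mono ?_)
  rintro x ⟨⟨t, h1, h2, h3⟩, h4⟩
  have h5 : ∀ u < (s (i + 1)).1, Nat.find (hex (L (x u))) ≤ i := fun u hu =>
    (hfind _ _).2 (h4 u hu)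
  refine ⟨t, h1, h2, h3.trans ?_, h5⟩
  unfold visitCount
  refine Nat.cast_le.2 (Finset.card_le_card fun u hu => ?_)
  simp only [Finset.mem_filter, Finset.mem_Ico, Set.mem_ofPred_eq] at hu ⊢
  refine ⟨hu.1, le_antisymm (h5 u (hu.1.2.trans h2)) ?_⟩
  rcases i with _ | i
  · exact Nat.zero_le _
  · by_contra hlt
    have := (hfind (L (x u)) i).1 (by omega)
    have h6 := hu.2
    omega

end Blocks

/-! ### The adversary -/

section VisitCount

variable {𝒳 : Type u} {x : ℕ → 𝒳} {A : Set 𝒳} {s t : ℕ}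

theorem visitCount_succ_of_mem (hst : s ≤ t) (h : x t ∈ A) :
    visitCount x A s (t + 1) = visitCount x A s t + 1 := by
  classical
  simp only [visitCount, Nat.Ico_succ_right_eq_insert_Ico hst]
  rw [Finset.filter_insert, if_pos h, Finset.card_insert_of_notMem (by simp)]

theorem visitCount_succ_of_notMem (hst : s ≤ t) (h : x t ∉ A) :
    visitCount x A s (t + 1) = visitCount x A s t := by
  classical
  simp only [visitCount, Nat.Ico_succ_right_eq_insert_Ico hst]
  rw [Finset.filter_insert, if_neg h]

theorem visitCount_mono (x : ℕ → 𝒳) (A : Set 𝒳) (s : ℕ) : Monotone (visitCount x A s) := by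
  classical
  exact fun a b hab => Finset.card_le_card (Finset.filter_subset_filter _
    (Finset.Ico_subset_Ico_right hab))

theorem visitCount_lt {u v : ℕ} (hs : s ≤ u) (hu : x u ∈ A) (huv : u < v) :
    visitCount x A s u < visitCount x A s v := by
  have h := visitCount_mono x A s (Nat.succ_le_of_lt huv)
  have h2 := visitCount_succ_of_mem hs hu
  simp only [Nat.succ_eq_add_one] at h
  omega

theorem exists_visitCount_eq {k : ℕ} (h : k < visitCount x A s t) :
    ∃ u, s ≤ u ∧ u < t ∧ x u ∈ A ∧ visitCount x A s u = k := by
  induction t with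
  | zero => simp [visitCount] at h
  | succ t ih =>
    rcases Nat.lt_or_ge t s with hts | hst
    · have : visitCount x A s (t + 1) = 0 := by
        simp [visitCount, Finset.Ico_eq_empty_of_le (show t + 1 ≤ s from hts)]
      omega
    · by_cases hk : k < visitCount x A s t
      · obtain ⟨u, h1, h2, h3, h4⟩ := ih hk
        exact ⟨u, h1, h2.trans (Nat.lt_succ_self t), h3, h4⟩
      · by_cases hx : x t ∈ A
        · rw [visitCount_succ_of_mem hst hx] at h
          exact ⟨t, hst, Nat.lt_succ_self t, hx, by omega⟩
        · rw [visitCount_succ_of_notMem hst hx] at h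
          omega

end VisitCount

/-- Blocks of times `[time i, time (i + 1))` and levels of points, together with a horizon in each
block. If the horizon is in the block, the path makes `plays` many visits to level `i` between the
beginning of the block and the horizon, and no visits to higher levels before the end of the
block. -/
structure BlockScheme (𝒳 : Type u) [MeasurableSpace 𝒳] where
  level : 𝒳 → ℕ
  measurable_level : Measurable level
  time : ℕ → ℕ
  time_zero : time 0 = 0
  strictMono_time : StrictMono time
  plays : ℕ → ℕ
  horizon : ℕ → (ℕ → 𝒳) → ℕ
  measurable_horizon : ∀ i, Measurable (horizon i)
  le_horizon : ∀ i x, horizon i x < time (i + 1) → (i + 1) * (time i + 1) ≤ horizon i x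
  plays_le : ∀ i x, horizon i x < time (i + 1) →
    plays (horizon i x) ≤ visitCount x {x | level x = i} (time i) (horizon i x)
  level_le : ∀ i x, horizon i x < time (i + 1) → ∀ u < time (i + 1), level (x u) ≤ i

theorem exists_blockScheme_of_notMem_CS {𝒳 : Type u} [MeasurableSpace 𝒳]
    {μ : ProbabilityMeasure (ℕ → 𝒳)} (h : μ ∉ CS 𝒳) :
    ∃ B : BlockScheme 𝒳, ∃ c δ : ℝ, 0 < c ∧ 0 < δ ∧ (∀ t, c * t ≤ B.plays t) ∧
      (∀ t, 0 < t → 0 < B.plays t) ∧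
      ∀ i, δ ≤ (μ : Measure (ℕ → 𝒳)).real {x | B.horizon i x < B.time (i + 1)} := by
  classical
  obtain ⟨c, δ, hc, hδ, L, hL, T, hT0, hmass⟩ := exists_blocks_of_notMem_CS h
  let p : ℕ → (ℕ → 𝒳) → ℕ → Prop := fun i x t => (i + 1) * (T i + 1) ≤ t ∧ t < T (i + 1) ∧
    c * t ≤ visitCount x {x | L x = i} (T i) t ∧ ∀ u < T (i + 1), L (x u) ≤ i
  have hp : ∀ i t, MeasurableSet {x | p i x t} := by
    intro i t
    have h1 : MeasurableSet {x : ℕ → 𝒳 | ∀ u < T (i + 1), L (x u) ≤ i} := by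
      simp only [Set.ofPred_forall]
      exact MeasurableSet.iInter fun u => MeasurableSet.iInter fun _ =>
        (hL.comp (measurable_pi_apply u)) (measurableSet_Iic (a := i))
    have h2 : MeasurableSet {x : ℕ → 𝒳 | c * t ≤ visitCount x {x | L x = i} (T i) t} :=
      measurableSet_le measurable_const (measurable_from_top.comp
        (measurable_visitCount (hL (measurableSet_singleton i)) _ _))
    exact (MeasurableSet.const _).inter ((MeasurableSet.const _).inter (h2.inter h1))
  -- The end of the block serves as the default horizon, so that "the horizon is in the block"
  -- expresses that the good event occurs.
  have hex : ∀ i x, ∃ t, p i x t ∨ t = T (i + 1) := fun i x => ⟨T (i + 1), Or.inr rfl⟩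
  have hspec : ∀ i x, Nat.find (hex i x) < T (i + 1) → p i x (Nat.find (hex i x)) := by
    intro i x hlt
    rcases Nat.find_spec (hex i x) with h | h
    · exact h
    · omega
  refine ⟨⟨L, hL, T, hT0, strictMono_nat_of_lt_succ fun i => ?_, fun t => ⌈c * t⌉₊,
    fun i x => Nat.find (hex i x),
    fun i => measurable_find (hex i) fun t => (hp i t).union (MeasurableSet.const _),
    fun i x hlt => (hspec i x hlt).1, fun i x hlt => Nat.ceil_le.2 (hspec i x hlt).2.2.1,
    fun i x hlt => (hspec i x hlt).2.2.2⟩, c, δ, hc, hδ, fun t => Nat.le_ceil _,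
    fun t ht => Nat.ceil_pos.2 (mul_pos hc (by exact_mod_cast ht)), fun i => ?_⟩
  -- Positive mass yields a path with a horizon inside the block, which forces the block to be
  -- nonempty.
  · have hne : {x | ∃ t, p i x t}.Nonempty := by
      by_contra hemp
      rw [Set.not_nonempty_iff_eq_empty] at hemp
      have h1 : δ ≤ (μ : Measure (ℕ → 𝒳)).real {x | ∃ t, p i x t} := hmass i
      rw [hemp, measureReal_empty] at h1
      linarith
    obtain ⟨x, t, h1, h2, -⟩ := hne
    nlinarith
  · refine (hmass i).trans (measureReal_mono ?_)
    rintro x ⟨t, ht⟩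
    exact lt_of_le_of_lt (Nat.find_min' (hex i x) (Or.inl ht)) ht.2.1

namespace BlockScheme

variable {𝒳 𝒴 : Type u} [MeasurableSpace 𝒳] (B : BlockScheme 𝒳)

/-- The block of the time `u`. -/
noncomputable def block (u : ℕ) : ℕ := sInf {i | u < B.time (i + 1)}

theorem block_le {u i : ℕ} (h : u < B.time (i + 1)) : B.block u ≤ i := Nat.sInf_le h

theorem lt_time_block (u : ℕ) : u < B.time (B.block u + 1) :=
  Nat.sInf_mem (s := {i | u < B.time (i + 1)})
    ⟨u, lt_of_lt_of_le (Nat.lt_succ_self u) (B.strictMono_time.id_le (u + 1))⟩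

theorem block_eq {u i : ℕ} (h1 : B.time i ≤ u) (h2 : u < B.time (i + 1)) : B.block u = i := by
  refine le_antisymm (B.block_le h2) ?_
  by_contra hlt
  have := B.strictMono_time.monotone (show B.block u + 1 ≤ i by omega)
  have := B.lt_time_block u
  omega

/-- The number of visits of the path before time `u`, in the current block, to the level of the
block. -/
noncomputable def count (i : ℕ) (x : ℕ → 𝒳) (u : ℕ) : ℕ :=
  visitCount x {x | B.level x = i} (B.time i) u

theorem measurable_count (i u : ℕ) : Measurable fun x : ℕ → 𝒳 => B.count i x u :=
  measurable_visitCount (B.measurable_level (measurableSet_singleton i)) _ _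

theorem measurable_level_apply (u : ℕ) : Measurable fun x : ℕ → 𝒳 => B.level (x u) :=
  B.measurable_level.comp (measurable_pi_apply u)

/-- The values given by the adversary: in the block `i`, at the first visits to level `i`, the
values `(D i).2`, which depend on the horizon; otherwise, at the visits to a level `j ≤ i`, the
value `(D j).1` of the comparator. -/
noncomputable def response (y₀ : 𝒴) (D : ℕ → 𝒴 × (ℕ → ℕ → 𝒴)) (x : ℕ → 𝒳) (u : ℕ) : 𝒴 :=
  if B.level (x u) = B.block u ∧
      B.count (B.block u) x u < B.plays (B.horizon (B.block u) x) then
    (D (B.block u)).2 (B.horizon (B.block u) x) (B.count (B.block u) x u)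
  else if B.level (x u) ≤ B.block u then (D (B.level (x u))).1 else y₀

theorem measurable_response [MeasurableSpace 𝒴] {Ω : Type*} [MeasurableSpace Ω] (y₀ : 𝒴)
    {D : Ω → ℕ → 𝒴 × (ℕ → ℕ → 𝒴)} (hD1 : ∀ j, Measurable fun ω => (D ω j).1)
    (hD2 : ∀ j t s, Measurable fun ω => (D ω j).2 t s) {x : Ω → ℕ → 𝒳} (hx : Measurable x) (u : ℕ) :
    Measurable fun ω => B.response y₀ (D ω) (x ω) u := by
  have hl := (B.measurable_level_apply u).comp hx
  have hc := (B.measurable_count (B.block u) u).comp hx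
  have hh := (B.measurable_horizon (B.block u)).comp hx
  refine Measurable.ite ?_ ?_ (Measurable.ite (hl (measurableSet_Iic (a := B.block u))) ?_
    measurable_const)
  · exact (hl (measurableSet_singleton (B.block u))).inter
      (measurableSet_lt hc ((measurable_from_top (f := B.plays)).comp hh))
  · refine measurable_apply_index (F := fun t ω => (D ω (B.block u)).2 t
      (B.count (B.block u) (x ω) u)) (fun t => ?_) hh measurable_id
    exact measurable_apply_index (F := fun s ω => (D ω (B.block u)).2 t s) (hD2 _ t) hc
      measurable_id
  · exact measurable_apply_index (F := fun j ω => (D ω j).1) hD1 hl measurable_id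

theorem exists_visitTime (i s : ℕ) (x : ℕ → 𝒳) : ∃ u,
    (B.time i ≤ u ∧ B.level (x u) = i ∧ B.count i x u = s) ∨ u = B.time (i + 1) :=
  ⟨_, Or.inr rfl⟩

open Classical in
/-- The time of the visit number `s` to level `i` in the block `i`, or the end of the block. -/
noncomputable def visitTime (i s : ℕ) (x : ℕ → 𝒳) : ℕ := Nat.find (B.exists_visitTime i s x)

theorem measurable_visitTime (i s : ℕ) : Measurable (B.visitTime i s) := by
  classical
  refine measurable_find _ fun u => MeasurableSet.union ?_ (MeasurableSet.const _)
  exact (MeasurableSet.const _).inter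
    ((B.measurable_level_apply u (measurableSet_singleton i)).inter
      (B.measurable_count i u (measurableSet_singleton s)))

variable {B}

theorem visitTime_spec {i s : ℕ} {x : ℕ → 𝒳} (h : B.horizon i x < B.time (i + 1))
    (hs : s < B.plays (B.horizon i x)) :
    B.time i ≤ B.visitTime i s x ∧ B.visitTime i s x < B.horizon i x ∧
      B.level (x (B.visitTime i s x)) = i ∧ B.count i x (B.visitTime i s x) = s := by
  classical
  obtain ⟨u, h1, h2, h3, h4⟩ := exists_visitCount_eq (hs.trans_le (B.plays_le i x h))
  have hle : B.visitTime i s x ≤ u := Nat.find_min' _ (Or.inl ⟨h1, h3, h4⟩)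
  have hlt := lt_of_le_of_lt hle h2
  rcases Nat.find_spec (B.exists_visitTime i s x) with h5 | h5
  · exact ⟨h5.1, hlt, h5.2⟩
  · exact absurd h5 (by have := hlt.trans h; exact this.ne)

theorem visitTime_count {i u : ℕ} {x : ℕ → 𝒳} (h : B.horizon i x < B.time (i + 1))
    (hu : B.time i ≤ u) (hl : B.level (x u) = i)
    (hs : B.count i x u < B.plays (B.horizon i x)) : B.visitTime i (B.count i x u) x = u := by
  obtain ⟨h1, -, h3, h4⟩ := visitTime_spec h hs
  rcases lt_trichotomy (B.visitTime i (B.count i x u) x) u with hlt | heq | hlt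
  · have := visitCount_lt (A := {x | B.level x = i}) h1 h3 hlt
    exact absurd h4 this.ne
  · exact heq
  · have := visitCount_lt (A := {x | B.level x = i}) hu hl hlt
    exact absurd h4 this.ne'

/-- At the visits to level `i` before the horizon, the values played before the current one are
determined by the data of the previous blocks and by the values played in this block. -/
theorem response_eq_of_lt {y₀ a : 𝒴} {D d : ℕ → 𝒴 × (ℕ → ℕ → 𝒴)} {i s : ℕ} {x : ℕ → 𝒳}
    (hd : ∀ j < i, d j = D j) (h : B.horizon i x < B.time (i + 1))
    (hs : s < B.plays (B.horizon i x)) {y : ℕ → 𝒴}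
    (hy : ∀ s' < s, y s' = (D i).2 (B.horizon i x) s') {v : ℕ} (hv : v < B.visitTime i s x) :
    B.response y₀ (Function.update d i (a, fun _ => y)) x v = B.response y₀ D x v := by
  obtain ⟨h1, h2, h3, h4⟩ := visitTime_spec h hs
  have hvt : v < B.time (i + 1) := hv.trans (h2.trans h)
  rcases (B.block_le hvt).lt_or_eq with hlt | heq
  · have e1 : Function.update d i (a, fun _ => y) (B.block v) = D (B.block v) := by
      rw [Function.update_of_ne hlt.ne, hd _ hlt]
    simp only [response, e1]
    split_ifs with c1 c2
    · rfl
    · rw [Function.update_of_ne (by omega), hd _ (by omega)]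
    · rfl
  · have hiv : B.time i ≤ v := by
      rcases i with _ | i
      · rw [B.time_zero]; exact Nat.zero_le _
      · by_contra hlt
        have := B.block_le (not_le.1 hlt)
        omega
    simp only [response, heq, Function.update_self]
    by_cases hl : B.level (x v) = i
    · have hcv : B.count i x v < s := by
        rw [← h4]; exact visitCount_lt (A := {x | B.level x = i}) hiv hl hv
      rw [if_pos ⟨hl, hcv.trans hs⟩, if_pos ⟨hl, hcv.trans hs⟩, hy _ hcv]
    · simp only [hl, false_and, if_false]
      split_ifs with c2
      · rw [Function.update_of_ne hl, hd _ (lt_of_le_of_ne c2 hl)]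
      · rfl

theorem response_visitTime {y₀ : 𝒴} {D : ℕ → 𝒴 × (ℕ → ℕ → 𝒴)} {i s : ℕ} {x : ℕ → 𝒳}
    (h : B.horizon i x < B.time (i + 1)) (hs : s < B.plays (B.horizon i x)) :
    B.response y₀ D x (B.visitTime i s x) = (D i).2 (B.horizon i x) s := by
  obtain ⟨h1, h2, h3, h4⟩ := visitTime_spec h hs
  have hb := B.block_eq h1 (h2.trans h)
  rw [response, hb, if_pos ⟨h3, by rw [h4]; exact hs⟩, h4]

theorem response_of_not_visitTime {y₀ : 𝒴} {D : ℕ → 𝒴 × (ℕ → ℕ → 𝒴)} {i u : ℕ} {x : ℕ → 𝒳}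
    (h : B.horizon i x < B.time (i + 1)) (hu : B.time i ≤ u) (hut : u < B.horizon i x)
    (hn : ∀ s < B.plays (B.horizon i x), B.visitTime i s x ≠ u) :
    B.response y₀ D x u = (D (B.level (x u))).1 := by
  have hb := B.block_eq hu (hut.trans h)
  rw [response, hb, if_neg, if_pos (B.level_le i x h u (hut.trans h))]
  rintro ⟨hl, hc⟩
  exact hn _ hc (visitTime_count h hu hl hc)

/-- The cumulative regret at the horizon is at least the regret at the first visits to level `i` in
the block `i`, up to the times before the block. -/
theorem sum_regret_ge {ℓ : 𝒴 → 𝒴 → ℝ} {C : ℝ} (hC : ∀ y y', ℓ y y' ∈ Set.Icc 0 C)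
    (hℓ0 : ∀ y, ℓ y y = 0) {y₀ : 𝒴} {D : ℕ → 𝒴 × (ℕ → ℕ → 𝒴)} {i : ℕ} {x : ℕ → 𝒳}
    (h : B.horizon i x < B.time (i + 1)) (z : ℕ → 𝒴) :
    -(C * B.time i) + ∑ s ∈ Finset.range (B.plays (B.horizon i x)),
        (ℓ (z (B.visitTime i s x)) ((D i).2 (B.horizon i x) s)
          - ℓ (D i).1 ((D i).2 (B.horizon i x) s))
      ≤ ∑ u ∈ Finset.range (B.horizon i x), (ℓ (z u) (B.response y₀ D x u)
          - ℓ (D (B.level (x u))).1 (B.response y₀ D x u)) := by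
  classical
  set t := B.horizon i x with ht
  set f : ℕ → ℝ := fun u => ℓ (z u) (B.response y₀ D x u)
          - ℓ (D (B.level (x u))).1 (B.response y₀ D x u) with hf
  have hTt : B.time i ≤ t := by
    have := B.le_horizon i x h
    nlinarith
  rw [Finset.range_eq_Ico, Finset.range_eq_Ico, ← Finset.sum_Ico_consecutive f (Nat.zero_le _) hTt]
  refine add_le_add ?_ ?_
  -- Nothing is known before the block beyond the lower bound `-C` for each term.
  · have h1 : ∑ u ∈ Finset.Ico 0 (B.time i), (-C) ≤ ∑ u ∈ Finset.Ico 0 (B.time i), f u :=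
      Finset.sum_le_sum fun u _ => by
        have h2 := hC (z u) (B.response y₀ D x u)
        have h3 := hC (D (B.level (x u))).1 (B.response y₀ D x u)
        simp only [hf]
        linarith [h2.1, h3.2]
    simp only [Finset.sum_const, Nat.card_Ico, Nat.sub_zero, nsmul_eq_mul] at h1
    linarith
  · have hinj : Set.InjOn (fun s => B.visitTime i s x) (Finset.Ico 0 (B.plays t) : Finset ℕ) := by
      intro s hs s' hs' hss
      simp only [Finset.coe_Ico, Set.mem_Ico] at hs hs'
      have h1 := (visitTime_spec h hs.2).2.2.2
      have h2 := (visitTime_spec h hs'.2).2.2.2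
      simp only at hss
      rw [hss] at h1
      omega
    calc _ = ∑ s ∈ Finset.Ico 0 (B.plays t), f (B.visitTime i s x) := by
          refine Finset.sum_congr rfl fun s hs => ?_
          have hs' := (Finset.mem_Ico.1 hs).2
          simp only [hf]
          rw [response_visitTime h hs', (visitTime_spec h hs').2.2.1]
      _ = ∑ u ∈ (Finset.Ico 0 (B.plays t)).image fun s => B.visitTime i s x, f u :=
          (Finset.sum_image hinj).symm
      _ ≤ ∑ u ∈ Finset.Ico (B.time i) t, f u := by
          -- At the remaining times before the horizon the response equals the comparator's value,
          -- so the comparator has zero loss and the regret is nonnegative.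
          refine Finset.sum_le_sum_of_subset_of_nonneg ?_ fun u hu hu' => ?_
          · intro u hu
            obtain ⟨s, hs, rfl⟩ := Finset.mem_image.1 hu
            have := visitTime_spec h (Finset.mem_Ico.1 hs).2
            exact Finset.mem_Ico.2 ⟨this.1, this.2.1⟩
          · have hu2 := Finset.mem_Ico.1 hu
            have hr := response_of_not_visitTime (y₀ := y₀) (D := D) h hu2.1 hu2.2 fun s hs he =>
              hu' (Finset.mem_image.2 ⟨s, Finset.mem_Ico.2 ⟨Nat.zero_le _, hs⟩, he⟩)
            simp only [hf]
            rw [hr, hℓ0, sub_zero]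
            exact (hC _ _).1

end BlockScheme

/-! ### Simulating a learning rule by mean estimation rules -/

section Simulation

theorem abs_timeAverage_sub_le {𝒴 : Type u} {ℓ : 𝒴 → 𝒴 → ℝ} {C : ℝ}
    (hC : ∀ y y', ℓ y y' ∈ Set.Icc 0 C) (a b y : ℕ → 𝒴) (T : ℕ) :
    |timeAverage (fun u => ℓ (a u) (y u) - ℓ (b u) (y u)) T| ≤ C := by
  have hC0 : 0 ≤ C := (hC (a 0) (a 0)).1.trans (hC (a 0) (a 0)).2
  have h1 := timeAverage_le hC0 (a := fun u => ℓ (a u) (y u) - ℓ (b u) (y u))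
    (fun u => by linarith [(hC (a u) (y u)).2, (hC (b u) (y u)).1]) T
  have h2 := timeAverage_le hC0 (a := fun u => -1 * (ℓ (a u) (y u) - ℓ (b u) (y u)))
    (fun u => by linarith [(hC (a u) (y u)).1, (hC (b u) (y u)).2]) T
  rw [timeAverage_const_mul] at h2
  rw [abs_le]
  constructor <;> linarith

variable {𝒳 𝒴 : Type u} [MeasurableSpace 𝒳] [MeasurableSpace 𝒴]

theorem OnlineLearningRule.measurable_prediction (f : OnlineLearningRule 𝒳 𝒴) {Ω : Type*}
    [MeasurableSpace Ω] {r : Ω → ℕ → f.R} {x : Ω → ℕ → 𝒳} {y : Ω → ℕ → 𝒴} (hr : Measurable r)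
    (hx : Measurable x) (hy : ∀ t, Measurable fun ω => y ω t) (t : ℕ) :
    Measurable fun ω => f.prediction (r ω) (x ω) (y ω) t := by
  refine (f.measurable_predict t).comp (((measurable_pi_apply t).comp hr).prodMk
    (Measurable.prodMk ?_ (Measurable.prodMk ?_ ((measurable_pi_apply t).comp hx))))
  · exact measurable_pi_iff.2 fun s => (measurable_pi_apply (s : ℕ)).comp hx
  · exact measurable_pi_iff.2 fun s => hy s

theorem OnlineLearningRule.prediction_congr (f : OnlineLearningRule 𝒳 𝒴) (r : ℕ → f.R)
    (x : ℕ → 𝒳) {y y' : ℕ → 𝒴} {t : ℕ} (h : ∀ s < t, y s = y' s) :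
    f.prediction r x y t = f.prediction r x y' t := by
  have : (fun s : Fin t => y s) = fun s : Fin t => y' s := funext fun s => h s s.2
  simp only [OnlineLearningRule.prediction, this]

/-- The law `Q` conditioned on `E`, or `Q` itself if `E` is null. -/
noncomputable def condLaw {Ω : Type*} [MeasurableSpace Ω] (Q : Measure Ω) [IsProbabilityMeasure Q]
    (E : Set Ω) : ProbabilityMeasure Ω := by
  classical exact if h : Q E = 0 then ⟨Q, inferInstance⟩ else ⟨Q[|E], cond_isProbabilityMeasure h⟩

/-- For a null event both sides vanish, so the default law in `condLaw` does no harm. -/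
theorem measureReal_mul_integral_condLaw {Ω : Type*} [MeasurableSpace Ω] (Q : Measure Ω)
    [IsProbabilityMeasure Q] (E : Set Ω) (G : Ω → ℝ) :
    Q.real E * ∫ ω, G ω ∂(condLaw Q E : Measure Ω) = ∫ ω in E, G ω ∂Q := by
  by_cases h : Q E = 0
  · rw [setIntegral_measure_zero _ h, measureReal_def, h]; simp
  · have h1 : (condLaw Q E : Measure Ω) = Q[|E] := by simp [condLaw, h]
    rw [h1, ProbabilityTheory.cond, integral_smul_measure, measureReal_def, ENNReal.toReal_inv,
      smul_eq_mul, ← mul_assoc, mul_inv_cancel₀, one_mul]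
    exact (ENNReal.toReal_pos h (measure_ne_top _ _)).ne'

/-- The mean estimation rule which simulates the learning rule `f`, at the visits to level `i` in
block `i`, on a path and a private randomness drawn from `Q`. -/
noncomputable def simulationRule (f : OnlineLearningRule 𝒳 𝒴) (B : BlockScheme 𝒳) (y₀ : 𝒴)
    (d : ℕ → 𝒴 × (ℕ → ℕ → 𝒴)) (i : ℕ) (Q : ProbabilityMeasure ((ℕ → 𝒳) × (ℕ → f.R))) :
    MeanEstimationRule 𝒴 where
  R := (ℕ → 𝒳) × (ℕ → f.R)
  -- A fresh path and randomness are drawn at every step. The values to predict are fixed in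
  -- advance, so only the marginal expected loss of each step matters, and it is the same as with a
  -- single draw.
  ν _ := Q
  predict s p := f.prediction p.1.2 p.1.1
    (B.response y₀ (Function.update d i (y₀, fun _ => extendSeq y₀ p.2)) p.1.1)
    (B.visitTime i s p.1.1)
  measurable_predict s := by
    have hx : Measurable fun p : ((ℕ → 𝒳) × (ℕ → f.R)) × (Fin s → 𝒴) => p.1.1 := by fun_prop
    refine measurable_apply_index (F := fun t (p : ((ℕ → 𝒳) × (ℕ → f.R)) × (Fin s → 𝒴)) =>
      f.prediction p.1.2 p.1.1
        (B.response y₀ (Function.update d i (y₀, fun _ => extendSeq y₀ p.2)) p.1.1) t)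
      (fun t => ?_) ((B.measurable_visitTime i s).comp hx) measurable_id
    refine f.measurable_prediction (by fun_prop) hx (fun u => ?_) t
    refine B.measurable_response y₀ (fun j => ?_) (fun j t s' => ?_) hx u
    · by_cases h : j = i
      · subst h; simp
      · simp [Function.update_of_ne h]
    · by_cases h : j = i
      · subst h
        simp only [Function.update_self]
        exact (measurable_pi_apply s').comp ((measurable_extendSeq y₀ s).comp measurable_snd)
      · simp [Function.update_of_ne h]

/-- Before the visit number `s` the simulated and the actual responses coincide, and a prediction
depends only on earlier responses. -/
theorem simulationRule_predict {f : OnlineLearningRule 𝒳 𝒴} {B : BlockScheme 𝒳} {y₀ : 𝒴}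
    {D d : ℕ → 𝒴 × (ℕ → ℕ → 𝒴)} {i s : ℕ} {x : ℕ → 𝒳} (r : ℕ → f.R)
    (Q : ProbabilityMeasure ((ℕ → 𝒳) × (ℕ → f.R)))
    (hd : ∀ j < i, d j = D j) (h : B.horizon i x < B.time (i + 1))
    (hs : s < B.plays (B.horizon i x)) :
    (simulationRule f B y₀ d i Q).predict s ((x, r), fun s' : Fin s => (D i).2 (B.horizon i x) s')
      = f.prediction r x (B.response y₀ D x) (B.visitTime i s x) :=
  f.prediction_congr r x fun _ hv => BlockScheme.response_eq_of_lt hd h hs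
    (fun _ hs' => extendSeq_of_lt y₀ _ hs') hv

/-- The average regret of `f` at the horizon of the block `i`, if it is in the block. -/
noncomputable def horizonRegret (f : OnlineLearningRule 𝒳 𝒴) (ℓ : 𝒴 → 𝒴 → ℝ) (B : BlockScheme 𝒳)
    (y₀ : 𝒴) (D : ℕ → 𝒴 × (ℕ → ℕ → 𝒴)) (i : ℕ) (p : (ℕ → 𝒳) × (ℕ → f.R)) : ℝ :=
  {p : (ℕ → 𝒳) × (ℕ → f.R) | B.horizon i p.1 < B.time (i + 1)}.indicator
    (fun p => timeAverage (fun u =>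
      ℓ (f.prediction p.2 p.1 (B.response y₀ D p.1) u) (B.response y₀ D p.1 u)
        - ℓ (D (B.level (p.1 u))).1 (B.response y₀ D p.1 u)) (B.horizon i p.1)) p

variable {f : OnlineLearningRule 𝒳 𝒴} {ℓ : 𝒴 → 𝒴 → ℝ} {B : BlockScheme 𝒳} {y₀ : 𝒴}
  {D : ℕ → 𝒴 × (ℕ → ℕ → 𝒴)} {i : ℕ} {C : ℝ}

theorem measurableSet_horizon_lt (i : ℕ) :
    MeasurableSet {p : (ℕ → 𝒳) × (ℕ → f.R) | B.horizon i p.1 < B.time (i + 1)} :=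
  ((B.measurable_horizon i).comp measurable_fst) (measurableSet_Iio (a := B.time (i + 1)))

theorem measurable_horizonRegret (hℓ : Measurable fun p : 𝒴 × 𝒴 => ℓ p.1 p.2) :
    Measurable (horizonRegret f ℓ B y₀ D i) := by
  refine Measurable.indicator ?_ (measurableSet_horizon_lt i)
  refine measurable_apply_index (F := fun t (p : (ℕ → 𝒳) × (ℕ → f.R)) => timeAverage (fun u =>
      ℓ (f.prediction p.2 p.1 (B.response y₀ D p.1) u) (B.response y₀ D p.1 u)
        - ℓ (D (B.level (p.1 u))).1 (B.response y₀ D p.1 u)) t) (fun t => ?_)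
    ((B.measurable_horizon i).comp measurable_fst) measurable_id
  have hr : ∀ u, Measurable fun p : (ℕ → 𝒳) × (ℕ → f.R) => B.response y₀ D p.1 u := fun u =>
    B.measurable_response (D := fun _ => D) y₀ (fun _ => measurable_const)
      (fun _ _ _ => measurable_const) measurable_fst u
  refine measurable_timeAverage (fun u => Measurable.sub ?_ ?_) t
  · exact hℓ.comp ((f.measurable_prediction measurable_snd measurable_fst hr u).prodMk (hr u))
  · exact hℓ.comp (((measurable_from_top (f := fun j => (D j).1)).comp
      ((B.measurable_level_apply u).comp measurable_fst)).prodMk (hr u))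

theorem abs_horizonRegret_le (hC : ∀ y y', ℓ y y' ∈ Set.Icc 0 C) (p : (ℕ → 𝒳) × (ℕ → f.R)) :
    |horizonRegret f ℓ B y₀ D i p| ≤ C := by
  by_cases h : p ∈ {p : (ℕ → 𝒳) × (ℕ → f.R) | B.horizon i p.1 < B.time (i + 1)}
  · rw [horizonRegret, Set.indicator_of_mem h]
    exact abs_timeAverage_sub_le hC _ _ _ _
  · rw [horizonRegret, Set.indicator_of_notMem h, abs_zero]
    exact (hC y₀ y₀).1.trans (hC y₀ y₀).2

/-- The regret of the simulating rule on the values played in the block `i` for the horizon `t`. -/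
noncomputable def simulatedRegret (f : OnlineLearningRule 𝒳 𝒴) (ℓ : 𝒴 → 𝒴 → ℝ) (B : BlockScheme 𝒳)
    (y₀ : 𝒴) (D d : ℕ → 𝒴 × (ℕ → ℕ → 𝒴)) (i : ℕ) (Q : ProbabilityMeasure ((ℕ → 𝒳) × (ℕ → f.R)))
    (t : ℕ) (p : (ℕ → 𝒳) × (ℕ → f.R)) : ℝ :=
  ∑ s ∈ Finset.range (B.plays t),
    (ℓ ((simulationRule f B y₀ d i Q).predict s (p, fun s' : Fin s => (D i).2 t s')) ((D i).2 t s)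
      - ℓ (D i).1 ((D i).2 t s))

/-- The times before the block cost at most `C * B.time i`, and the horizon is at least `(i + 1) *
B.time i`; dividing gives the error `C / (i + 1)`. -/
theorem horizonRegret_ge (hC : ∀ y y', ℓ y y' ∈ Set.Icc 0 C) (hℓ0 : ∀ y, ℓ y y = 0)
    {d : ℕ → 𝒴 × (ℕ → ℕ → 𝒴)} (hd : ∀ j < i, d j = D j)
    (Q : ProbabilityMeasure ((ℕ → 𝒳) × (ℕ → f.R))) {p : (ℕ → 𝒳) × (ℕ → f.R)}
    (h : B.horizon i p.1 < B.time (i + 1)) :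
    -(C / (i + 1)) + 1 / (B.horizon i p.1 : ℝ) *
        simulatedRegret f ℓ B y₀ D d i Q (B.horizon i p.1) p
      ≤ horizonRegret f ℓ B y₀ D i p := by
  have hC0 : 0 ≤ C := (hC y₀ y₀).1.trans (hC y₀ y₀).2
  rw [horizonRegret, Set.indicator_of_mem (by exact h), timeAverage]
  have hle := B.le_horizon i p.1 h
  have hpos : 0 < B.horizon i p.1 := lt_of_lt_of_le (by positivity) hle
  have hpos' : (0 : ℝ) < B.horizon i p.1 := by exact_mod_cast hpos
  have hsum := BlockScheme.sum_regret_ge hC hℓ0 (y₀ := y₀) (D := D) h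
    (fun u => f.prediction p.2 p.1 (B.response y₀ D p.1) u)
  have heq : simulatedRegret f ℓ B y₀ D d i Q (B.horizon i p.1) p
      = ∑ s ∈ Finset.range (B.plays (B.horizon i p.1)),
        (ℓ (f.prediction p.2 p.1 (B.response y₀ D p.1) (B.visitTime i s p.1))
            ((D i).2 (B.horizon i p.1) s) - ℓ (D i).1 ((D i).2 (B.horizon i p.1) s)) := by
    refine Finset.sum_congr rfl fun s hs => ?_
    have := simulationRule_predict (y₀ := y₀) p.2 Q hd h (Finset.mem_range.1 hs)
    rw [← this]
  rw [heq]
  have h2 := mul_le_mul_of_nonneg_left hsum (by positivity : 0 ≤ 1 / (B.horizon i p.1 : ℝ))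
  refine le_trans ?_ h2
  rw [mul_add]
  refine add_le_add ?_ le_rfl
  have h3 : ((i : ℝ) + 1) * B.time i ≤ B.horizon i p.1 := by
    have : (i + 1) * B.time i ≤ B.horizon i p.1 := le_trans (by gcongr; omega) hle
    exact_mod_cast this
  rw [one_div, mul_neg, neg_le_neg_iff, inv_mul_eq_div, div_le_div_iff₀ hpos' (by positivity)]
  nlinarith

theorem integrable_simulatedRegret (hC : ∀ y y', ℓ y y' ∈ Set.Icc 0 C)
    (hℓ : Measurable fun p : 𝒴 × 𝒴 => ℓ p.1 p.2) {d : ℕ → 𝒴 × (ℕ → ℕ → 𝒴)}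
    (Q : ProbabilityMeasure ((ℕ → 𝒳) × (ℕ → f.R))) (t : ℕ)
    (P : Measure ((ℕ → 𝒳) × (ℕ → f.R))) [IsProbabilityMeasure P] :
    Integrable (simulatedRegret f ℓ B y₀ D d i Q t) P := by
  refine integrable_finsetSum _ fun s _ => Integrable.sub ?_ (integrable_const _)
  refine integrable_of_abs_le (C := C) ?_ fun p => ?_
  · exact ((simulationRule f B y₀ d i Q).measurable_loss_predict hℓ s).comp
      (measurable_prodMk_left (x := (D i).2 t))
  · rw [abs_of_nonneg (hC _ _).1]; exact (hC _ _).2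

theorem integral_simulatedRegret (hC : ∀ y y', ℓ y y' ∈ Set.Icc 0 C)
    (hℓ : Measurable fun p : 𝒴 × 𝒴 => ℓ p.1 p.2) {d : ℕ → 𝒴 × (ℕ → ℕ → 𝒴)}
    (Q : ProbabilityMeasure ((ℕ → 𝒳) × (ℕ → f.R))) (t : ℕ) :
    ∫ p, simulatedRegret f ℓ B y₀ D d i Q t p ∂(Q : Measure _)
      = ∑ s ∈ Finset.range (B.plays t), ((simulationRule f B y₀ d i Q).expectedLoss ℓ s ((D i).2 t)
        - ℓ (D i).1 ((D i).2 t s)) := by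
  have hi := fun s => (simulationRule f B y₀ d i Q).integrable_loss_predict hℓ hC s ((D i).2 t)
  have hi' : ∀ s ∈ Finset.range (B.plays t), Integrable (fun p : (ℕ → 𝒳) × (ℕ → f.R) =>
      ℓ ((simulationRule f B y₀ d i Q).predict s (p, fun s' : Fin s => (D i).2 t s')) ((D i).2 t s)
      - ℓ (D i).1 ((D i).2 t s)) (Q : Measure _) := fun s _ => (hi s).sub (integrable_const _)
  unfold simulatedRegret
  rw [integral_finsetSum _ hi']
  refine Finset.sum_congr rfl fun s _ => ?_
  have hconst : ∫ _ : (ℕ → 𝒳) × (ℕ → f.R), ℓ (D i).1 ((D i).2 t s) ∂(Q : Measure _)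
      = ℓ (D i).1 ((D i).2 t s) := by simp
  exact (integral_sub (hi s) (integrable_const _)).trans (congrArg₂ (· - ·) rfl hconst)

/-- The expected average regret at the horizon of the block `i`. -/
theorem integral_horizonRegret_ge (hC : ∀ y y', ℓ y y' ∈ Set.Icc 0 C) (hℓ0 : ∀ y, ℓ y y = 0)
    (hℓ : Measurable fun p : 𝒴 × 𝒴 => ℓ p.1 p.2) {d : ℕ → 𝒴 × (ℕ → ℕ → 𝒴)}
    (hd : ∀ j < i, d j = D j) (Q : Measure ((ℕ → 𝒳) × (ℕ → f.R))) [IsProbabilityMeasure Q]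
    {η c δ : ℝ} (hη : 0 < η) (hc : 0 < c) (hplays : ∀ t, c * t ≤ B.plays t)
    (hδ : δ ≤ Q.real {p | B.horizon i p.1 < B.time (i + 1)})
    (hD : ∀ t < B.time (i + 1), η * B.plays t ≤ ∑ s ∈ Finset.range (B.plays t),
      ((simulationRule f B y₀ d i (condLaw Q {p | B.horizon i p.1 = t})).expectedLoss ℓ s ((D i).2 t)
        - ℓ (D i).1 ((D i).2 t s))) :
    δ * (η * c) - C / (i + 1) ≤ ∫ p, horizonRegret f ℓ B y₀ D i p ∂Q := by
  have hC0 : 0 ≤ C := (hC y₀ y₀).1.trans (hC y₀ y₀).2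
  -- Splitting by the value of the horizon: on each piece the number of plays and the hard values
  -- are fixed, and the conditional law is the one used by the simulating rule.
  set E : ℕ → Set ((ℕ → 𝒳) × (ℕ → f.R)) := fun t => {p | B.horizon i p.1 = t} with hE
  have hEm : ∀ t, MeasurableSet (E t) := fun t =>
    ((B.measurable_horizon i).comp measurable_fst) (measurableSet_singleton t)
  set φ : ℕ → (ℕ → 𝒳) × (ℕ → f.R) → ℝ := fun t p => -(C / (i + 1)) + 1 / (t : ℝ) *
    simulatedRegret f ℓ B y₀ D d i (condLaw Q (E t)) t p with hφ
  have hφi : ∀ t, Integrable (φ t) Q := fun t =>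
    (integrable_const _).add ((integrable_simulatedRegret hC hℓ _ t Q).const_mul _)
  have hpt : ∀ p, ∑ t ∈ Finset.range (B.time (i + 1)), (E t).indicator (φ t) p
      ≤ horizonRegret f ℓ B y₀ D i p := by
    intro p
    by_cases h : B.horizon i p.1 < B.time (i + 1)
    · rw [Finset.sum_eq_single (B.horizon i p.1)
        (fun t _ ht => Set.indicator_of_notMem (fun hh => ht (by exact hh.symm)) _)
        (fun hn => absurd (Finset.mem_range.2 h) hn), Set.indicator_of_mem (by exact rfl)]
      exact horizonRegret_ge hC hℓ0 hd _ h
    · rw [Finset.sum_eq_zero fun t ht => Set.indicator_of_notMem (fun hh => h (by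
        have h1 : B.horizon i p.1 = t := hh
        rw [h1]; exact Finset.mem_range.1 ht)) _]
      rw [horizonRegret, Set.indicator_of_notMem (by exact h)]
  have hterm : ∀ t ∈ Finset.range (B.time (i + 1)),
      Q.real (E t) * (η * c - C / (i + 1)) ≤ ∫ p, (E t).indicator (φ t) p ∂Q := by
    intro t ht
    have ht' := Finset.mem_range.1 ht
    rw [integral_indicator (hEm t)]
    rcases Nat.eq_zero_or_pos t with rfl | hpos
    -- A horizon in the block is at least `(i + 1) * (B.time i + 1)`, so the division by `t` below
    -- is legitimate.
    · have : E 0 = ∅ := by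
        refine Set.eq_empty_of_forall_notMem fun p hp => ?_
        have h1 : B.horizon i p.1 = 0 := hp
        have h2 := B.le_horizon i p.1 (by rw [h1]; exact ht')
        rw [h1] at h2
        have : 0 < (i + 1) * (B.time i + 1) := by positivity
        omega
      simp [this]
    · have hpos' : (0 : ℝ) < t := by exact_mod_cast hpos
      have h1 : ∫ p in E t, φ t p ∂Q = Q.real (E t) * (-(C / (i + 1))) + 1 / (t : ℝ) *
          (Q.real (E t) * ∫ p, simulatedRegret f ℓ B y₀ D d i (condLaw Q (E t)) t p
            ∂(condLaw Q (E t) : Measure _)) := by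
        rw [measureReal_mul_integral_condLaw, ← integral_const_mul]
        refine (integral_add (integrable_const _).integrableOn
          ((integrable_simulatedRegret hC hℓ _ t Q).const_mul _).integrableOn).trans ?_
        simp
      rw [h1, integral_simulatedRegret hC hℓ]
      have h2 : η * (c * t) ≤ _ := (mul_le_mul_of_nonneg_left (hplays t) hη.le).trans (hD t ht')
      have h3 := mul_le_mul_of_nonneg_left h2 (measureReal_nonneg (μ := Q) (s := E t))
      have h4 := mul_le_mul_of_nonneg_left h3 (by positivity : 0 ≤ 1 / (t : ℝ))
      have h5 : 1 / (t : ℝ) * (Q.real (E t) * (η * (c * t))) = Q.real (E t) * (η * c) := by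
        field_simp
      rw [h5] at h4
      linarith
  have hmass : ∑ t ∈ Finset.range (B.time (i + 1)), Q.real (E t)
      = Q.real {p | B.horizon i p.1 < B.time (i + 1)} := by
    have hU : {p : (ℕ → 𝒳) × (ℕ → f.R) | B.horizon i p.1 < B.time (i + 1)}
        = ⋃ t ∈ Finset.range (B.time (i + 1)), E t := by
      ext p; simp [hE]
    rw [hU, measureReal_biUnion_finset _ fun t _ => hEm t]
    intro t _ t' _ htt
    refine Set.disjoint_left.2 fun p hp hp' => htt ?_
    have h1 : B.horizon i p.1 = t := hp
    have h2 : B.horizon i p.1 = t' := hp'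
    rw [← h1, h2]
  have hEi : ∀ t ∈ Finset.range (B.time (i + 1)), Integrable ((E t).indicator (φ t)) Q :=
    fun t _ => (hφi t).indicator (hEm t)
  calc δ * (η * c) - C / (i + 1)
      ≤ Q.real {p | B.horizon i p.1 < B.time (i + 1)} * (η * c - C / (i + 1)) := by
        have h1 : Q.real {p : (ℕ → 𝒳) × (ℕ → f.R) | B.horizon i p.1 < B.time (i + 1)} ≤ 1 :=
          measureReal_le_one
        have h2 : 0 ≤ C / ((i : ℝ) + 1) := by positivity
        have h3 := mul_le_mul_of_nonneg_right hδ (mul_pos hη hc).le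
        have h4 := mul_le_mul_of_nonneg_right h1 h2
        linarith
    _ = ∑ t ∈ Finset.range (B.time (i + 1)), Q.real (E t) * (η * c - C / (i + 1)) := by
        rw [← Finset.sum_mul, hmass]
    _ ≤ ∑ t ∈ Finset.range (B.time (i + 1)), ∫ p, (E t).indicator (φ t) p ∂Q :=
        Finset.sum_le_sum hterm
    _ = ∫ p, ∑ t ∈ Finset.range (B.time (i + 1)), (E t).indicator (φ t) p ∂Q :=
        (integral_finsetSum _ hEi).symm
    _ ≤ ∫ p, horizonRegret f ℓ B y₀ D i p ∂Q :=
        integral_mono (integrable_finsetSum _ hEi)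
          (integrable_of_abs_le (measurable_horizonRegret hℓ) (abs_horizonRegret_le hC)) hpt

end Simulation

/-- The sequence defined recursively from its previous terms, padded with `a₀`. -/
noncomputable def recSeq {β : Type*} (F : ℕ → (ℕ → β) → β) (a₀ : β) : ℕ → β
  | i => F i fun j => if _h : j < i then recSeq F a₀ j else a₀

/-! ### Necessity of CS -/

section Lower

variable {𝒳 𝒴 : Type u} [MeasurableSpace 𝒳] [MeasurableSpace 𝒴]

/-- The adversary who answers the path `x` with the values `V x`. -/
noncomputable def deterministicMechanism (R : Type u) [MeasurableSpace R]
    (μ : ProbabilityMeasure (ℕ → 𝒳)) (V : (ℕ → 𝒳) → ℕ → 𝒴) (hV : ∀ t, Measurable fun x => V x t) :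
    AdversarialMechanism R μ 𝒴 where
  Ω := ℕ → 𝒳
  P := μ
  X t x := x t
  measurable_X t := measurable_pi_apply t
  law_X := Measure.map_id
  Y t := Kernel.deterministic (fun p => V p.1 t) ((hV t).comp measurable_fst)

theorem AdversarialMechanism.ae_of_ae_runLaw {R : Type u} [MeasurableSpace R]
    [MeasurableSingletonClass (ℕ → 𝒴)] {μ : ProbabilityMeasure (ℕ → 𝒳)}
    (M : AdversarialMechanism R μ 𝒴) {ν : ℕ → ProbabilityMeasure R} {V : M.Ω → ℕ → 𝒴}
    (hV : ∀ q, M.responseKernel q = Measure.dirac (V q.1))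
    {p : (M.Ω × (ℕ → R)) × (ℕ → 𝒴) → Prop} (h : ∀ᵐ z ∂(M.runLaw ν), p z) :
    ∀ᵐ q ∂((M.P : Measure M.Ω).prod (Measure.infinitePi fun t => (ν t : Measure R))),
      p (q, V q.1) := by
  rw [runLaw] at h
  filter_upwards [Measure.ae_ae_of_ae_compProd h] with q hq
  rwa [hV, ae_dirac_eq] at hq

theorem ae_deterministicMechanism {R : Type u} [MeasurableSpace R]
    [MeasurableSingletonClass (ℕ → 𝒴)] {μ : ProbabilityMeasure (ℕ → 𝒳)} {V : (ℕ → 𝒳) → ℕ → 𝒴}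
    {hV : ∀ t, Measurable fun x => V x t} {ν : ℕ → ProbabilityMeasure R}
    {p : ((ℕ → 𝒳) × (ℕ → R)) × (ℕ → 𝒴) → Prop}
    (h : ∀ᵐ z ∂((deterministicMechanism R μ V hV).runLaw ν), p z) :
    ∀ᵐ q ∂((μ : Measure (ℕ → 𝒳)).prod (Measure.infinitePi fun t => (ν t : Measure R))),
      p (q, V q.1) := by
  refine (deterministicMechanism R μ V hV).ae_of_ae_runLaw (V := V) (fun q => ?_) h
  change Measure.infinitePi (fun t => Kernel.deterministic (fun p : (ℕ → 𝒳) × (Fin t → R) =>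
    V p.1 t) ((hV t).comp measurable_fst) (q.1, fun s : Fin t => q.2 s)) = _
  simp only [Kernel.deterministic_apply]
  exact Measure.infinitePi_dirac _

theorem AdversarialMechanism.empiricallyIntegrable_of_le {R : Type u} [MeasurableSpace R]
    {μ : ProbabilityMeasure (ℕ → 𝒳)} [Nonempty 𝒴] (M : AdversarialMechanism R μ 𝒴)
    (ν : ℕ → ProbabilityMeasure R) {ℓ : 𝒴 → 𝒴 → ℝ} {C : ℝ} (hC : ∀ y y', ℓ y y' ∈ Set.Icc 0 C) :
    M.EmpiricallyIntegrable ν ℓ := by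
  -- The threshold `C + 1` exceeds every loss, so the truncated losses are identically zero.
  refine ⟨Classical.arbitrary 𝒴, fun ε hε => Eventually.of_forall fun z => ⟨C + 1, ?_, ?_⟩⟩
  · have := hC (Classical.arbitrary 𝒴) (Classical.arbitrary 𝒴)
    linarith [this.1, this.2]
  · have h : ∀ y : 𝒴, {y | C + 1 ≤ ℓ (Classical.arbitrary 𝒴) y}.indicator
        (ℓ (Classical.arbitrary 𝒴)) y = 0 := fun y =>
      Set.indicator_of_notMem (fun hy => by
        have h1 : C + 1 ≤ ℓ (Classical.arbitrary 𝒴) y := hy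
        linarith [(hC (Classical.arbitrary 𝒴) y).2]) _
    have h2 : ∀ T, timeAverage (fun _ => (0 : ℝ)) T = 0 := fun T => by simp [timeAverage]
    simp only [h, h2, limsup_const]
    exact_mod_cast hε.le

/-- Without finite-time mean estimation, no rule is universally consistent outside CS. -/
theorem mem_CS_of_universallyConsistent [Nonempty 𝒴] [MeasurableSingletonClass 𝒴]
    {ℓ : 𝒴 → 𝒴 → ℝ} {C : ℝ} (hC : ∀ y y', ℓ y y' ∈ Set.Icc 0 C) (hℓ0 : ∀ y, ℓ y y = 0)
    (hℓ : Measurable fun p : 𝒴 × 𝒴 => ℓ p.1 p.2) (hFT : ¬ FTiME ℓ)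
    {μ : ProbabilityMeasure (ℕ → 𝒳)} {f : OnlineLearningRule 𝒳 𝒴}
    (hf : f.UniversallyConsistent ℓ μ) : μ ∈ CS 𝒳 := by
  by_contra hμ
  obtain ⟨B, c, δ, hc, hδ, hplays, hpos, hmass⟩ := exists_blockScheme_of_notMem_CS hμ
  obtain ⟨η, hη, hcomp⟩ := exists_common_comparator hC hℓ hFT
  set Q : Measure ((ℕ → 𝒳) × (ℕ → f.R)) :=
    (μ : Measure (ℕ → 𝒳)).prod (Measure.infinitePi fun t => (f.ν t : Measure f.R)) with hQ
  let y₀ : 𝒴 := Classical.arbitrary 𝒴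
  let a₀ : 𝒴 × (ℕ → ℕ → 𝒴) := (y₀, fun _ _ => y₀)
  have hstep : ∀ (i : ℕ) (d : ℕ → 𝒴 × (ℕ → ℕ → 𝒴)), ∃ a : 𝒴 × (ℕ → ℕ → 𝒴),
      ∀ t < B.time (i + 1), η * B.plays t ≤ ∑ s ∈ Finset.range (B.plays t),
        ((simulationRule f B y₀ d i (condLaw Q {p | B.horizon i p.1 = t})).expectedLoss ℓ s (a.2 t)
          - ℓ a.1 (a.2 t s)) := by
    intro i d
    -- There is one rule for each possible horizon `t` in the block, all to be defeated with the
    -- same comparator value `b`. The maximum supplies the positive horizon required by the lemma;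
    -- with zero plays the desired inequality is trivial.
    obtain ⟨b, hb⟩ := hcomp
      (fun t => simulationRule f B y₀ d i (condLaw Q {p | B.horizon i p.1 = t}))
      (fun t => max (B.plays t) 1) (fun t => by positivity) (B.time (i + 1))
    have hb' : ∀ t, ∃ y : ℕ → 𝒴, t < B.time (i + 1) →
        η * B.plays t ≤ ∑ s ∈ Finset.range (B.plays t),
        ((simulationRule f B y₀ d i (condLaw Q {p | B.horizon i p.1 = t})).expectedLoss ℓ s y
          - ℓ b (y s)) := by
      intro t
      by_cases ht : t < B.time (i + 1) ∧ 0 < B.plays t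
      · obtain ⟨y, hy⟩ := hb t ht.1
        rw [max_eq_left ht.2] at hy
        exact ⟨y, fun _ => hy⟩
      · refine ⟨fun _ => y₀, fun h => ?_⟩
        have : B.plays t = 0 := by
          by_contra h0
          exact ht ⟨h, Nat.pos_of_ne_zero h0⟩
        simp [this]
    choose q hq using hb'
    exact ⟨(b, q), hq⟩
  choose F hF using hstep
  -- The rules simulated in block `i` involve the data of earlier levels, so the data are chosen
  -- recursively.
  set D := recSeq F a₀ with hD
  let d : ℕ → ℕ → 𝒴 × (ℕ → ℕ → 𝒴) := fun i j => if _h : j < i then D j else a₀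
  have hDi : ∀ i, D i = F i (d i) := fun i => by rw [hD, recSeq]
  have hVm : ∀ t, Measurable fun x : ℕ → 𝒳 => B.response y₀ D x t := fun t =>
    B.measurable_response (D := fun _ => D) y₀ (fun _ => measurable_const)
      (fun _ _ _ => measurable_const) measurable_id t
  have hhm : Measurable fun x : 𝒳 => (D (B.level x)).1 :=
    (measurable_from_top (f := fun j => (D j).1)).comp B.measurable_level
  let M := deterministicMechanism f.R μ (B.response y₀ D) hVm
  have hae := ae_deterministicMechanism (hf M (M.empiricallyIntegrable_of_le f.ν hC) _ hhm)
  -- The horizon of block `i`, if in the block, is at least `i`, so consistency against the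
  -- comparator `(D (B.level x)).1` controls the regret there. The positive part is taken because
  -- consistency only bounds the regret from above.
  have hlim : ∀ᵐ p ∂Q, Tendsto (fun i => max (horizonRegret f ℓ B y₀ D i p) 0) atTop (𝓝 0) := by
    filter_upwards [hae] with p hp
    refine Metric.tendsto_atTop.2 fun ε hε => ?_
    have hlt := eventually_lt_of_limsup_lt (lt_of_le_of_lt hp (show (0 : EReal) < (ε : EReal) by
      exact_mod_cast hε)) (by isBoundedDefault)
    obtain ⟨N, hN⟩ := eventually_atTop.1 hlt
    refine ⟨N, fun i hi => ?_⟩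
    rw [Real.dist_0_eq_abs, abs_of_nonneg (le_max_right _ _)]
    refine max_lt ?_ hε
    by_cases h : B.horizon i p.1 < B.time (i + 1)
    · rw [horizonRegret, Set.indicator_of_mem (by exact h)]
      have h1 := B.le_horizon i p.1 h
      have h2 := hN (B.horizon i p.1) (by nlinarith)
      exact_mod_cast h2
    · rwa [horizonRegret, Set.indicator_of_notMem (by exact h)]
  -- Dominated convergence gives expectations tending to zero, while `hlow` keeps them above `δ * (η
  -- * c) - C / (i + 1)`.
  have hint := tendsto_integral_of_dominated_convergence (μ := Q) (fun _ => C)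
    (fun i => ((measurable_horizonRegret hℓ).max measurable_const).aestronglyMeasurable)
    (integrable_const _) (fun i => Eventually.of_forall fun p => by
      have h1 := abs_horizonRegret_le (B := B) (y₀ := y₀) (D := D) (i := i) hC p
      rw [Real.norm_eq_abs, abs_of_nonneg (le_max_right _ _)]
      exact max_le (abs_le.1 h1).2 ((hC y₀ y₀).1.trans (hC y₀ y₀).2)) hlim
  rw [integral_zero] at hint
  have hlow : ∀ i : ℕ, δ * (η * c) - C / (i + 1) ≤
      ∫ p, max (horizonRegret f ℓ B y₀ D i p) 0 ∂Q := by
    intro i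
    have hδ' : δ ≤ Q.real {p | B.horizon i p.1 < B.time (i + 1)} := by
      have h1 : Q.real {p | B.horizon i p.1 < B.time (i + 1)}
          = (μ : Measure (ℕ → 𝒳)).real {x | B.horizon i x < B.time (i + 1)} := by
        have h2 : {p : (ℕ → 𝒳) × (ℕ → f.R) | B.horizon i p.1 < B.time (i + 1)}
            = {x | B.horizon i x < B.time (i + 1)} ×ˢ Set.univ := by
          ext p; simp
        rw [h2, measureReal_prod_prod]
        simp
      rw [h1]
      exact hmass i
    refine (integral_horizonRegret_ge hC hℓ0 hℓ (d := d i) (fun j hj => by simp [d, hj]) Q hη hc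
      hplays hδ' (fun t ht => ?_)).trans (integral_mono
        (integrable_of_abs_le (measurable_horizonRegret hℓ) (abs_horizonRegret_le hC))
        (integrable_of_abs_le (C := C) ((measurable_horizonRegret hℓ).max measurable_const)
          fun p => ?_) fun p => le_max_left _ _)
    · rw [hDi]
      exact hF i (d i) t ht
    · have h1 := abs_horizonRegret_le (B := B) (y₀ := y₀) (D := D) (i := i) hC p
      rw [abs_of_nonneg (le_max_right _ _)]
      exact max_le (abs_le.1 h1).2 ((hC y₀ y₀).1.trans (hC y₀ y₀).2)
  have hz : Tendsto (fun i : ℕ => δ * (η * c) - C / ((i : ℝ) + 1)) atTop (𝓝 (δ * (η * c) - 0)) :=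
    tendsto_const_nhds.sub (by
      simpa [div_eq_mul_inv] using (tendsto_one_div_add_atTop_nhds_zero_nat (𝕜 := ℝ)).const_mul C)
  have := le_of_tendsto_of_tendsto' hz hint hlow
  rw [sub_zero] at this
  have : 0 < δ * (η * c) := by positivity
  linarith

end Lower

theorem mainTheorem6 {𝒳 𝒴 : Type u}
    [MetricSpace 𝒳] [TopologicalSpace.SeparableSpace 𝒳] [MeasurableSpace 𝒳] [BorelSpace 𝒳]
    [MetricSpace 𝒴] [TopologicalSpace.SeparableSpace 𝒴] [MeasurableSpace 𝒴] [BorelSpace 𝒴]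
    [Nonempty 𝒴] (α : ℝ) (hα : 1 ≤ α)
    (hbdd : ∃ C : ℝ, ∀ y y' : 𝒴, powLoss α y y' ≤ C)
    (hFT : ¬ FTiME (powLoss α : 𝒴 → 𝒴 → ℝ)) :
    SOLAR 𝒳 (powLoss α : 𝒴 → 𝒴 → ℝ) = CS 𝒳 ∧
      ∃ f : OnlineLearningRule 𝒳 𝒴,
        OptimisticallyUniversal (powLoss α : 𝒴 → 𝒴 → ℝ) f ∧
          ∀ μ ∈ CS 𝒳, f.UniversallyConsistent (powLoss α : 𝒴 → 𝒴 → ℝ) μ := by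
  have hα0 : 0 < α := one_pos.trans_le hα
  obtain ⟨f, hf⟩ := exists_universallyConsistent_of_CS (𝒳 := 𝒳) hα0 hbdd
  obtain ⟨C, hC⟩ := hbdd
  have hsub : SOLAR 𝒳 (powLoss α : 𝒴 → 𝒴 → ℝ) ⊆ CS 𝒳 := fun μ ⟨g, hg⟩ =>
    mem_CS_of_universallyConsistent (fun y y' => ⟨powLoss_nonneg α y y', hC y y'⟩)
      (powLoss_self hα0.ne') (measurable_powLoss α) hFT hg
  exact ⟨hsub.antisymm fun μ hμ => ⟨f, hf μ hμ⟩, f, fun μ hμ => hf μ (hsub hμ), hf⟩
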